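/- Let $P=\{u\in\mathbb R^n : \ell_j(u)=\langle u,\boldsymbol b_j\rangle-\lambda_j\ge 0,\ j=1,\dots,m\}$ be a labeled polytope: a bounded, full-dimensional, simple rational convex polytope with exactly $m$ facets, with stacky vectors $\boldsymbol b_j=c_j\boldsymbol v_j\in N=\mathbb Z^n$, where $\boldsymbol v_j$ is the primitive inward normal of the $j$-th facet and the label $c_j$ is a positive integer. Let $\Sigma$ be the normal fan of $P$, let $U(\Sigma)\subset\mathbb C^m$ be the set of points $z$ such that $\{\boldsymbol b_j : z_j=0\}$ spans a cone of $\Sigma$, let $K_{\mathbb C}$ be the kernel of the map $(\mathbb C^*)^m\to(\mathbb C^*)^n$, $t\mapsto(\prod_j t_j^{b_{j1}},\dots,\prod_j t_j^{b_{jn}})$, and let $\mathcal X=U(\Sigma)/K_{\mathbb C}$ be the associated compact toric orbifold. It is uniformized, for each $n$-dimensional cone $\sigma$ with stacky vectors $\boldsymbol b_{i_1},\dots,\boldsymbol b_{i_n}$ spanning the sublattice $N_{\boldsymbol b_\sigma}\subset N$, by $\mathbb C^n$ with the group $N/N_{\boldsymbol b_\sigma}$; the class of $g=\sum_k g_k\boldsymbol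 b_{i_k}\in N$ acts by $x_k\mapsto e^{2\pi i g_k}x_k$. For $u$ in the interior of $P$ let $L(u)\subset\mathcal X$ be the Lagrangian torus fiber, that is, the set of points with homogeneous coordinates satisfying $|z_j|^2/2=\ell_j(u)$ for all $j$. Let $Box$ be the set of all lattice vectors $\nu=\sum_k c_k\boldsymbol b_{i_k}\in N$ with $c_k\in[0,1)$, where $\boldsymbol b_{i_1},\dots,\boldsymbol b_{i_n}$ are the stacky vectors of an $n$-dimensional cone of $\Sigma$, and let $Box'=Box\setminus\{0\}$; it indexes the nontrivial twisted sectors of $\mathcal X$. Consider holomorphic (good, representable) orbi-discs $w:(\mathcal D,\partial\mathcal D)\to(\mathcal X,L(u))$ whose source is the closed unit disc with exactly one interior orbifold point $z^+$, of some order $k\ge2$. Thus $w$ lifts locally to holomorphic maps into uniformizing charts away from $z^+$, and near $z^+$ the composition of $w$ with $\zeta\mapsto z^++\zeta^k$ has a holomorphic lift into a chart $\mathbb C^n$ which is equivariant for an injective homomorphism $\phi:\mathbb Z/k\to N/N_{\boldsymbol b_\sigma}$. The twisted sector of $w$ is the $\nu\in Box$ which represents $\phi(1)$. The desingularized Maslov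 index of $w$ is the Maslov index of the bundle pair $(|w^*T\mathcal X|,(w|_{\partial\mathcal D})^*TL(u))$, where $|w^*T\mathcal X|$ is the desingularization of the orbi-bundle $w^*T\mathcal X$. Then each such orbi-disc of desingularized Maslov index $0$ has exactly one twisted sector $\nu$, this $\nu$ lies in $Box'$, and the assignment $w\mapsto\nu$ induces a bijection from the set of these orbi-discs, modulo the $T^n$-action on $\mathcal X$ and automorphisms of the source disc (biholomorphisms of the disc which carry orbifold point to orbifold point and preserve its order), onto $Box'$. Moreover, each such $w$ with sector $\nu$ is given in homogeneous coordinates by $$w(z)=\big[a_1\,\varphi(z)^{c_1},\dots,a_m\,\varphi(z)^{c_m}\big],\qquad \varphi(z)=\frac{z-z^+}{1-\overline{z^+}z},$$ with $|a_j|^2/2=\ell_j(u)$, where $\nu=\sum_j c_j\boldsymbol b_j$, $c_j\in[0,1)$, the $\boldsymbol b_j$ with $c_j\ne0$ span a cone of $\Sigma$, each $kc_j$ is an integer, and $\varphi(z)^{c_j}$ means $\zeta^{kc_j}$ for a $k$-th root $\zeta$ of $\varphi(z)$, the same for all $j$ (the resulting point of $\mathcal X$ does not depend on the choice of $\zeta$).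 In particular, after an automorphism moving $z^+$ to $0$, $w=(a_1z^{c_1},\dots,a_mz^{c_m})$. -/

import Mathlib

open scoped Topology

noncomputable section

/-- The numerical data of a labeled polytope in `ℝⁿ` with `m` facets: inward normals `v_j`,
labels `c_j`, and the constants `λ_j`. -/
structure PolytopeData (n m : ℕ) where
  normal : Fin m → Fin n → ℤ
  label : Fin m → ℕ
  const : Fin m → ℝ

/-- The closed unit disc `D²`. -/
abbrev ClosedDisc : Type := Metric.closedBall (0 : ℂ) 1

namespace PolytopeData

variable {n m : ℕ}

/-! ### Labeled polytopes -/

/-- The stacky vectors `b_j = c_j v_j ∈ N = ℤⁿ`. -/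
def stacky (P : PolytopeData n m) (j : Fin m) : Fin n → ℤ := fun i => P.label j * P.normal j i

/-- `ℓ_j(u) = ⟨u, b_j⟩ - λ_j`. -/
def ell (P : PolytopeData n m) (j : Fin m) (u : Fin n → ℝ) : ℝ :=
  ∑ i, u i * (P.stacky j i : ℝ) - P.const j

/-- The polytope `{u | ℓ_j(u) ≥ 0 for all j}` in `M_ℝ = ℝⁿ`. -/
def polytope (P : PolytopeData n m) : Set (Fin n → ℝ) := {u | ∀ j, 0 ≤ P.ell j u}

/-- The data describe a simple rational convex polytope with exactly `m` facets, primitive inward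
normals `v_j` and positive integer labels `c_j`. -/
structure IsLabeledPolytope (P : PolytopeData n m) : Prop where
  primitive : ∀ j, Finset.univ.gcd (P.normal j) = 1
  label_pos : ∀ j, 0 < P.label j
  bounded : Bornology.IsBounded P.polytope
  interior_nonempty : (interior P.polytope).Nonempty
  /-- The set `{ℓ_j = 0}` cuts out a facet, different from the other ones: it has a point that lies
  on no other facet. -/
  facet : ∀ j, ∃ u, P.ell j u = 0 ∧ ∀ k, k ≠ j → 0 < P.ell k u
  /-- Exactly `n` facets meet at every vertex. -/
  simple : ∀ u ∈ Set.extremePoints ℝ P.polytope, {j | P.ell j u = 0}.ncard = n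

/-! ### The fan and the toric orbifold as a complex quotient -/

/-- The set `{b_j | j ∈ I}` spans a cone of the normal fan `Σ(P)`: the facets with labels
in `I` have a common point. -/
def IsCone (P : PolytopeData n m) (I : Set (Fin m)) : Prop :=
  ∃ u ∈ P.polytope, ∀ j ∈ I, P.ell j u = 0

theorem IsCone.mono {P : PolytopeData n m} {I J : Set (Fin m)} (h : P.IsCone J) (hIJ : I ⊆ J) :
    P.IsCone I := by
  obtain ⟨u, hu, h⟩ := h
  exact ⟨u, hu, fun j hj => h j (hIJ hj)⟩

/-- An `n`-dimensional cone of the fan, with an ordering `b_{i_1}, …, b_{i_n}` of its stacky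
vectors. -/
structure MaxCone (P : PolytopeData n m) where
  idx : Fin n ↪ Fin m
  isCone : P.IsCone (Set.range idx)

/-- `U(Σ) = ⋃_σ U(σ) ⊆ ℂᵐ`: the points whose vanishing coordinates span a cone of the fan. -/
def U (P : PolytopeData n m) : Set (Fin m → ℂ) := {z | P.IsCone {j | z j = 0}}

/-- The group `K_ℂ`, the kernel of `(ℂ*)ᵐ → (ℂ*)ⁿ`, `t ↦ (∏_j t_j ^ b_{j i})_i`. -/
def KC (P : PolytopeData n m) : Subgroup (Fin m → ℂˣ) where
  carrier := {t | ∀ i, ∏ j, t j ^ P.stacky j i = 1}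
  mul_mem' := by
    intro s t hs ht i
    simp only [Set.mem_ofPred_eq] at hs ht
    simp [mul_zpow, Finset.prod_mul_distrib, hs i, ht i]
  one_mem' := by intro i; simp
  inv_mem' := by
    intro s hs i
    simp only [Set.mem_ofPred_eq] at hs
    simp [Finset.prod_inv_distrib, hs i]

/-- Two points of `U(Σ)` are equivalent when they lie in one orbit of `K_ℂ`. -/
def orbitSetoid (P : PolytopeData n m) : Setoid P.U where
  r z z' := ∃ t ∈ P.KC, ∀ j, z'.1 j = (t j : ℂ) * z.1 j
  iseqv :=
    { refl := fun _ => ⟨1, P.KC.one_mem, by simp⟩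
      symm := by
        rintro z z' ⟨t, ht, h⟩
        exact ⟨t⁻¹, P.KC.inv_mem ht, fun j => by simp [h j]⟩
      trans := by
        rintro x y z ⟨t, ht, h⟩ ⟨s, hs, h'⟩
        exact ⟨s * t, P.KC.mul_mem hs ht, fun j => by simp [h j, h' j, mul_assoc]⟩ }

/-- The underlying space of the compact toric orbifold `U(Σ) / K_ℂ`. -/
def X (P : PolytopeData n m) : Type := Quotient P.orbitSetoid

instance (P : PolytopeData n m) : TopologicalSpace P.X :=
  inferInstanceAs (TopologicalSpace (Quotient P.orbitSetoid))

/-- The point of the toric orbifold with given homogeneous coordinates. -/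
def point (P : PolytopeData n m) (z : Fin m → ℂ) (hz : z ∈ P.U) : P.X :=
  Quotient.mk P.orbitSetoid ⟨z, hz⟩

theorem torus_smul_mem (P : PolytopeData n m) (t : Fin m → Circle) (z : P.U) :
    (fun j => (t j : ℂ) * z.1 j) ∈ P.U := by
  have h := z.2
  simpa [U] using h

/-- The action of the compact torus on the toric orbifold. It is written with elements of
`Tᵐ = (S¹)ᵐ` and factors through `Tⁿ = Tᵐ / K`. -/
def torusAct (P : PolytopeData n m) (t : Fin m → Circle) : P.X → P.X :=
  Quotient.map' (s₁ := P.orbitSetoid) (s₂ := P.orbitSetoid)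
    (fun z => ⟨fun j => (t j : ℂ) * z.1 j, P.torus_smul_mem t z⟩) (by
      rintro z z' ⟨s, hs, h⟩
      exact ⟨s, hs, fun j => by simp only [h j]; ring⟩)

theorem torusAct_one (P : PolytopeData n m) (x : P.X) : P.torusAct 1 x = x := by
  induction x using Quotient.inductionOn with
  | h z =>
    refine Quotient.sound' ⟨1, P.KC.one_mem, fun j => by simp⟩

theorem torusAct_mul (P : PolytopeData n m) (s t : Fin m → Circle) (x : P.X) :
    P.torusAct (s * t) x = P.torusAct s (P.torusAct t x) := by
  induction x using Quotient.inductionOn with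
  | h z =>
    refine Quotient.sound' ⟨1, P.KC.one_mem, fun j => by simp [mul_assoc]⟩

/-- The Lagrangian torus fiber `L(u)` of the moment map: the points that have homogeneous
coordinates with `|z_j|² / 2 = ℓ_j(u)` for all `j`. -/
def fiber (P : PolytopeData n m) (u : Fin n → ℝ) : Set P.X :=
  {x | ∃ (z : Fin m → ℂ) (hz : z ∈ P.U), x = P.point z hz ∧ ∀ j, ‖z j‖ ^ 2 / 2 = P.ell j u}

/-! ### Uniformizing charts

The chart of an `n`-dimensional cone `σ` is `U'_σ = ℂⁿ` with the group `N / N_{b_σ}`. -/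

/-- The homogeneous coordinates of the point of `U'_σ` with coordinates `x`: these are `x` on the
cone, and `1` off the cone. -/
def chartCoord (P : PolytopeData n m) (s : P.MaxCone) (x : Fin n → ℂ) : Fin m → ℂ :=
  Function.extend s.idx x 1

theorem chartCoord_mem (P : PolytopeData n m) (s : P.MaxCone) (x : Fin n → ℂ) :
    P.chartCoord s x ∈ P.U := by
  refine s.isCone.mono ?_
  intro j hj
  by_contra hjs
  have h1 : P.chartCoord s x j = 1 := by
    have hne : ¬ ∃ a, s.idx a = j := by simpa using hjs
    simp [chartCoord, Function.extend_apply' _ _ _ hne]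
  have h0 : P.chartCoord s x j = 0 := hj
  exact one_ne_zero (h1.symm.trans h0)

/-- The uniformizing map `U'_σ = ℂⁿ → X`. -/
def chart (P : PolytopeData n m) (s : P.MaxCone) (x : Fin n → ℂ) : P.X :=
  P.point (P.chartCoord s x) (P.chartCoord_mem s x)

/-- The sublattice `N_{b_σ}` of `N` that is spanned by the stacky vectors of the cone. -/
def coneLattice (P : PolytopeData n m) (s : P.MaxCone) : AddSubgroup (Fin n → ℤ) :=
  AddSubgroup.closure (Set.range fun j => P.stacky (s.idx j))

/-- The pairings `⟨ν, u_{i_j}⟩` with the basis dual to `b_{i_1}, …, b_{i_n}`, that is, the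
coordinates of `ν` in the basis `b_{i_1}, …, b_{i_n}`. -/
def dualCoord (P : PolytopeData n m) (s : P.MaxCone) (ν : Fin n → ℤ) : Fin n → ℝ :=
  (Matrix.of fun i j => (P.stacky (s.idx j) i : ℝ))⁻¹.mulVec fun i => (ν i : ℝ)

/-- The action of (the class in `N / N_{b_σ}` of) a lattice vector on the chart,
`g · x_j = exp(2πi ⟨g, u_{i_j}⟩) x_j`. -/
def latAct (P : PolytopeData n m) (s : P.MaxCone) (ν : Fin n → ℤ) (x : Fin n → ℂ) : Fin n → ℂ :=
  fun j => Complex.exp (2 * Real.pi * Complex.I * (P.dualCoord s ν j : ℂ)) * x j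

/-- `τ` is, near `x`, a holomorphic change of uniformizing charts. -/
def IsTransition (P : PolytopeData n m) (s s' : P.MaxCone) (τ : (Fin n → ℂ) → Fin n → ℂ)
    (x : Fin n → ℂ) : Prop :=
  ∀ᶠ y in 𝓝 x, DifferentiableAt ℂ τ y ∧ P.chart s' (τ y) = P.chart s y

/-! ### Twisted sectors -/

/-- `Box_{b_σ}`, the lattice vectors `∑ c_k b_{i_k}` with `c_k ∈ [0, 1)`. -/
def boxCone (P : PolytopeData n m) (s : P.MaxCone) : Set (Fin n → ℤ) :=
  {ν | ∃ c : Fin n → ℝ, (∀ j, 0 ≤ c j ∧ c j < 1) ∧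
    ∀ i, (ν i : ℝ) = ∑ j, c j * (P.stacky (s.idx j) i : ℝ)}

/-- `Box`, the index set of the components of the inertia orbifold. -/
def box (P : PolytopeData n m) : Set (Fin n → ℤ) := ⋃ s : P.MaxCone, P.boxCone s

/-- `Box' = Box \ {0}`, the index set of the nontrivial twisted sectors. -/
def box' (P : PolytopeData n m) : Set (Fin n → ℤ) := P.box \ {0}

/-! ### Holomorphic orbi-discs with one interior orbifold point -/

/-- A holomorphic lift of a map `w` to a uniformizing chart, over an open subset `V ∩ D²` of the
disc that does not contain the orbifold point `p`. -/
structure LocalLift (P : PolytopeData n m) (w : ClosedDisc → P.X) (p : ℂ) where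
  V : Set ℂ
  isOpen : IsOpen V
  avoids : p ∉ V
  cone : P.MaxCone
  F : ℂ → Fin n → ℂ
  continuousOn : ContinuousOn F (V ∩ Metric.closedBall 0 1)
  holomorphic : DifferentiableOn ℂ F (V ∩ Metric.ball 0 1)
  lifts : ∀ z : ClosedDisc, (z : ℂ) ∈ V → w z = P.chart cone (F z)

/-- A lift of `w` at the orbifold point `p` of order `k`: a holomorphic lift `F` of `w` composed
with the branched covering `ζ ↦ p + ζ ^ k`, equivariant for an injective homomorphism `φ` from
`ℤ / k` to the group of the chart. The exponents `wt` record the matrix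
`diag(exp(2πi wt_j / k))` by which the generator of `ℤ / k` acts on the fiber of the pulled back
tangent bundle. -/
structure OrbiLift (P : PolytopeData n m) (w : ClosedDisc → P.X) (p : ℂ) (k : ℕ) where
  ε : ℝ
  ε_pos : 0 < ε
  small : ∀ ζ ∈ Metric.ball (0 : ℂ) ε, p + ζ ^ k ∈ Metric.ball (0 : ℂ) 1
  cone : P.MaxCone
  F : ℂ → Fin n → ℂ
  holomorphic : DifferentiableOn ℂ F (Metric.ball 0 ε)
  lifts : ∀ ζ ∈ Metric.ball (0 : ℂ) ε, ∀ z : ClosedDisc, (z : ℂ) = p + ζ ^ k →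
    w z = P.chart cone (F ζ)
  φ : ZMod k →+ (Fin n → ℤ) ⧸ P.coneLattice cone
  injective : Function.Injective φ
  equivariant : ∀ ν : Fin n → ℤ, (QuotientAddGroup.mk ν : (Fin n → ℤ) ⧸ P.coneLattice cone) = φ 1 →
    ∀ ζ ∈ Metric.ball (0 : ℂ) ε,
      F (Complex.exp (2 * Real.pi * Complex.I / k) * ζ) = P.latAct cone ν (F ζ)
  wt : Fin n → ℕ
  wt_lt : ∀ j, wt j < k
  wt_spec : ∀ ν : Fin n → ℤ, (QuotientAddGroup.mk ν : (Fin n → ℤ) ⧸ P.coneLattice cone) = φ 1 →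
    ∀ x j, P.latAct cone ν x j = Complex.exp (2 * Real.pi * Complex.I * (wt j : ℂ) / k) * x j

/-- A holomorphic (good, representable) orbi-disc in the toric orbifold with boundary on the torus
fiber `L(u)`, whose source is the disc with exactly one interior orbifold point `pt`, uniformized
by a branched covering of degree `order ≥ 2`. -/
structure OrbiDisc (P : PolytopeData n m) (u : Fin n → ℝ) where
  pt : ℂ
  pt_mem : pt ∈ Metric.ball (0 : ℂ) 1
  order : ℕ
  two_le_order : 2 ≤ order
  map : ClosedDisc → P.X
  continuous : Continuous map
  exists_lift : ∀ z : ClosedDisc, (z : ℂ) ≠ pt → ∃ l : P.LocalLift map pt, (z : ℂ) ∈ l.V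
  exists_orbiLift : Nonempty (P.OrbiLift map pt order)
  boundary : ∀ z : ClosedDisc, ‖(z : ℂ)‖ = 1 → map z ∈ P.fiber u

/-- The orbi-disc `D` has the twisted sector `ν`: the homomorphism `ℤ / k → N / N_{b_σ}` at the
orbifold point sends the generator to the class of `ν ∈ Box_{b_σ}`. -/
def OrbiDisc.HasSector {P : PolytopeData n m} {u : Fin n → ℝ} (D : P.OrbiDisc u)
    (ν : Fin n → ℤ) : Prop :=
  ∃ o : P.OrbiLift D.map D.pt D.order, ν ∈ P.boxCone o.cone ∧
    o.φ 1 = (QuotientAddGroup.mk ν : (Fin n → ℤ) ⧸ P.coneLattice o.cone)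

/-! ### The desingularized Maslov index -/

/-- The Jacobian matrix of a holomorphic map. -/
def jacobian (τ : (Fin n → ℂ) → Fin n → ℂ) (x : Fin n → ℂ) : Matrix (Fin n) (Fin n) ℂ :=
  Matrix.of fun i j => fderiv ℂ τ x (Pi.single j 1) i

/-- A (continuous, complex) trivialization of the desingularization `|w^*TX|` of the pull-back of
the tangent bundle by an orbi-disc `w`.

Over a local lift `F : V → U'_σ` the bundle `w^*TX` is `V × ℂⁿ`, and these pieces are glued by the
derivatives of the changes of charts `τ` that match the lifts. Near the orbifold point, with
`z = pt + ζ ^ k`, the bundle `w^*TX` is the quotient of `{ζ} × ℂⁿ` by `ℤ / k`, and its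
desingularization is glued in by `(ζ, y) ↦ (ζ ^ k, (ζ ^ (-wt_j) y_j)_j)`. The matrices `A`
and `B` express the trivialization in these pieces. -/
structure DesingTriv {P : PolytopeData n m} {u : Fin n → ℝ} (D : P.OrbiDisc u) where
  A : P.LocalLift D.map D.pt → ℂ → Matrix (Fin n) (Fin n) ℂ
  continuousOn_A : ∀ l, ContinuousOn (A l) (l.V ∩ Metric.closedBall 0 1)
  det_A : ∀ l, ∀ z ∈ l.V ∩ Metric.closedBall 0 1, (A l z).det ≠ 0
  compat_A : ∀ l l' : P.LocalLift D.map D.pt, ∀ z ∈ l.V ∩ l'.V ∩ Metric.closedBall 0 1,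
    ∀ τ, P.IsTransition l.cone l'.cone τ (l.F z) →
      (∀ᶠ y in 𝓝[Metric.closedBall 0 1] z, τ (l.F y) = l'.F y) →
      A l' z * jacobian τ (l.F z) = A l z
  B : P.OrbiLift D.map D.pt D.order → ℂ → Matrix (Fin n) (Fin n) ℂ
  continuousOn_B : ∀ o, ContinuousOn (B o) (Metric.ball D.pt (o.ε ^ D.order))
  det_B : ∀ o, ∀ z ∈ Metric.ball D.pt (o.ε ^ D.order), (B o z).det ≠ 0
  compat_B : ∀ (o : P.OrbiLift D.map D.pt D.order) (l : P.LocalLift D.map D.pt),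
    ∀ ζ ∈ Metric.ball (0 : ℂ) o.ε, ζ ≠ 0 → D.pt + ζ ^ D.order ∈ l.V →
    ∀ τ, P.IsTransition o.cone l.cone τ (o.F ζ) →
      (∀ᶠ η in 𝓝 ζ, τ (o.F η) = l.F (D.pt + η ^ D.order)) →
      A l (D.pt + ζ ^ D.order) * jacobian τ (o.F ζ) =
        B o (D.pt + ζ ^ D.order) * Matrix.diagonal fun j => (ζ ^ o.wt j)⁻¹

/-- In a trivialization, the determinant of a real frame of the Lagrangian boundary condition `TL`
at a boundary point `z`: in a chart the torus fiber is `{|x_j| = r_j}`, so that its tangent space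
has the real basis `i x_j e_j`. -/
def DesingTriv.lagDet {P : PolytopeData n m} {u : Fin n → ℝ} {D : P.OrbiDisc u}
    (T : DesingTriv D) (l : P.LocalLift D.map D.pt) (z : ℂ) : ℂ :=
  (T.A l z * Matrix.diagonal fun j => Complex.I * l.F z j).det

/-- `μ` is the desingularized Maslov index of the orbi-disc `D`: in a trivialization of the
desingularized bundle, `μ` is the rotation number along the boundary circle of the square of the
normalized determinant of the Lagrangian subspaces `TL`. -/
def OrbiDisc.HasDesingMaslovIndex {P : PolytopeData n m} {u : Fin n → ℝ} (D : P.OrbiDisc u)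
    (μ : ℤ) : Prop :=
  ∃ (T : DesingTriv D) (θ : ℝ → ℝ), Continuous θ ∧
    (∀ (t : ℝ) (l : P.LocalLift D.map D.pt), Complex.exp (t * Complex.I) ∈ l.V →
      T.lagDet l (Complex.exp (t * Complex.I)) ^ 2 /
          (‖T.lagDet l (Complex.exp (t * Complex.I))‖ : ℂ) ^ 2 =
        Complex.exp (θ t * Complex.I)) ∧
    θ (2 * Real.pi) - θ 0 = 2 * Real.pi * μ

/-! ### Orbi-discs modulo the torus and the automorphisms of the source -/

/-- A homeomorphism of the closed disc is an automorphism if it and its inverse are holomorphic in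
the interior. -/
def IsDiscAut (e : ClosedDisc ≃ₜ ClosedDisc) : Prop :=
  ∃ g g' : ℂ → ℂ,
    DifferentiableOn ℂ g (Metric.ball 0 1) ∧ DifferentiableOn ℂ g' (Metric.ball 0 1) ∧
    Set.MapsTo g (Metric.ball 0 1) (Metric.ball 0 1) ∧
    Set.MapsTo g' (Metric.ball 0 1) (Metric.ball 0 1) ∧
    (∀ z : ClosedDisc, (e z : ℂ) = g z) ∧ ∀ z : ClosedDisc, (e.symm z : ℂ) = g' z

theorem IsDiscAut.refl : IsDiscAut (Homeomorph.refl _) :=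
  ⟨id, id, differentiableOn_id, differentiableOn_id, fun _ h => h, fun _ h => h,
    fun _ => rfl, fun _ => rfl⟩

theorem IsDiscAut.symm {e : ClosedDisc ≃ₜ ClosedDisc} (h : IsDiscAut e) : IsDiscAut e.symm := by
  obtain ⟨g, g', h1, h2, h3, h4, h5, h6⟩ := h
  exact ⟨g', g, h2, h1, h4, h3, h6, h5⟩

theorem IsDiscAut.trans {e f : ClosedDisc ≃ₜ ClosedDisc} (h : IsDiscAut e) (h' : IsDiscAut f) :
    IsDiscAut (e.trans f) := by
  obtain ⟨g, g', h1, h2, h3, h4, h5, h6⟩ := h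
  obtain ⟨k, k', a1, a2, a3, a4, a5, a6⟩ := h'
  refine ⟨k ∘ g, g' ∘ k', a1.comp h1 h3, h2.comp a2 a4, a3.comp h3, h4.comp a4, ?_, ?_⟩
  · intro z; simp [a5, h5]
  · intro z; simp [a6, h6]

/-- Two orbi-discs agree up to the action of the torus on the target and an isomorphism of the
source orbifold discs. -/
def OrbiDisc.Equivalent {P : PolytopeData n m} {u : Fin n → ℝ} (D D' : P.OrbiDisc u) : Prop :=
  D.order = D'.order ∧ ∃ e : ClosedDisc ≃ₜ ClosedDisc, IsDiscAut e ∧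
    (∀ z : ClosedDisc, (z : ℂ) = D.pt ↔ (e z : ℂ) = D'.pt) ∧
    ∃ t : Fin m → Circle, ∀ z, D'.map (e z) = P.torusAct t (D.map z)

/-- The holomorphic orbi-discs with one interior orbifold point and desingularized Maslov index
`0`. -/
def BasicOrbiDisc (P : PolytopeData n m) (u : Fin n → ℝ) : Type :=
  {D : P.OrbiDisc u // D.HasDesingMaslovIndex 0}

instance basicSetoid (P : PolytopeData n m) (u : Fin n → ℝ) : Setoid (P.BasicOrbiDisc u) where
  r D D' := D.1.Equivalent D'.1
  iseqv :=
    { refl := fun D => ⟨rfl, Homeomorph.refl _, IsDiscAut.refl, fun _ => Iff.rfl, 1,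
        fun z => (P.torusAct_one _).symm⟩
      symm := by
        rintro D D' ⟨h, e, he, hp, t, ht⟩
        refine ⟨h.symm, e.symm, he.symm, fun z => ?_, t⁻¹, fun z => ?_⟩
        · rw [hp (e.symm z), e.apply_symm_apply]
        · have h1 := ht (e.symm z)
          rw [e.apply_symm_apply] at h1
          rw [h1, ← P.torusAct_mul, inv_mul_cancel, P.torusAct_one]
      trans := by
        rintro D D' D'' ⟨h, e, he, hp, t, ht⟩ ⟨h', e', he', hp', t', ht'⟩
        refine ⟨h.trans h', e.trans e', he.trans he', fun z => ?_, t' * t, fun z => ?_⟩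
        · rw [hp, hp']; rfl
        · rw [P.torusAct_mul, ← ht, ← ht']; rfl }

/-- The orbi-disc has the form `(a_1 φ(z)^{c_1}, …, a_m φ(z)^{c_m})` in homogeneous coordinates,
where `φ(z) = (z - pt) / (1 - conj(pt) z)` (which is `z` when the orbifold point is `0`), where `a`
lies over `L(u)`, and where `ν = ∑ c_j b_j` with `c_j ∈ [0, 1)` vanishing off a cone of the fan.
The fractional power `φ(z)^{c_j}` means `ζ ^ {d_j}` with `c_j = d_j / k`, for any `k`-th root `ζ` of
`φ(z)`, where `k` is the order of the orbifold point. -/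
def OrbiDisc.HasMonomialForm {P : PolytopeData n m} {u : Fin n → ℝ} (D : P.OrbiDisc u)
    (ν : Fin n → ℤ) : Prop :=
  ∃ (a : Fin m → ℂ) (c : Fin m → ℝ) (d : Fin m → ℕ),
    (∀ j, ‖a j‖ ^ 2 / 2 = P.ell j u) ∧
    (∀ j, 0 ≤ c j ∧ c j < 1) ∧ P.IsCone {j | c j ≠ 0} ∧
    (∀ i, (ν i : ℝ) = ∑ j, c j * (P.stacky j i : ℝ)) ∧
    (∀ j, c j = d j / D.order) ∧
    ∀ (z : ClosedDisc) (ζ : ℂ),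
      ζ ^ D.order = ((z : ℂ) - D.pt) / (1 - (starRingEnd ℂ) D.pt * z) →
      ∃ h : (fun j => a j * ζ ^ d j) ∈ P.U, D.map z = P.point (fun j => a j * ζ ^ d j) h

end PolytopeData

end

/-!
An orbi-disc is studied through the characters `f_i = ∏_j z_j ^ b_{j i}` of the open torus orbit
`(ℂ*)ᵐ / K_ℂ` (`torusCoord`): they separate the points of this orbit, and have constant modulus on
each torus fiber. The boundary of an orbi-disc `w` lies in the open orbit, so that by the identity
theorem `w` meets the toric divisors at isolated interior points only (`eventually_isGeneric`).

*Index zero forces minimal intersections* (`isMinimal_of_index_zero`). In the logarithmic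
frames `B · diag(x)⁻¹`, with `B` the matrix of stacky vectors of the cone, all changes of charts
become trivial (`jacobian_transition`). Hence in a trivialization of the desingularized bundle the
determinants of the Lagrangian frame in the various charts differ only by constants, and fit
together to one function on the disc. It vanishes at a point to the order of the intersection with
the toric divisors, diminished at the orbifold point by the weights of the desingularization. Index
zero is vanishing winding number along the boundary, so by the argument principle
(`ne_zero_of_winding_eq_zero`) there are no zeros: `w` meets the divisors only at the orbifold point
`z⁺`, and there with the least multiplicities `k c_j` which the sector `ν = ∑ c_j b_j` allows.

*Minimal orbi-discs are monomial* (`exists_characters`, `hasMonomialForm`). With the Blaschke factor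
`φ` at `z⁺`, the functions `f_i / φ ^ ν_i` are holomorphic without zeros and of constant modulus on
the circle, hence constant. A point of the torus fiber realizes the constants, and separation by
characters gives `w = [a_j φ ^ c_j]`.

*The sector classifies.* The moduli `|f_i| = const · |φ| ^ ν_i` determine `ν`, and automorphisms of
the disc preserve `|φ|` by the Schwarz–Pick lemma, so the sector is an invariant (`sector_eq`). Two
minimal orbi-discs with the same sector have the same order and the same exponents, since a vector
in the support of the fan has a unique expansion in a cone (`cone_coeff_unique`); they differ by a
Blaschke factor and a torus element (`equivalent`). Conversely each element of `Box'` is the sector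
of a monomial orbi-disc (`exists_isMinimal`), and for a minimal orbi-disc the logarithmic frame
trivializes the desingularized bundle with constant Lagrangian determinant, so that the index is
zero (`hasDesingMaslovIndex`).
-/

noncomputable section

namespace PolytopeData

variable {n m : ℕ}

/-! ### Cones of the normal fan -/

/-- The stacky vector `b_j`, seen in `N ⊗ ℝ`. -/
def realStacky (P : PolytopeData n m) (j : Fin m) : Fin n → ℝ := fun i => (P.stacky j i : ℝ)

theorem ell_add_smul (P : PolytopeData n m) (j : Fin m) (u v : Fin n → ℝ) (t : ℝ) :
    P.ell j (u + t • v) = P.ell j u + t * ∑ i, v i * P.realStacky j i := by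
  simp only [ell, realStacky, Pi.add_apply, Pi.smul_apply, smul_eq_mul, add_mul,
    Finset.sum_add_distrib, Finset.mul_sum, mul_assoc]
  ring

theorem continuous_ell (P : PolytopeData n m) (j : Fin m) : Continuous (P.ell j) := by
  unfold ell
  fun_prop

theorem IsLabeledPolytope.exists_stacky_ne_zero {P : PolytopeData n m} (hP : P.IsLabeledPolytope)
    (j : Fin m) : ∃ i, P.stacky j i ≠ 0 := by
  by_contra! h
  have h1 : ∀ i, P.normal j i = 0 := by
    intro i
    have := h i
    simp only [stacky, mul_eq_zero, Nat.cast_eq_zero] at this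
    exact this.resolve_left (hP.label_pos j).ne'
  have h2 := hP.primitive j
  rw [Finset.gcd_eq_zero_iff.2 fun i _ => h1 i] at h2
  exact zero_ne_one h2

/-- Interior points lie strictly inside every facet: otherwise moving against `b_j` would leave the
polytope at once. -/
theorem IsLabeledPolytope.ell_pos {P : PolytopeData n m} (hP : P.IsLabeledPolytope)
    {u : Fin n → ℝ} (hu : u ∈ interior P.polytope) (j : Fin m) : 0 < P.ell j u := by
  have h1 : Filter.Tendsto (fun t : ℝ => u + t • (-P.realStacky j)) (𝓝[>] 0) (𝓝 u) := by
    have : Continuous (fun t : ℝ => u + t • (-P.realStacky j)) := by fun_prop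
    have h := (this.tendsto 0).mono_left (nhdsWithin_le_nhds (s := Set.Ioi 0))
    simpa using h
  obtain ⟨t, ht, ht0⟩ := ((h1.eventually (mem_interior_iff_mem_nhds.1 hu)).and
    self_mem_nhdsWithin).exists
  have h2 := ht j
  rw [ell_add_smul] at h2
  have h3 : 0 < ∑ i, P.realStacky j i * P.realStacky j i := by
    obtain ⟨i, hi⟩ := hP.exists_stacky_ne_zero j
    refine Finset.sum_pos' (fun i _ => mul_self_nonneg _) ⟨i, Finset.mem_univ _, ?_⟩
    have : P.realStacky j i ≠ 0 := by simpa [realStacky] using hi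
    exact mul_self_pos.2 this
  have h4 : ∑ i, (-P.realStacky j) i * P.realStacky j i
      = -∑ i, P.realStacky j i * P.realStacky j i := by simp
  rw [h4] at h2
  have : 0 < t * ∑ i, P.realStacky j i * P.realStacky j i := mul_pos ht0 h3
  linarith

/-- Every face of the polytope has a vertex. -/
theorem IsLabeledPolytope.exists_vertex {P : PolytopeData n m} (hP : P.IsLabeledPolytope)
    {I : Set (Fin m)} (hI : P.IsCone I) :
    ∃ v ∈ Set.extremePoints ℝ P.polytope, ∀ j ∈ I, P.ell j v = 0 := by
  set K : Set (Fin n → ℝ) := {u | u ∈ P.polytope ∧ ∀ j ∈ I, P.ell j u = 0} with hK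
  have hcl : IsClosed K := by
    have : K = (⋂ j, {u | 0 ≤ P.ell j u}) ∩ ⋂ j ∈ I, {u | P.ell j u = 0} := by
      ext u; simp [hK, polytope]
    rw [this]
    exact (isClosed_iInter fun j => isClosed_le continuous_const (P.continuous_ell j)).inter
      (isClosed_biInter fun j _ => isClosed_eq (P.continuous_ell j) continuous_const)
  have hcomp : IsCompact K :=
    Metric.isCompact_of_isClosed_isBounded hcl (hP.bounded.subset fun u hu => hu.1)
  obtain ⟨u, hu, hu'⟩ := hI
  obtain ⟨v, hv⟩ := hcomp.extremePoints_nonempty ⟨u, hu, hu'⟩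
  have hext : IsExtreme ℝ P.polytope K := by
    refine ⟨fun u hu => hu.1, ?_⟩
    rintro x hx y hy z hz ⟨a, b, ha, hb, hab, rfl⟩
    refine ⟨hx, fun j hj => ?_⟩
    have h1 := hz.2 j hj
    have h2 : P.ell j (a • x + b • y) = a * P.ell j x + b * P.ell j y := by
      simp only [ell, Pi.add_apply, Pi.smul_apply, smul_eq_mul, add_mul,
        Finset.sum_add_distrib, mul_sub, Finset.mul_sum, mul_assoc]
      linear_combination P.const j * hab
    have hx' := hx j
    have hy' := hy j
    rw [h2] at h1
    have h3 : 0 ≤ a * P.ell j x := mul_nonneg ha.le hx'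
    have h4 : 0 ≤ b * P.ell j y := mul_nonneg hb.le hy'
    have h5 : a * P.ell j x = 0 := by linarith
    exact (mul_eq_zero.1 h5).resolve_left ha.ne'
  exact ⟨v, hext.extremePoints_subset_extremePoints hv, (extremePoints_subset hv).2⟩

/-- A vector orthogonal to all stacky vectors of the facets through a vertex vanishes, for
otherwise the vertex would be the midpoint of a segment in the polytope. -/
theorem eq_zero_of_orthogonal_vertex {P : PolytopeData n m} {v : Fin n → ℝ}
    (hv : v ∈ Set.extremePoints ℝ P.polytope) {x : Fin n → ℝ}
    (hx : ∀ j, P.ell j v = 0 → ∑ i, x i * P.realStacky j i = 0) : x = 0 := by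
  have hmem : v ∈ P.polytope := extremePoints_subset hv
  have h1 : ∀ j, ∀ᶠ t : ℝ in 𝓝 0, 0 ≤ P.ell j (v + t • x) := by
    intro j
    by_cases hj : P.ell j v = 0
    · refine Filter.Eventually.of_forall fun t => ?_
      rw [ell_add_smul, hj, hx j hj]; simp
    · have hpos : 0 < P.ell j v := lt_of_le_of_ne (hmem j) (Ne.symm hj)
      have hc : Continuous fun t : ℝ => P.ell j (v + t • x) :=
        (P.continuous_ell j).comp (by fun_prop)
      have := (hc.tendsto 0).eventually (lt_mem_nhds (a := 0) (by simpa using hpos))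
      exact this.mono fun t ht => ht.le
  have h2 : ∀ᶠ t : ℝ in 𝓝 0, v + t • x ∈ P.polytope := Filter.eventually_all.2 h1
  have h3 : ∀ᶠ t : ℝ in 𝓝 0, v + (-t) • x ∈ P.polytope := by
    have : Filter.Tendsto (fun t : ℝ => -t) (𝓝 0) (𝓝 0) := by
      simpa using (continuous_neg (G := ℝ)).tendsto 0
    exact this.eventually h2
  obtain ⟨t, ⟨ht, ht'⟩, ht0⟩ := (((h2.and h3).filter_mono nhdsWithin_le_nhds).and
    (self_mem_nhdsWithin (a := (0 : ℝ)) (s := Set.Ioi 0))).exists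
  have h4 : v ∈ openSegment ℝ (v + t • x) (v + (-t) • x) := by
    refine ⟨1 / 2, 1 / 2, by norm_num, by norm_num, by norm_num, ?_⟩
    ext i; simp; ring
  have h5 := hv.2 ht ht' h4
  have h6 : t • x = 0 := by simpa using h5
  exact (smul_eq_zero.1 h6).resolve_left (ne_of_gt ht0)

/-- The polytope being simple, the stacky vectors of a cone of the fan are linearly independent. -/
theorem IsLabeledPolytope.linearIndepOn {P : PolytopeData n m} (hP : P.IsLabeledPolytope)
    {I : Set (Fin m)} (hI : P.IsCone I) : LinearIndepOn ℝ P.realStacky I := by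
  obtain ⟨v, hv, hvI⟩ := hP.exists_vertex hI
  refine LinearIndepOn.mono (s := {j | P.ell j v = 0}) ?_ hvI
  have hcard : Nat.card {j | P.ell j v = 0} = n := hP.simple v hv
  -- The `n` stacky vectors at a vertex form a square matrix with trivial kernel.
  let e : Fin n ≃ {j | P.ell j v = 0} := (Finite.equivFinOfCardEq hcard).symm
  have h1 : IsUnit (Matrix.of fun k : Fin n => P.realStacky (e k)) := by
    rw [Matrix.isUnit_iff_isUnit_det, isUnit_iff_ne_zero]
    intro h0
    obtain ⟨x, hx0, hx⟩ := Matrix.exists_mulVec_eq_zero_iff.2 h0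
    refine hx0 (eq_zero_of_orthogonal_vertex hv fun j hj => ?_)
    have := congrFun hx (e.symm ⟨j, hj⟩)
    simp only [Matrix.mulVec, dotProduct, Matrix.of_apply, Equiv.apply_symm_apply,
      Pi.zero_apply] at this
    rw [← this]
    exact Finset.sum_congr rfl fun i _ => mul_comm _ _
  have h2 := Matrix.linearIndependent_rows_iff_isUnit.2 h1
  rw [LinearIndepOn]
  exact (linearIndependent_equiv e).1 h2

/-- The matrix whose columns are the stacky vectors `b_{i_1}, …, b_{i_n}` of a cone. -/
def coneMat (P : PolytopeData n m) (s : P.MaxCone) : Matrix (Fin n) (Fin n) ℝ :=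
  Matrix.of fun i j => (P.stacky (s.idx j) i : ℝ)

theorem IsLabeledPolytope.isUnit_coneMat {P : PolytopeData n m} (hP : P.IsLabeledPolytope)
    (s : P.MaxCone) : IsUnit (P.coneMat s) := by
  have h := (linearIndepOn_range_iff s.idx.injective P.realStacky).1 (hP.linearIndepOn s.isCone)
  exact Matrix.linearIndependent_cols_iff_isUnit.1 h

theorem IsLabeledPolytope.det_coneMat_ne_zero {P : PolytopeData n m} (hP : P.IsLabeledPolytope)
    (s : P.MaxCone) : (P.coneMat s).det ≠ 0 :=
  ((Matrix.isUnit_iff_isUnit_det _).1 (hP.isUnit_coneMat s)).ne_zero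

theorem dualCoord_eq (P : PolytopeData n m) (s : P.MaxCone) (ν : Fin n → ℤ) :
    P.dualCoord s ν = (P.coneMat s)⁻¹.mulVec fun i => (ν i : ℝ) := rfl

theorem IsLabeledPolytope.sum_dualCoord {P : PolytopeData n m} (hP : P.IsLabeledPolytope)
    (s : P.MaxCone) (ν : Fin n → ℤ) (i : Fin n) :
    ∑ j, P.dualCoord s ν j * (P.stacky (s.idx j) i : ℝ) = ν i := by
  have h : (P.coneMat s).mulVec (P.dualCoord s ν) = fun i => (ν i : ℝ) := by
    rw [dualCoord_eq, Matrix.mulVec_mulVec, Matrix.mul_nonsing_inv _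
      ((Matrix.isUnit_iff_isUnit_det _).1 (hP.isUnit_coneMat s)), Matrix.one_mulVec]
  rw [← congrFun h i]
  exact Finset.sum_congr rfl fun j _ => mul_comm _ _

theorem IsLabeledPolytope.dualCoord_eq_of_sum {P : PolytopeData n m} (hP : P.IsLabeledPolytope)
    (s : P.MaxCone) {ν : Fin n → ℤ} {c : Fin n → ℝ}
    (h : ∀ i, (ν i : ℝ) = ∑ j, c j * (P.stacky (s.idx j) i : ℝ)) : P.dualCoord s ν = c := by
  have h' : (fun i => (ν i : ℝ)) = (P.coneMat s).mulVec c := by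
    ext i
    rw [h i]
    exact Finset.sum_congr rfl fun j _ => mul_comm _ _
  rw [dualCoord_eq, h', Matrix.mulVec_mulVec, Matrix.nonsing_inv_mul _
      ((Matrix.isUnit_iff_isUnit_det _).1 (hP.isUnit_coneMat s)), Matrix.one_mulVec]

theorem dualCoord_sub (P : PolytopeData n m) (s : P.MaxCone) (ν ν' : Fin n → ℤ) :
    P.dualCoord s (ν - ν') = P.dualCoord s ν - P.dualCoord s ν' := by
  rw [dualCoord_eq, dualCoord_eq, dualCoord_eq, ← Matrix.mulVec_sub]
  congr 1
  ext i; simp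

theorem dualCoord_nsmul (P : PolytopeData n m) (s : P.MaxCone) (k : ℕ) (ν : Fin n → ℤ) :
    P.dualCoord s (k • ν) = (k : ℝ) • P.dualCoord s ν := by
  rw [dualCoord_eq, dualCoord_eq, ← Matrix.mulVec_smul]
  congr 1
  ext i; simp

theorem IsLabeledPolytope.mem_coneLattice {P : PolytopeData n m} (hP : P.IsLabeledPolytope)
    (s : P.MaxCone) (ν : Fin n → ℤ) :
    ν ∈ P.coneLattice s ↔ ∀ j, ∃ a : ℤ, P.dualCoord s ν j = a := by
  constructor
  · intro h
    have h1 : ∃ a : Fin n → ℤ, ν = ∑ j, a j • P.stacky (s.idx j) := by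
      refine AddSubgroup.closure_induction ?_ ?_ ?_ ?_ h
      · rintro _ ⟨j, rfl⟩
        exact ⟨Pi.single j 1, by simp [Pi.single_apply, ite_smul]⟩
      · exact ⟨0, by simp⟩
      · rintro x y _ _ ⟨a, rfl⟩ ⟨b, rfl⟩
        exact ⟨a + b, by simp [add_smul, Finset.sum_add_distrib]⟩
      · rintro x _ ⟨a, rfl⟩
        exact ⟨-a, by simp⟩
    obtain ⟨a, ha⟩ := h1
    have h2 : P.dualCoord s ν = fun j => (a j : ℝ) := by
      refine hP.dualCoord_eq_of_sum s fun i => ?_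
      rw [ha]
      simp [Finset.sum_apply]
    exact fun j => ⟨a j, by rw [h2]⟩
  · intro h
    choose a ha using h
    have h1 : ν = ∑ j, a j • P.stacky (s.idx j) := by
      ext i
      have := hP.sum_dualCoord s ν i
      simp only [ha] at this
      rw [Finset.sum_apply]
      simp only [Pi.smul_apply, smul_eq_mul]
      exact_mod_cast this.symm
    rw [h1]
    exact sum_mem fun j _ => zsmul_mem (AddSubgroup.subset_closure (Set.mem_range_self j)) _

theorem IsLabeledPolytope.mk_eq_mk_iff {P : PolytopeData n m} (hP : P.IsLabeledPolytope)
    (s : P.MaxCone) (ν ν' : Fin n → ℤ) :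
    (QuotientAddGroup.mk ν : (Fin n → ℤ) ⧸ P.coneLattice s) = QuotientAddGroup.mk ν' ↔
      ∀ j, ∃ a : ℤ, P.dualCoord s ν' j = P.dualCoord s ν j + a := by
  rw [QuotientAddGroup.eq, neg_add_eq_sub, hP.mem_coneLattice, dualCoord_sub]
  simp only [Pi.sub_apply, sub_eq_iff_eq_add']

/-- Cones of the fan meet along common faces: a vector in the support of the fan has only one
expression as a nonnegative combination of the stacky vectors of a cone. Pairing with points of the
two faces shows that both combinations are carried by the facets through one common point. -/
theorem IsLabeledPolytope.cone_coeff_unique {P : PolytopeData n m} (hP : P.IsLabeledPolytope)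
    {c c' : Fin m → ℝ} (hc : ∀ j, 0 ≤ c j) (hc' : ∀ j, 0 ≤ c' j) (hI : P.IsCone {j | c j ≠ 0})
    (hI' : P.IsCone {j | c' j ≠ 0})
    (h : ∀ i, ∑ j, c j * (P.stacky j i : ℝ) = ∑ j, c' j * (P.stacky j i : ℝ)) : c = c' := by
  obtain ⟨x, hx, hxI⟩ := hI
  obtain ⟨y, hy, hyI⟩ := hI'
  -- Pairing `∑ d_j b_j` with a point `w` gives `∑ d_j ℓ_j(w)` up to a constant. At a common point
  -- `x` of the facets of `c`, the sum for `c` attains its minimum `0`, so that the sum for `c'`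
  -- vanishes as well, and both families live on the facets through `x`.
  have key : ∀ (d : Fin m → ℝ) (w : Fin n → ℝ),
      ∑ i, w i * ∑ j, d j * (P.stacky j i : ℝ) = ∑ j, d j * P.ell j w + ∑ j, d j * P.const j := by
    intro d w
    simp only [ell, mul_sub, Finset.sum_sub_distrib, Finset.mul_sum]
    rw [Finset.sum_comm]
    simp only [sub_add_cancel]
    exact Finset.sum_congr rfl fun j _ => Finset.sum_congr rfl fun i _ => by ring
  have hcx : ∑ j, c j * P.ell j x = 0 := Finset.sum_eq_zero fun j _ => by
    by_cases hj : c j = 0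
    · simp [hj]
    · simp [hxI j hj]
  have hcy : ∑ j, c' j * P.ell j y = 0 := Finset.sum_eq_zero fun j _ => by
    by_cases hj : c' j = 0
    · simp [hj]
    · simp [hyI j hj]
  have h1 : 0 ≤ ∑ j, c j * P.ell j y := Finset.sum_nonneg fun j _ => mul_nonneg (hc j) (hy j)
  have h2 : 0 ≤ ∑ j, c' j * P.ell j x := Finset.sum_nonneg fun j _ => mul_nonneg (hc' j) (hx j)
  have e1 := key c x
  have e2 := key c' x
  have e3 := key c y
  have e4 := key c' y
  simp only [h] at e1 e3
  have h3 : ∑ j, c' j * P.ell j x = 0 := by linarith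
  have h4 : ∀ j, c' j ≠ 0 → P.ell j x = 0 := by
    intro j hj
    have := (Finset.sum_eq_zero_iff_of_nonneg fun j _ => mul_nonneg (hc' j) (hx j)).1 h3 j
      (Finset.mem_univ _)
    exact (mul_eq_zero.1 this).resolve_left hj
  have hcone : P.IsCone {j | P.ell j x = 0} := ⟨x, hx, fun j hj => hj⟩
  have hlin := hP.linearIndepOn hcone
  have hcoe : {j | P.ell j x = 0} = ((Finset.univ.filter fun j => P.ell j x = 0 :
      Finset (Fin m)) : Set (Fin m)) := by ext; simp
  rw [hcoe, linearIndepOn_finset_iff] at hlin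
  have hsum : ∑ j ∈ Finset.univ.filter (fun j => P.ell j x = 0),
      (c j - c' j) • P.realStacky j = 0 := by
    have hall : ∑ j, (c j - c' j) • P.realStacky j = 0 := by
      ext i
      simp only [Finset.sum_apply, Pi.smul_apply, smul_eq_mul, realStacky, sub_mul,
        Finset.sum_sub_distrib, h, sub_self, Pi.zero_apply]
    rw [← hall]
    refine Finset.sum_filter_of_ne fun j _ hj => ?_
    by_contra hx0
    refine hj ?_
    rw [not_imp_comm.1 (hxI j) hx0, not_imp_comm.1 (h4 j) hx0]
    simp
  ext j
  by_cases hj : P.ell j x = 0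
  · exact sub_eq_zero.1 (hlin (fun j => c j - c' j) hsum j (by simpa using hj))
  · rw [not_imp_comm.1 (hxI j) hj, not_imp_comm.1 (h4 j) hj]

/-! ### The open torus orbit -/

/-- The `j`-th homogeneous coordinate vanishes at the point `x`, that is, `x` lies on the `j`-th
toric divisor. -/
def IsZero (P : PolytopeData n m) (j : Fin m) : P.X → Prop :=
  Quotient.lift (fun z => z.1 j = 0) (by
    rintro z z' ⟨t, -, h⟩
    simp [h j])

/-- The point lies in the open torus orbit `(ℂ*)ᵐ / K_ℂ`. -/
def IsGeneric (P : PolytopeData n m) (x : P.X) : Prop := ∀ j, ¬ P.IsZero j x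

/-- The characters `∏_j z_j ^ b_{j i}` of the point with homogeneous coordinates `z`. On the open
torus orbit they are an isomorphism onto `(ℂ*)ⁿ`; elsewhere they have no meaning. -/
def torusCoord (P : PolytopeData n m) : P.X → Fin n → ℂ :=
  Quotient.lift (fun z i => ∏ j, z.1 j ^ P.stacky j i) (by
    rintro z z' ⟨t, ht, h⟩
    ext i
    have h1 : ∏ j, ((t j : ℂ) ^ P.stacky j i) = 1 := by
      have := congrArg (Units.val) (ht i)
      simpa using this
    simp only [h, mul_zpow, Finset.prod_mul_distrib, h1, one_mul])

theorem isZero_point (P : PolytopeData n m) {z : Fin m → ℂ} (hz : z ∈ P.U) (j : Fin m) :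
    P.IsZero j (P.point z hz) ↔ z j = 0 := Iff.rfl

theorem torusCoord_point (P : PolytopeData n m) {z : Fin m → ℂ} (hz : z ∈ P.U) (i : Fin n) :
    P.torusCoord (P.point z hz) i = ∏ j, z j ^ P.stacky j i := rfl

theorem exists_point (P : PolytopeData n m) (x : P.X) : ∃ z, ∃ hz : z ∈ P.U, x = P.point z hz := by
  induction x using Quotient.inductionOn with
  | h z => exact ⟨z.1, z.2, rfl⟩

theorem point_eq_point (P : PolytopeData n m) {z z' : Fin m → ℂ} {hz : z ∈ P.U} {hz' : z' ∈ P.U}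
    (t : Fin m → ℂ) (ht : ∀ j, t j ≠ 0) (h : ∀ i, ∏ j, t j ^ P.stacky j i = 1)
    (hzz : ∀ j, z' j = t j * z j) : P.point z hz = P.point z' hz' := by
  refine Quotient.sound' ⟨fun j => Units.mk0 (t j) (ht j), fun i => ?_, hzz⟩
  ext
  simpa using h i

theorem torusCoord_injOn (P : PolytopeData n m) {x y : P.X} (hx : P.IsGeneric x)
    (hy : P.IsGeneric y) (h : P.torusCoord x = P.torusCoord y) : x = y := by
  obtain ⟨z, hz, rfl⟩ := P.exists_point x
  obtain ⟨w, hw, rfl⟩ := P.exists_point y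
  have hz0 : ∀ j, z j ≠ 0 := hx
  have hw0 : ∀ j, w j ≠ 0 := hy
  refine P.point_eq_point (fun j => w j / z j) (fun j => div_ne_zero (hw0 j) (hz0 j)) (fun i => ?_)
    fun j => by field_simp [hz0 j]
  have h1 := congrFun h i
  rw [torusCoord_point, torusCoord_point] at h1
  simp only [div_zpow, Finset.prod_div_distrib]
  rw [h1]
  exact div_self (Finset.prod_ne_zero_iff.2 fun j _ => zpow_ne_zero _ (hw0 j))

theorem torusCoord_ne_zero (P : PolytopeData n m) {x : P.X} (hx : P.IsGeneric x) (i : Fin n) :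
    P.torusCoord x i ≠ 0 := by
  obtain ⟨z, hz, rfl⟩ := P.exists_point x
  exact Finset.prod_ne_zero_iff.2 fun j _ => zpow_ne_zero _ (hx j)

theorem isClosed_isZero (P : PolytopeData n m) (j : Fin m) : IsClosed {x : P.X | P.IsZero j x} := by
  have h : IsClosed ((Quotient.mk P.orbitSetoid) ⁻¹' {x : P.X | P.IsZero j x}) := by
    have : ((Quotient.mk P.orbitSetoid) ⁻¹' {x : P.X | P.IsZero j x}) = {z : P.U | z.1 j = 0} := rfl
    rw [this]
    exact isClosed_eq ((continuous_apply j).comp continuous_subtype_val) continuous_const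
  exact isQuotientMap_quotient_mk'.isClosed_preimage.1 h

theorem torusCoord_torusAct (P : PolytopeData n m) (t : Fin m → Circle) (x : P.X) (i : Fin n) :
    P.torusCoord (P.torusAct t x) i = (∏ j, (t j : ℂ) ^ P.stacky j i) * P.torusCoord x i := by
  obtain ⟨z, hz, rfl⟩ := P.exists_point x
  change ∏ j, ((t j : ℂ) * z j) ^ P.stacky j i = _
  simp only [mul_zpow, Finset.prod_mul_distrib]
  rfl

/-- Over a torus fiber the characters have constant modulus. -/
theorem IsLabeledPolytope.norm_torusCoord_fiber {P : PolytopeData n m} (hP : P.IsLabeledPolytope)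
    {u : Fin n → ℝ} (hu : u ∈ interior P.polytope) {x : P.X} (hx : x ∈ P.fiber u) :
    P.IsGeneric x ∧ ∀ i, ‖P.torusCoord x i‖ = ∏ j, √(2 * P.ell j u) ^ P.stacky j i := by
  obtain ⟨z, hz, rfl, h⟩ := hx
  have h1 : ∀ j, ‖z j‖ = √(2 * P.ell j u) := by
    intro j
    rw [← h j, mul_div_cancel₀ _ two_ne_zero, Real.sqrt_sq (norm_nonneg _)]
  constructor
  · intro j hj
    have h2 : z j = 0 := hj
    have h3 := h j
    have := hP.ell_pos hu j
    rw [h2] at h3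
    simp only [norm_zero] at h3
    linarith
  · intro i
    rw [torusCoord_point, norm_prod]
    simp only [norm_zpow, h1]

/-! ### Charts and characters -/

/-- The characters of a point in the coordinates of a uniformizing chart. -/
def coneMon (P : PolytopeData n m) (s : P.MaxCone) (x : Fin n → ℂ) (i : Fin n) : ℂ :=
  ∏ j, x j ^ P.stacky (s.idx j) i

theorem chartCoord_idx (P : PolytopeData n m) (s : P.MaxCone) (x : Fin n → ℂ) (j : Fin n) :
    P.chartCoord s x (s.idx j) = x j := s.idx.injective.extend_apply _ _ _

theorem chartCoord_of_notMem (P : PolytopeData n m) (s : P.MaxCone) (x : Fin n → ℂ) {j : Fin m}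
    (hj : j ∉ Set.range s.idx) : P.chartCoord s x j = 1 :=
  Function.extend_apply' _ _ _ (by simpa using hj)

/-- A product over all facets of factors which are trivial off a cone. -/
theorem prod_eq_prod_cone {M : Type*} [CommMonoid M] (P : PolytopeData n m) (s : P.MaxCone)
    (f : Fin m → M) (hf : ∀ j, j ∉ Set.range s.idx → f j = 1) :
    ∏ j, f j = ∏ j, f (s.idx j) :=
  (Finset.prod_of_injOn s.idx s.idx.injective.injOn (by simp [Set.MapsTo])
    (fun j _ hj => hf j (by simpa using hj)) fun _ _ => rfl).symm

/-- A sum over all facets of terms which vanish off a cone. -/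
theorem sum_eq_sum_cone {M : Type*} [AddCommMonoid M] (P : PolytopeData n m) (s : P.MaxCone)
    (f : Fin m → M) (hf : ∀ j, j ∉ Set.range s.idx → f j = 0) :
    ∑ j, f j = ∑ j, f (s.idx j) :=
  (Finset.sum_of_injOn s.idx s.idx.injective.injOn (by simp [Set.MapsTo])
    (fun j _ hj => hf j (by simpa using hj)) fun _ _ => rfl).symm

theorem torusCoord_chart (P : PolytopeData n m) (s : P.MaxCone) (x : Fin n → ℂ) :
    P.torusCoord (P.chart s x) = P.coneMon s x := by
  ext i
  rw [chart, torusCoord_point, P.prod_eq_prod_cone s]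
  · simp only [chartCoord_idx, coneMon]
  · intro j hj
    rw [P.chartCoord_of_notMem s x hj, one_zpow]

theorem isZero_chart_idx (P : PolytopeData n m) (s : P.MaxCone) (x : Fin n → ℂ) (j : Fin n) :
    P.IsZero (s.idx j) (P.chart s x) ↔ x j = 0 := by
  rw [chart, isZero_point, chartCoord_idx]

theorem not_isZero_chart (P : PolytopeData n m) (s : P.MaxCone) (x : Fin n → ℂ) {j : Fin m}
    (hj : j ∉ Set.range s.idx) : ¬ P.IsZero j (P.chart s x) := by
  rw [chart, isZero_point, P.chartCoord_of_notMem s x hj]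
  exact one_ne_zero

theorem isGeneric_chart (P : PolytopeData n m) (s : P.MaxCone) (x : Fin n → ℂ) :
    P.IsGeneric (P.chart s x) ↔ ∀ j, x j ≠ 0 := by
  refine ⟨fun h j => (P.isZero_chart_idx s x j).not.1 (h _), fun h j => ?_⟩
  by_cases hj : j ∈ Set.range s.idx
  · obtain ⟨j, rfl⟩ := hj
    exact (P.isZero_chart_idx s x j).not.2 (h j)
  · exact P.not_isZero_chart s x hj

theorem coneMon_ne_zero (P : PolytopeData n m) (s : P.MaxCone) {x : Fin n → ℂ}
    (hx : ∀ j, x j ≠ 0) (i : Fin n) : P.coneMon s x i ≠ 0 :=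
  Finset.prod_ne_zero_iff.2 fun j _ => zpow_ne_zero _ (hx j)

theorem coneMon_mul (P : PolytopeData n m) (s : P.MaxCone) (x y : Fin n → ℂ) (i : Fin n) :
    P.coneMon s (fun j => x j * y j) i = P.coneMon s x i * P.coneMon s y i := by
  simp only [coneMon, mul_zpow, Finset.prod_mul_distrib]

theorem coneMon_div (P : PolytopeData n m) (s : P.MaxCone) (x y : Fin n → ℂ) (i : Fin n) :
    P.coneMon s (fun j => x j / y j) i = P.coneMon s x i / P.coneMon s y i := by
  simp only [coneMon, div_zpow, Finset.prod_div_distrib]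

theorem coneMon_exp (P : PolytopeData n m) (s : P.MaxCone) (v : Fin n → ℂ) (i : Fin n) :
    P.coneMon s (fun j => Complex.exp (v j)) i =
      Complex.exp (∑ j, (P.stacky (s.idx j) i : ℂ) * v j) := by
  simp only [coneMon, Complex.exp_sum, Complex.exp_int_mul]

/-- A power of a common base: the exponents combine to a lattice vector. -/
theorem coneMon_pow (P : PolytopeData n m) (s : P.MaxCone) {ζ : ℂ} (hζ : ζ ≠ 0) (d : Fin n → ℕ)
    (i : Fin n) :
    P.coneMon s (fun j => ζ ^ d j) i = ζ ^ (∑ j, (d j : ℤ) * P.stacky (s.idx j) i) := by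
  have key : ∀ S : Finset (Fin n), ∏ j ∈ S, (ζ ^ d j) ^ P.stacky (s.idx j) i
      = ζ ^ (∑ j ∈ S, (d j : ℤ) * P.stacky (s.idx j) i) := by
    intro S
    induction S using Finset.induction_on with
    | empty => simp
    | insert a S ha ih =>
      rw [Finset.prod_insert ha, Finset.sum_insert ha, ih, zpow_add₀ hζ, zpow_mul, zpow_natCast]
  exact key _

theorem coneMon_continuousAt (P : PolytopeData n m) (s : P.MaxCone) {x : Fin n → ℂ}
    (hx : ∀ j, x j ≠ 0) (i : Fin n) : ContinuousAt (fun y => P.coneMon s y i) x := by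
  unfold coneMon
  exact tendsto_finsetProd _ fun j _ =>
    (continuous_apply j).continuousAt.zpow₀ _ (Or.inl (hx j))

/-- The characters determine the point of the open torus orbit up to the finite group of the chart;
every value is attained. -/
theorem IsLabeledPolytope.exists_coneMon_eq {P : PolytopeData n m} (hP : P.IsLabeledPolytope)
    (s : P.MaxCone) {y : Fin n → ℂ} (hy : ∀ i, y i ≠ 0) :
    ∃ x : Fin n → ℂ, (∀ j, x j ≠ 0) ∧ P.coneMon s x = y ∧
      ((∀ i, ‖y i‖ = 1) → ∀ j, ‖x j‖ = 1) := by
  have hdet := (Matrix.isUnit_iff_isUnit_det _).1 (hP.isUnit_coneMat s)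
  refine ⟨fun j => Complex.exp (∑ i, (((P.coneMat s)⁻¹ j i : ℝ) : ℂ) * Complex.log (y i)),
    fun j => Complex.exp_ne_zero _, ?_, ?_⟩
  · ext i
    rw [coneMon_exp]
    have h1 : ∀ k, ∑ j, (P.stacky (s.idx j) i : ℂ) * (((P.coneMat s)⁻¹ j k : ℝ) : ℂ)
        = if i = k then 1 else 0 := by
      intro k
      have := congrFun (congrFun (Matrix.mul_nonsing_inv _ hdet) i) k
      rw [Matrix.mul_apply, Matrix.one_apply] at this
      have h2 := congrArg (fun r : ℝ => (r : ℂ)) this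
      simpa [coneMat, apply_ite] using h2
    have h2 : ∑ j, (P.stacky (s.idx j) i : ℂ) *
        ∑ k, (((P.coneMat s)⁻¹ j k : ℝ) : ℂ) * Complex.log (y k) = Complex.log (y i) := by
      simp only [Finset.mul_sum, ← mul_assoc]
      rw [Finset.sum_comm]
      simp only [← Finset.sum_mul, h1]
      simp
    rw [h2, Complex.exp_log (hy i)]
  · intro h j
    rw [Complex.norm_exp]
    simp [Complex.re_sum, Complex.log_re, h]

/-- The characters of a chart are locally injective near `1`. -/
theorem IsLabeledPolytope.eventually_eq_one {P : PolytopeData n m} (hP : P.IsLabeledPolytope)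
    (s : P.MaxCone) : ∀ᶠ ρ : Fin n → ℂ in 𝓝 1, P.coneMon s ρ = 1 → ρ = 1 := by
  have hlog : ∀ j, Filter.Tendsto (fun ρ : Fin n → ℂ => Complex.log (ρ j)) (𝓝 1) (𝓝 0) := by
    intro j
    have h1 : ContinuousAt (fun ρ : Fin n → ℂ => Complex.log (ρ j)) 1 :=
      ContinuousAt.clog (continuous_apply j).continuousAt (by simp)
    simpa [ContinuousAt] using h1
  -- Near `1` the logarithms of the characters are too small to be nonzero multiples of `2πi`.
  have hsum : ∀ i, ∀ᶠ ρ : Fin n → ℂ in 𝓝 1,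
      ‖∑ j, (P.stacky (s.idx j) i : ℂ) * Complex.log (ρ j)‖ < 1 := by
    intro i
    have h1 : Filter.Tendsto (fun ρ : Fin n → ℂ =>
        ‖∑ j, (P.stacky (s.idx j) i : ℂ) * Complex.log (ρ j)‖) (𝓝 1) (𝓝 0) := by
      have := (tendsto_finsetSum Finset.univ fun j _ => (hlog j).const_mul
        (P.stacky (s.idx j) i : ℂ)).norm
      simpa using this
    exact h1.eventually (gt_mem_nhds one_pos)
  have hne : ∀ j, ∀ᶠ ρ : Fin n → ℂ in 𝓝 1, ρ j ≠ 0 := fun j =>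
    (continuous_apply j).continuousAt.eventually_ne (by simp)
  filter_upwards [Filter.eventually_all.2 hsum, Filter.eventually_all.2 hne] with ρ h1 h2 h3
  have h4 : ∀ i, ∑ j, (P.stacky (s.idx j) i : ℂ) * Complex.log (ρ j) = 0 := by
    intro i
    have h5 : Complex.exp (∑ j, (P.stacky (s.idx j) i : ℂ) * Complex.log (ρ j)) = 1 := by
      rw [← coneMon_exp]
      have : (fun j => Complex.exp (Complex.log (ρ j))) = ρ := by
        ext j; exact Complex.exp_log (h2 j)
      rw [this, h3]; rfl
    obtain ⟨a, ha⟩ := Complex.exp_eq_one_iff.1 h5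
    have h6 := h1 i
    rw [ha] at h6 ⊢
    have h7 : ‖(a : ℂ) * (2 * Real.pi * Complex.I)‖ = |(a : ℝ)| * (2 * Real.pi) := by
      simp [abs_of_pos Real.pi_pos]
    rw [h7] at h6
    have h8 : |(a : ℝ)| < 1 := by nlinarith [Real.pi_gt_three, abs_nonneg (a : ℝ)]
    have h9 : a = 0 := by
      have : |a| < 1 := by exact_mod_cast h8
      exact Int.abs_lt_one_iff.1 this
    simp [h9]
  have hu : IsUnit ((P.coneMat s).map (Complex.ofRealHom)) := by
    have := (hP.isUnit_coneMat s).map (Complex.ofRealHom.mapMatrix (m := Fin n))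
    simpa using this
  have h5 : ((P.coneMat s).map (Complex.ofRealHom)).mulVec (fun j => Complex.log (ρ j)) = 0 := by
    ext i
    simpa [Matrix.mulVec, dotProduct, coneMat] using h4 i
  have h6 : (fun j => Complex.log (ρ j)) = 0 :=
    Matrix.mulVec_injective_iff_isUnit.2 hu (by rw [h5, Matrix.mulVec_zero])
  ext j
  rw [← Complex.exp_log (h2 j), congrFun h6 j]
  simp

/-! ### Changes of charts over the open torus orbit -/

/-- Over the open torus orbit there is a change of charts with a prescribed value at a point. In
logarithmic coordinates it is linear with matrix `B'⁻¹ B`. It carries one of two continuous lifts of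
a map to the other, as soon as the limits correspond. -/
theorem IsLabeledPolytope.exists_transition {P : PolytopeData n m} (hP : P.IsLabeledPolytope)
    (s s' : P.MaxCone) {x x' : Fin n → ℂ} (hx : ∀ j, x j ≠ 0) (h : P.chart s' x' = P.chart s x) :
    ∃ τ : (Fin n → ℂ) → Fin n → ℂ, P.IsTransition s s' τ x ∧ τ x = x' ∧
      ∀ (l : Filter ℂ) (f f' : ℂ → Fin n → ℂ), Filter.Tendsto f l (𝓝 x) →
        Filter.Tendsto f' l (𝓝 x') → (∀ᶠ a in l, P.chart s' (f' a) = P.chart s (f a)) →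
        ∀ᶠ a in l, τ (f a) = f' a := by
  have hx' : ∀ j, x' j ≠ 0 := by
    rw [← P.isGeneric_chart s', h, P.isGeneric_chart]; exact hx
  have hdet := (Matrix.isUnit_iff_isUnit_det _).1 (hP.isUnit_coneMat s')
  set M : Matrix (Fin n) (Fin n) ℝ := (P.coneMat s')⁻¹ * P.coneMat s with hM
  have hBM : P.coneMat s' * M = P.coneMat s := by
    rw [hM, ← mul_assoc, Matrix.mul_nonsing_inv _ hdet, one_mul]
  have hBM' : ∀ i l, ∑ j, (P.stacky (s'.idx j) i : ℂ) * (M j l : ℂ) = P.stacky (s.idx l) i := by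
    intro i l
    have := congrFun (congrFun hBM i) l
    rw [Matrix.mul_apply] at this
    have h2 := congrArg (fun r : ℝ => (r : ℂ)) this
    simpa [coneMat] using h2
  have hxx : P.coneMon s' x' = P.coneMon s x := by
    rw [← torusCoord_chart, ← torusCoord_chart, h]
  set τ : (Fin n → ℂ) → Fin n → ℂ := fun y j =>
    x' j * Complex.exp (∑ l, (M j l : ℂ) * Complex.log (y l / x l)) with hτ
  have hτx : τ x = x' := by
    ext j
    simp [hτ, div_self (hx _)]
  have hτ0 : ∀ y j, τ y j ≠ 0 := fun y j => mul_ne_zero (hx' j) (Complex.exp_ne_zero _)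
  have hmon : ∀ y, (∀ j, y j ≠ 0) → P.coneMon s' (τ y) = P.coneMon s y := by
    intro y hy
    ext i
    rw [hτ, coneMon_mul, coneMon_exp]
    have h1 : ∑ j, (P.stacky (s'.idx j) i : ℂ) * ∑ l, (M j l : ℂ) * Complex.log (y l / x l)
        = ∑ l, (P.stacky (s.idx l) i : ℂ) * Complex.log (y l / x l) := by
      simp only [Finset.mul_sum, ← mul_assoc]
      rw [Finset.sum_comm]
      simp only [← Finset.sum_mul, hBM']
    have h2 : (fun l => Complex.exp (Complex.log (y l / x l))) = fun l => y l / x l := by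
      ext l; exact Complex.exp_log (div_ne_zero (hy l) (hx l))
    rw [h1, ← coneMon_exp, h2, coneMon_div, hxx]
    field_simp [P.coneMon_ne_zero s hx i]
  have hchart : ∀ y, (∀ j, y j ≠ 0) → P.chart s' (τ y) = P.chart s y := by
    intro y hy
    refine P.torusCoord_injOn ((P.isGeneric_chart _ _).2 (hτ0 y)) ((P.isGeneric_chart _ _).2 hy) ?_
    rw [torusCoord_chart, torusCoord_chart, hmon y hy]
  have hne : ∀ᶠ y : Fin n → ℂ in 𝓝 x, ∀ j, y j ≠ 0 :=
    Filter.eventually_all.2 fun j => (continuous_apply j).continuousAt.eventually_ne (hx j)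
  have hslit : ∀ᶠ y : Fin n → ℂ in 𝓝 x, ∀ j, y j / x j ∈ Complex.slitPlane := by
    refine Filter.eventually_all.2 fun j => ?_
    have hc : ContinuousAt (fun y : Fin n → ℂ => y j / x j) x :=
      (continuous_apply j).continuousAt.div_const _
    refine hc.eventually (Complex.isOpen_slitPlane.mem_nhds ?_)
    simp only [div_self (hx j)]
    exact Complex.one_mem_slitPlane
  have hdiff : ∀ᶠ y in 𝓝 x, DifferentiableAt ℂ τ y := by
    filter_upwards [hslit] with y hy
    rw [differentiableAt_pi]
    intro j
    refine DifferentiableAt.const_mul (DifferentiableAt.cexp (DifferentiableAt.fun_sum fun l _ =>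
      DifferentiableAt.const_mul (DifferentiableAt.clog (f := fun y : Fin n → ℂ => y l / x l)
        (by simp only [div_eq_mul_inv]; fun_prop) (hy l)) _)) _
  refine ⟨τ, ?_, hτx, ?_⟩
  · filter_upwards [hne, hdiff] with y hy hy'
    exact ⟨hy', hchart y hy⟩
  -- The coordinates of `τ ∘ f` and `f'` have the same characters and a quotient tending to `1`.
  · intro l f f' hf hf' hff
    have hτc : Filter.Tendsto (fun a => τ (f a)) l (𝓝 x') := by
      have : ContinuousAt τ x := hdiff.self_of_nhds.continuousAt
      rw [ContinuousAt, hτx] at this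
      exact this.comp hf
    have hρ : Filter.Tendsto (fun a => fun j => τ (f a) j / f' a j) l (𝓝 1) := by
      rw [tendsto_pi_nhds]
      intro j
      have := ((continuous_apply j).tendsto x').comp hτc |>.div
        (((continuous_apply j).tendsto x').comp hf') (hx' j)
      rw [div_self (hx' j)] at this
      exact this
    have hne' : ∀ᶠ y : Fin n → ℂ in 𝓝 x', ∀ j, y j ≠ 0 :=
      Filter.eventually_all.2 fun j => (continuous_apply j).continuousAt.eventually_ne (hx' j)
    filter_upwards [hρ.eventually (hP.eventually_eq_one s'), hff, hf.eventually hne,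
      hf'.eventually hne'] with a h1 h2 h3 h4
    have h5 := h1 (by
      ext i
      rw [coneMon_div, ← P.torusCoord_chart s' (f' a), h2, torusCoord_chart, hmon _ h3]
      exact div_self (P.coneMon_ne_zero s h3 i))
    ext j
    exact (div_eq_one_iff_eq (h4 j)).1 (congrFun h5 j)

/-- In the logarithmic frames `B · diag(x)⁻¹` all changes of charts over the open torus orbit have
trivial derivative: they preserve the characters. -/
theorem jacobian_transition (P : PolytopeData n m) {s s' : P.MaxCone}
    {τ : (Fin n → ℂ) → Fin n → ℂ} {x : Fin n → ℂ} (hτ : P.IsTransition s s' τ x)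
    (hx : ∀ j, x j ≠ 0) :
    (P.coneMat s').map Complex.ofRealHom * (Matrix.diagonal fun j => (τ x j)⁻¹) * jacobian τ x =
      (P.coneMat s).map Complex.ofRealHom * Matrix.diagonal fun j => (x j)⁻¹ := by
  have hd : DifferentiableAt ℂ τ x := hτ.self_of_nhds.1
  have hx' : ∀ j, τ x j ≠ 0 := by
    rw [← P.isGeneric_chart s', hτ.self_of_nhds.2, P.isGeneric_chart]; exact hx
  ext i l
  have hp : HasDerivAt (fun t : ℂ => x + t • (Pi.single l 1 : Fin n → ℂ))
      (Pi.single l 1) 0 := by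
    simpa using ((hasDerivAt_id (0 : ℂ)).smul_const (Pi.single l 1 : Fin n → ℂ)).const_add x
  have hp0 : x + (0 : ℂ) • (Pi.single l 1 : Fin n → ℂ) = x := by simp
  have hq : HasDerivAt (fun t : ℂ => τ (x + t • (Pi.single l 1 : Fin n → ℂ)))
      (fderiv ℂ τ x (Pi.single l 1)) 0 := by
    have h1 : HasFDerivAt τ (fderiv ℂ τ x) (x + (0 : ℂ) • (Pi.single l 1 : Fin n → ℂ)) := by
      rw [hp0]; exact hd.hasFDerivAt
    exact h1.comp_hasDerivAt 0 hp
  have hpj := fun j => hasDerivAt_pi.1 hp j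
  have hqj := fun j => hasDerivAt_pi.1 hq j
  have heq : (fun t : ℂ => ∏ j, (τ (x + t • (Pi.single l 1 : Fin n → ℂ)) j) ^ P.stacky (s'.idx j) i)
      =ᶠ[𝓝 0] fun t : ℂ => ∏ j, ((x + t • (Pi.single l 1 : Fin n → ℂ)) j) ^ P.stacky (s.idx j) i := by
    have h1 := hp.continuousAt.tendsto
    rw [hp0] at h1
    filter_upwards [h1.eventually hτ] with t ht
    have h2 := congrFun (congrArg P.torusCoord ht.2) i
    rw [torusCoord_chart, torusCoord_chart] at h2
    exact h2
  have hL := (logDeriv_congr_nhds heq).self_of_nhds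
  rw [logDeriv_prod (f := fun j t => (τ (x + t • (Pi.single l 1 : Fin n → ℂ)) j) ^
      P.stacky (s'.idx j) i) (fun j _ => by
        simp only [zero_smul, add_zero]; exact zpow_ne_zero _ (hx' j))
      (fun j _ => (hqj j).differentiableAt.zpow (Or.inl (by simpa using hx' j))),
    logDeriv_prod (f := fun j t => ((x + t • (Pi.single l 1 : Fin n → ℂ)) j) ^
      P.stacky (s.idx j) i) (fun j _ => by
        simp only [zero_smul, add_zero]; exact zpow_ne_zero _ (hx j))
      (fun j _ => (hpj j).differentiableAt.zpow (Or.inl (by simpa using hx j)))] at hL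
  simp only [logDeriv_fun_zpow (hqj _).differentiableAt,
    logDeriv_fun_zpow (hpj _).differentiableAt, logDeriv_apply, (hqj _).deriv, (hpj _).deriv,
    zero_smul, add_zero] at hL
  rw [Matrix.mul_apply, Matrix.mul_diagonal]
  simp only [Matrix.mul_diagonal, Matrix.map_apply, jacobian, Matrix.of_apply, coneMat]
  simp only [Complex.ofRealHom_eq_coe, Complex.ofReal_intCast]
  calc _ = ∑ j, (P.stacky (s'.idx j) i : ℂ) * ((fderiv ℂ τ x (Pi.single l 1)) j / τ x j) :=
        Finset.sum_congr rfl fun j _ => by rw [div_eq_mul_inv]; ring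
    _ = _ := hL
    _ = _ := by
        rw [Finset.sum_eq_single l]
        · simp [div_eq_mul_inv]
        · intro j _ hj
          simp [Pi.single_eq_of_ne hj]
        · simp

end PolytopeData

namespace DiscAnalysis

/-! ### An argument principle for continuous functions -/

/-- A continuous function without zeros on the closed disc has a continuous logarithm. -/
theorem exists_continuous_log {S : ℂ → ℂ} (hS : ContinuousOn S (Metric.closedBall 0 1))
    (h0 : ∀ z ∈ Metric.closedBall (0 : ℂ) 1, S z ≠ 0) :
    ∃ G : ℂ → ℂ, Continuous G ∧ ∀ z ∈ Metric.closedBall (0 : ℂ) 1, Complex.exp (G z) = S z := by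
  -- The function is extended to the plane by the radial retraction onto the disc.
  set r : ℂ → ℂ := fun z => z / (max 1 ‖z‖ : ℝ) with hr
  have hpos : ∀ z : ℂ, 0 < max 1 ‖z‖ := fun z => lt_max_of_lt_left one_pos
  have hrc : Continuous r := by
    refine Continuous.div continuous_id (by fun_prop) fun z => ?_
    exact_mod_cast (hpos z).ne'
  have hrm : ∀ z, r z ∈ Metric.closedBall (0 : ℂ) 1 := by
    intro z
    rw [mem_closedBall_zero_iff, hr]
    simp only [norm_div, Complex.norm_real, Real.norm_of_nonneg (hpos z).le]
    exact (div_le_one (hpos z)).2 (le_max_right _ _)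
  have hrid : ∀ z ∈ Metric.closedBall (0 : ℂ) 1, r z = z := by
    intro z hz
    rw [mem_closedBall_zero_iff] at hz
    simp [hr, max_eq_left hz]
  have huniv : IsSimplyConnected (Set.univ : Set ℂ) := by
    have : ContractibleSpace (Set.univ : Set ℂ) := convex_univ.contractibleSpace ⟨0, trivial⟩
    exact inferInstanceAs (SimplyConnectedSpace (Set.univ : Set ℂ))
  obtain ⟨G, hG, hG'⟩ := Complex.exists_continuousOn_eqOn_exp_comp huniv isOpen_univ
    (g := fun z => S (r z)) (hS.comp_continuous hrc hrm).continuousOn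
    (by rintro ⟨z, -, hz⟩; exact h0 _ (hrm z) hz)
  refine ⟨G, continuousOn_univ.1 hG, fun z hz => ?_⟩
  have := hG' (Set.mem_univ z)
  simpa [hrid z hz] using this

/-- A continuous real function with values in `2πℤ` is constant. -/
theorem eq_of_exp_eq_one {δ : ℝ → ℝ} (hδ : Continuous δ)
    (h : ∀ t, Complex.exp (δ t * Complex.I) = 1) (s t : ℝ) : δ s = δ t := by
  have h1 : ∀ t, ∃ a : ℤ, (a : ℝ) = δ t / (2 * Real.pi) := by
    intro t
    obtain ⟨a, ha⟩ := Complex.exp_eq_one_iff.1 (h t)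
    refine ⟨a, ?_⟩
    have h2 : (δ t : ℂ) = a * (2 * Real.pi) := by
      refine mul_right_cancel₀ Complex.I_ne_zero ?_
      rw [ha]; ring
    have h3 : δ t = a * (2 * Real.pi) := by exact_mod_cast h2
    rw [h3, mul_div_cancel_right₀ _ (by positivity)]
  choose a ha using h1
  have hac : Continuous a := by
    refine Int.isClosedEmbedding_coe_real.isEmbedding.continuous_iff.2 ?_
    have : ((↑) : ℤ → ℝ) ∘ a = fun t => δ t / (2 * Real.pi) := funext ha
    rw [this]
    fun_prop
  have h2 : a s = a t := PreconnectedSpace.constant inferInstance hac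
  have h3 := ha s
  rw [h2, ha t] at h3
  exact ((div_left_inj' (by positivity)).1 h3).symm

/-- **Argument principle**, for a continuous function on the closed disc which near each interior
point is a power of the distance up to a nonvanishing continuous factor: if the square of
its direction does not wind along the boundary circle, then it has no zeros. After division by
`∏ (z - p)^N` it has a logarithm, so that its winding number is the sum of the `N`. -/
theorem ne_zero_of_winding_eq_zero {S : ℂ → ℂ} (hS : ContinuousOn S (Metric.closedBall 0 1))
    (hbd : ∀ z : ℂ, ‖z‖ = 1 → S z ≠ 0)
    (hloc : ∀ p ∈ Metric.ball (0 : ℂ) 1, ∃ N : ℕ, ∃ c : ℂ, c ≠ 0 ∧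
      Filter.Tendsto (fun z => S z / (z - p) ^ N) (𝓝[≠] p) (𝓝 c))
    {θ : ℝ → ℝ} (hθ : Continuous θ)
    (hSθ : ∀ t : ℝ, S (Complex.exp (t * Complex.I)) ^ 2 / (‖S (Complex.exp (t * Complex.I))‖ : ℂ) ^ 2
      = Complex.exp (θ t * Complex.I))
    (hper : θ (2 * Real.pi) = θ 0) :
    ∀ z ∈ Metric.closedBall (0 : ℂ) 1, S z ≠ 0 := by
  classical
  choose! N c hc hlim using hloc
  set Z : Set ℂ := {z | z ∈ Metric.closedBall (0 : ℂ) 1 ∧ S z = 0} with hZ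
  have hZball : ∀ z ∈ Z, z ∈ Metric.ball (0 : ℂ) 1 := by
    intro z hz
    rw [mem_ball_zero_iff]
    exact lt_of_le_of_ne (mem_closedBall_zero_iff.1 hz.1) fun h => hbd z h hz.2
  have hiso : ∀ p ∈ Metric.ball (0 : ℂ) 1, ∀ᶠ z in 𝓝[≠] p, S z ≠ 0 := by
    intro p hp
    filter_upwards [(hlim p hp).eventually_ne (hc p hp)] with z hz h0
    exact hz (by simp [h0])
  have hnear : ∀ p ∈ Metric.closedBall (0 : ℂ) 1,
      ∀ᶠ z in 𝓝[Metric.closedBall 0 1 \ {p}] p, z ∉ Z := by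
    intro p hp
    by_cases hpb : p ∈ Metric.ball (0 : ℂ) 1
    · exact ((hiso p hpb).filter_mono (nhdsWithin_mono _ fun z hz => hz.2)).mono
        fun z hz hz' => hz hz'.2
    · have hn : ‖p‖ = 1 := by
        rw [mem_ball_zero_iff, not_lt] at hpb
        exact le_antisymm (mem_closedBall_zero_iff.1 hp) hpb
      exact (((hS p hp).mono Set.sdiff_subset).eventually_ne (hbd p hn)).mono
        fun z hz hz' => hz hz'.2
  have hfin : Z.Finite := by
    by_contra hinf
    obtain ⟨x, hx, hacc⟩ := Set.Infinite.exists_accPt_of_subset_isCompact hinf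
      (isCompact_closedBall (0 : ℂ) 1) fun z hz => hz.1
    rw [accPt_iff_frequently] at hacc
    have h1 := hnear x hx
    rw [eventually_nhdsWithin_iff] at h1
    obtain ⟨y, ⟨hyx, hyZ⟩, hy⟩ := (hacc.and_eventually h1).exists
    exact hy ⟨hyZ.1, hyx⟩ hyZ
  set Zf := hfin.toFinset with hZf
  have hmemZf : ∀ z, z ∈ Zf ↔ z ∈ Z := fun z => hfin.mem_toFinset
  -- The quotient by the polynomial `Q` with the same zeros extends to a function `L` without zeros,
  -- which has a continuous logarithm `G`.
  set Q : ℂ → ℂ := fun z => ∏ q ∈ Zf, (z - q) ^ N q with hQ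
  have hQc : Continuous Q := by rw [hQ]; fun_prop
  have hQ0 : ∀ z, z ∉ Z → Q z ≠ 0 := by
    intro z hz
    refine Finset.prod_ne_zero_iff.2 fun q hq => pow_ne_zero _ (sub_ne_zero.2 ?_)
    rintro rfl
    exact hz ((hmemZf z).1 hq)
  have hL : ∀ p ∈ Metric.closedBall (0 : ℂ) 1, ∃ L : ℂ, L ≠ 0 ∧ (p ∉ Z → L = S p / Q p) ∧
      Filter.Tendsto (fun z => S z / Q z) (𝓝[Metric.closedBall 0 1 \ {p}] p) (𝓝 L) := by
    intro p hp
    by_cases hpZ : p ∈ Z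
    · have hpb := hZball p hpZ
      have h1 : ∏ q ∈ Zf.erase p, (p - q) ^ N q ≠ 0 := by
        refine Finset.prod_ne_zero_iff.2 fun q hq => pow_ne_zero _ (sub_ne_zero.2 ?_)
        exact (Finset.ne_of_mem_erase hq).symm
      have h2 : Continuous fun z => ∏ q ∈ Zf.erase p, (z - q) ^ N q := by fun_prop
      refine ⟨c p / ∏ q ∈ Zf.erase p, (p - q) ^ N q, div_ne_zero (hc p hpb) h1,
        fun h => absurd hpZ h, ?_⟩
      have h3 := ((hlim p hpb).mono_left (nhdsWithin_mono p
        (s := Metric.closedBall 0 1 \ {p}) fun z hz => hz.2)).div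
        ((h2.tendsto p).mono_left nhdsWithin_le_nhds) h1
      refine h3.congr fun z => ?_
      rw [Pi.div_apply, hQ, div_div, Finset.mul_prod_erase Zf (fun q => (z - q) ^ N q)
        ((hmemZf p).2 hpZ)]
    · refine ⟨S p / Q p, div_ne_zero (fun h => hpZ ⟨hp, h⟩) (hQ0 p hpZ), fun _ => rfl, ?_⟩
      exact ((hS p hp).mono Set.sdiff_subset).div
        ((hQc.tendsto p).mono_left nhdsWithin_le_nhds) (hQ0 p hpZ)
  choose! L hL0 hLeq hLlim using hL
  have hLc : ContinuousOn L (Metric.closedBall 0 1) := by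
    intro p hp
    rw [← continuousWithinAt_sdiff_self, ContinuousWithinAt]
    refine (hLlim p hp).congr' ?_
    filter_upwards [hnear p hp, self_mem_nhdsWithin] with z hz hz'
    exact (hLeq z hz'.1 hz).symm
  obtain ⟨G, hGc, hG⟩ := exists_continuous_log hLc hL0
  -- On the boundary circle `S = exp (i K t + H)` with a periodic function `H`.
  set E : ℝ → ℂ := fun t => Complex.exp (t * Complex.I) with hE
  have hEn : ∀ t, ‖E t‖ = 1 := fun t => Complex.norm_exp_ofReal_mul_I t
  have hEc : Continuous E := by rw [hE]; fun_prop
  set H : ℝ → ℂ := fun t => G (E t) + ∑ q ∈ Zf, N q * Complex.log (1 - q / E t) with hH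
  set K : ℕ := ∑ q ∈ Zf, N q with hK
  have hslit : ∀ q ∈ Zf, ∀ t, 1 - q / E t ∈ Complex.slitPlane := by
    intro q hq t
    have hq1 := mem_ball_zero_iff.1 (hZball q ((hmemZf q).1 hq))
    have h1 : ‖-(q / E t)‖ < 1 := by rw [norm_neg, norm_div, hEn, div_one]; exact hq1
    have := Complex.mem_slitPlane_of_norm_lt_one h1
    rwa [← sub_eq_add_neg] at this
  have hHc : Continuous H := by
    refine (hGc.comp hEc).add (continuous_finsetSum _ fun q hq => continuous_const.mul ?_)
    refine Continuous.clog (continuous_const.sub (continuous_const.div hEc fun t => ?_))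
      (hslit q hq)
    exact Complex.exp_ne_zero _
  have hSE : ∀ t, S (E t) = Complex.exp (K * t * Complex.I + H t) := by
    intro t
    have hmem : E t ∈ Metric.closedBall (0 : ℂ) 1 := by
      rw [mem_closedBall_zero_iff, hEn]
    have hnZ : E t ∉ Z := fun h => hbd _ (hEn t) h.2
    have h1 : S (E t) = L (E t) * Q (E t) := by
      rw [hLeq _ hmem hnZ, div_mul_cancel₀ _ (hQ0 _ hnZ)]
    have h2 : ∀ q ∈ Zf, (E t - q) ^ N q =
        Complex.exp (N q * t * Complex.I + N q * Complex.log (1 - q / E t)) := by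
      intro q hq
      have h3 : E t - q = Complex.exp (t * Complex.I + Complex.log (1 - q / E t)) := by
        rw [Complex.exp_add, Complex.exp_log (Complex.slitPlane_ne_zero (hslit q hq t)), mul_sub,
          mul_one, mul_div_cancel₀ _ (Complex.exp_ne_zero _)]
      rw [h3, ← Complex.exp_nat_mul]
      congr 1; ring
    rw [h1, ← hG _ hmem, hQ]
    simp only
    rw [Finset.prod_congr rfl h2, ← Complex.exp_sum, ← Complex.exp_add, Finset.sum_add_distrib, hH,
      hK]
    congr 1
    push_cast
    simp only [Finset.sum_mul]
    ring
  have hdir : ∀ t, S (E t) ^ 2 / (‖S (E t)‖ : ℂ) ^ 2 =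
      Complex.exp (((2 * (K * t + (H t).im) : ℝ) : ℂ) * Complex.I) := by
    intro t
    rw [hSE, Complex.norm_exp, Complex.ofReal_exp, ← Complex.exp_nat_mul, ← Complex.exp_nat_mul,
      ← Complex.exp_sub]
    congr 1
    apply Complex.ext <;> simp
  -- Angle functions of the same curve differ by a constant; comparing them at the two ends of the
  -- circle, the number `K` of zeros vanishes.
  set δ : ℝ → ℝ := fun t => θ t - 2 * (K * t + (H t).im) with hδ
  have hδc : Continuous δ := by
    have : Continuous fun t => (H t).im := Complex.continuous_im.comp hHc
    rw [hδ]; fun_prop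
  have hδ1 : ∀ t, Complex.exp (δ t * Complex.I) = 1 := by
    intro t
    have h1 := hSθ t
    rw [hdir t] at h1
    rw [hδ, Complex.ofReal_sub, sub_mul, Complex.exp_sub, ← h1, div_self (Complex.exp_ne_zero _)]
  have hEper : E (2 * Real.pi) = E 0 := by
    simp [hE, Complex.exp_two_pi_mul_I]
  have hHper : H (2 * Real.pi) = H 0 := by simp only [hH, hEper]
  have hK0 : K = 0 := by
    have h1 := eq_of_exp_eq_one hδc hδ1 (2 * Real.pi) 0
    simp only [hδ, hper, hHper] at h1
    have h2 : (K : ℝ) * Real.pi = 0 := by linarith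
    have h3 := (mul_eq_zero.1 h2).resolve_right Real.pi_ne_zero
    exact_mod_cast h3
  intro z hz hz0
  have hzZ : z ∈ Z := ⟨hz, hz0⟩
  have hzb := hZball z hzZ
  have hN : N z = 0 := (Finset.sum_eq_zero_iff.1 hK0) z ((hmemZf z).2 hzZ)
  have h1 := hlim z hzb
  simp only [hN, pow_zero, div_one] at h1
  have h2 : Filter.Tendsto S (𝓝[≠] z) (𝓝 (S z)) :=
    ((hS z hz).continuousAt (Metric.closedBall_mem_nhds_of_mem hzb)).tendsto.mono_left
      nhdsWithin_le_nhds
  exact hc z hzb ((tendsto_nhds_unique h1 h2).trans hz0)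

/-! ### The branched covering `ζ ↦ p + ζ ^ k` -/

theorem nhds_le_map_pow (p ζ₀ : ℂ) {k : ℕ} (hk : k ≠ 0) :
    𝓝 (p + ζ₀ ^ k) ≤ Filter.map (fun ζ => p + ζ ^ k) (𝓝 ζ₀) := by
  have han : AnalyticOnNhd ℂ (fun ζ : ℂ => p + ζ ^ k) Set.univ := fun z _ => by fun_prop
  refine (han ζ₀ trivial).eventually_constant_or_nhds_le_map_nhds.resolve_left fun h => ?_
  have h1 : (fun ζ : ℂ => p + ζ ^ k) = fun _ => p + ζ₀ ^ k :=
    han.eq_of_eventuallyEq (fun _ _ => analyticAt_const) (z₀ := ζ₀) h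
  have h2 := (congrFun h1 0).trans (congrFun h1 1).symm
  simp [hk] at h2

theorem tendsto_of_tendsto_pow {Y : Type*} {l : Filter Y} {p : ℂ} {k : ℕ} (hk : k ≠ 0) {f : ℂ → Y}
    (h : Filter.Tendsto (fun ζ => f (p + ζ ^ k)) (𝓝[≠] 0) l) : Filter.Tendsto f (𝓝[≠] p) l := by
  intro t ht
  have h1 := mem_nhdsWithin_iff_eventually.1 (h ht)
  have h2 : ∀ᶠ z in 𝓝 p, z ∈ f ⁻¹' t ∪ {p} := by
    have h3 := nhds_le_map_pow p 0 hk
    rw [zero_pow hk, add_zero] at h3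
    refine h3 ?_
    change ∀ᶠ ζ in 𝓝 (0 : ℂ), p + ζ ^ k ∈ f ⁻¹' t ∪ {p}
    filter_upwards [h1] with ζ hζ
    by_cases h0 : ζ = 0
    · right; simp [h0, hk]
    · exact Or.inl (hζ h0)
  refine mem_nhdsWithin_iff_eventually.2 ?_
  filter_upwards [h2] with z hz hzp
  exact hz.resolve_right hzp

theorem eventually_of_eventually_pow {p : ℂ} {k : ℕ} (hk : k ≠ 0) {Q : ℂ → Prop}
    (h : ∀ᶠ ζ in 𝓝[≠] (0 : ℂ), Q (p + ζ ^ k)) : ∀ᶠ z in 𝓝[≠] p, Q z :=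
  Filter.tendsto_principal.1 (tendsto_of_tendsto_pow (f := fun z => z) (l := Filter.principal {z | Q z})
    hk (Filter.tendsto_principal.2 h))

theorem tendsto_add_pow {p : ℂ} {k : ℕ} (hk : k ≠ 0) :
    Filter.Tendsto (fun ζ : ℂ => p + ζ ^ k) (𝓝[≠] 0) (𝓝[≠] p) := by
  refine tendsto_nhdsWithin_iff.2 ⟨?_, ?_⟩
  · have : Continuous fun ζ : ℂ => p + ζ ^ k := by fun_prop
    have h := this.tendsto 0
    rw [zero_pow hk, add_zero] at h
    exact h.mono_left nhdsWithin_le_nhds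
  · filter_upwards [self_mem_nhdsWithin] with ζ hζ h
    exact hζ (by simpa [hk] using h)

/-- A `k`-th root. -/
def root (k : ℕ) (z : ℂ) : ℂ := z ^ ((k : ℂ)⁻¹)

theorem root_pow {k : ℕ} (hk : k ≠ 0) (z : ℂ) : root k z ^ k = z := Complex.cpow_nat_inv_pow z hk

theorem root_mem_ball {k : ℕ} (hk : k ≠ 0) {p z : ℂ} {ε : ℝ} (hε : 0 < ε)
    (hz : z ∈ Metric.ball p (ε ^ k)) : root k (z - p) ∈ Metric.ball (0 : ℂ) ε := by
  rw [mem_ball_zero_iff]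
  refine lt_of_pow_lt_pow_left₀ k hε.le ?_
  rw [← norm_pow, root_pow hk, ← dist_eq_norm]
  exact hz

/-- A continuous function of `ζ` that depends only on `ζ ^ k` is a continuous function of
`z = p + ζ ^ k`. -/
theorem continuousAt_comp_root {Y : Type*} [TopologicalSpace Y] {k : ℕ} (hk : k ≠ 0) {p : ℂ}
    {G : ℂ → Y} {B : Set ℂ} (hB : IsOpen B) (hG : ContinuousOn G B)
    (hinv : ∀ ζ ∈ B, ∀ ζ' ∈ B, ζ ^ k = ζ' ^ k → G ζ = G ζ')
    (hroot : ∀ ζ ∈ B, ∀ ζ', ζ' ^ k = ζ ^ k → ζ' ∈ B) {z : ℂ} (hz : root k (z - p) ∈ B) :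
    ContinuousAt (fun z => G (root k (z - p))) z := by
  set ζ₀ := root k (z - p) with hζ₀
  have hz₀ : p + ζ₀ ^ k = z := by rw [hζ₀, root_pow hk]; ring
  have h1 : Filter.Tendsto ((fun z => G (root k (z - p))) ∘ fun ζ => p + ζ ^ k) (𝓝 ζ₀)
      (𝓝 (G ζ₀)) := by
    refine (hG.continuousAt (hB.mem_nhds hz)).tendsto.congr' ?_
    filter_upwards [hB.mem_nhds hz] with ζ hζ
    have h2 : root k (p + ζ ^ k - p) ^ k = ζ ^ k := by rw [root_pow hk]; ring
    exact hinv _ hζ _ (hroot _ hζ _ h2) h2.symm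
  have h3 := Filter.tendsto_map'_iff.2 h1
  rw [ContinuousAt]
  have h4 := nhds_le_map_pow p ζ₀ hk
  rw [hz₀] at h4
  exact h3.mono_left h4

theorem eq_zero_of_tendsto_zpow {a : ℤ} {c : ℂ} (hc : c ≠ 0)
    (h : Filter.Tendsto (fun z : ℂ => z ^ a) (𝓝[≠] 0) (𝓝 c)) : a = 0 := by
  have key : ∀ (b : ℕ) (d : ℂ), d ≠ 0 →
      Filter.Tendsto (fun z : ℂ => z ^ b) (𝓝[≠] 0) (𝓝 d) → b = 0 := by
    intro b d hd hb
    by_contra hb0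
    have h1 : Filter.Tendsto (fun z : ℂ => z ^ b) (𝓝[≠] 0) (𝓝 0) := by
      have := ((continuous_pow b).tendsto (0 : ℂ)).mono_left (nhdsWithin_le_nhds (s := {0}ᶜ))
      rwa [zero_pow hb0] at this
    exact hd (tendsto_nhds_unique hb h1)
  obtain ⟨b, rfl | rfl⟩ := a.eq_nat_or_neg
  · simp only [zpow_natCast] at h
    simp [key b c hc h]
  · have h1 := h.inv₀ hc
    simp only [zpow_neg, inv_inv, zpow_natCast] at h1
    simp [key b _ (inv_ne_zero hc) h1]

/-- An equivariant holomorphic function at a branch point: it is a power of `ζ`, with exponent in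
the residue class of the weight, times a continuous function without zero at the branch point. -/
theorem exists_eq_pow_mul {F : ℂ → ℂ} {ε : ℝ} (hε : 0 < ε)
    (hF : DifferentiableOn ℂ F (Metric.ball 0 ε)) (h0 : ¬ ∀ᶠ ζ in 𝓝 0, F ζ = 0) {k : ℕ} {a : ℕ}
    (ha : a < k)
    (hk : ∀ ζ ∈ Metric.ball (0 : ℂ) ε, F (Complex.exp (2 * Real.pi * Complex.I / k) * ζ) =
      Complex.exp (2 * Real.pi * Complex.I * a / k) * F ζ) :
    ∃ (q : ℕ) (g : ℂ → ℂ), ContinuousOn g (Metric.ball 0 ε) ∧ g 0 ≠ 0 ∧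
      ∀ ζ ∈ Metric.ball (0 : ℂ) ε, F ζ = ζ ^ (a + k * q) * g ζ := by
  have hk0 : k ≠ 0 := by omega
  have hball : Metric.ball (0 : ℂ) ε ∈ 𝓝 0 := Metric.ball_mem_nhds _ hε
  obtain ⟨N, g₀, hg₀, hg₀0, hFg⟩ :=
    (hF.analyticAt hball).exists_eventuallyEq_pow_smul_nonzero_iff.2 h0
  simp only [sub_zero, smul_eq_mul] at hFg
  set ω := Complex.exp (2 * Real.pi * Complex.I / k) with hω
  have hprim : IsPrimitiveRoot ω k := Complex.isPrimitiveRoot_exp k hk0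
  have hωa : Complex.exp (2 * Real.pi * Complex.I * a / k) = ω ^ a := by
    rw [hω, ← Complex.exp_nat_mul]; congr 1; ring
  -- The leading coefficient is multiplied by `ω ^ N` and by `ω ^ a` under the rotation.
  have hmod : N ≡ a [MOD k] := by
    have h1 : Filter.Tendsto (fun ζ => ω ^ N * g₀ (ω * ζ)) (𝓝[≠] 0) (𝓝 (ω ^ N * g₀ 0)) := by
      have hc : ContinuousAt (fun ζ => g₀ (ω * ζ)) 0 := by
        have h2 : ContinuousAt g₀ (ω * 0) := by rw [mul_zero]; exact hg₀.continuousAt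
        exact ContinuousAt.comp (g := g₀) h2 (by fun_prop)
      have h3 := hc.tendsto
      rw [mul_zero] at h3
      exact (h3.const_mul _).mono_left nhdsWithin_le_nhds
    have h2 : Filter.Tendsto (fun ζ => ω ^ a * g₀ ζ) (𝓝[≠] 0) (𝓝 (ω ^ a * g₀ 0)) :=
      (hg₀.continuousAt.tendsto.const_mul _).mono_left nhdsWithin_le_nhds
    have hω0 : Filter.Tendsto (fun ζ : ℂ => ω * ζ) (𝓝 0) (𝓝 0) := by
      have : Continuous fun ζ : ℂ => ω * ζ := by fun_prop
      simpa using this.tendsto 0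
    have h3 : (fun ζ => ω ^ N * g₀ (ω * ζ)) =ᶠ[𝓝[≠] 0] fun ζ => ω ^ a * g₀ ζ := by
      filter_upwards [nhdsWithin_le_nhds hFg, nhdsWithin_le_nhds (hω0.eventually hFg),
        nhdsWithin_le_nhds hball, self_mem_nhdsWithin] with ζ e1 e2 e3 e4
      have e5 := hk ζ e3
      rw [e2, e1, hωa, mul_pow] at e5
      refine mul_left_cancel₀ (pow_ne_zero N e4) ?_
      linear_combination e5
    have h4 := tendsto_nhds_unique (h1.congr' h3) h2
    have h5 : ω ^ N = ω ^ a := mul_right_cancel₀ hg₀0 h4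
    rw [pow_eq_pow_mod N hprim.pow_eq_one] at h5
    exact (hprim.pow_inj (Nat.mod_lt _ (Nat.pos_of_ne_zero hk0)) ha h5).trans
      (Nat.mod_eq_of_lt ha).symm
  have hN : N = a + k * (N / k) := by
    have h1 : N % k = a := by rw [hmod, Nat.mod_eq_of_lt ha]
    have := Nat.mod_add_div N k
    omega
  refine ⟨N / k, fun ζ => if ζ = 0 then g₀ 0 else F ζ / ζ ^ N, ?_, by simpa using hg₀0, ?_⟩
  · intro ζ hζ
    refine ContinuousAt.continuousWithinAt ?_
    by_cases hζ0 : ζ = 0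
    · subst hζ0
      refine hg₀.continuousAt.congr ?_
      filter_upwards [hFg] with η hη
      by_cases h : η = 0
      · simp [h]
      · rw [if_neg h, hη, mul_div_cancel_left₀ _ (pow_ne_zero _ h)]
    · have h1 : ContinuousAt (fun η => F η / η ^ N) ζ :=
        ((hF.continuousOn.continuousAt (Metric.isOpen_ball.mem_nhds hζ)).div (by fun_prop)
          (pow_ne_zero _ hζ0))
      refine h1.congr ?_
      filter_upwards [isOpen_ne.mem_nhds hζ0] with η hη
      rw [if_neg hη]
  · intro ζ hζ
    rw [← hN]
    by_cases hζ0 : ζ = 0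
    · subst hζ0
      simpa using hFg.self_of_nhds
    · simp only [if_neg hζ0]
      rw [mul_div_cancel₀ _ (pow_ne_zero _ hζ0)]

/-! ### Functions of constant modulus on the circle -/

/-- A holomorphic function without zeros and of constant modulus on the boundary circle is
constant. -/
theorem eq_const_of_norm_sphere {g : ℂ → ℂ} {r : ℝ} (hg : ContinuousOn g (Metric.closedBall 0 1))
    (hd : DifferentiableOn ℂ g (Metric.ball 0 1)) (h0 : ∀ z ∈ Metric.closedBall (0 : ℂ) 1, g z ≠ 0)
    (hr : ∀ z : ℂ, ‖z‖ = 1 → ‖g z‖ = r) : ∀ z ∈ Metric.closedBall (0 : ℂ) 1, g z = g 0 := by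
  have hcl : closure (Metric.ball (0 : ℂ) 1) = Metric.closedBall 0 1 := closure_ball _ one_ne_zero
  have hfr : ∀ z ∈ frontier (Metric.ball (0 : ℂ) 1), ‖z‖ = 1 := by
    intro z hz
    rw [frontier_ball _ one_ne_zero] at hz
    simpa using hz
  have hdc : DiffContOnCl ℂ g (Metric.ball 0 1) := ⟨hd, by rwa [hcl]⟩
  have hdc' : DiffContOnCl ℂ (fun z => (g z)⁻¹) (Metric.ball 0 1) :=
    hdc.inv (by rw [hcl]; exact h0)
  have hup : ∀ z ∈ Metric.closedBall (0 : ℂ) 1, ‖g z‖ ≤ r := by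
    intro z hz
    rw [← hcl] at hz
    exact Complex.norm_le_of_forall_mem_frontier_norm_le Metric.isBounded_ball hdc
      (fun y hy => (hr y (hfr y hy)).le) hz
  have hlow : ∀ z ∈ Metric.closedBall (0 : ℂ) 1, ‖(g z)⁻¹‖ ≤ r⁻¹ := by
    intro z hz
    rw [← hcl] at hz
    exact Complex.norm_le_of_forall_mem_frontier_norm_le Metric.isBounded_ball hdc'
      (fun y hy => by rw [norm_inv, hr y (hfr y hy)]) hz
  have hmem0 : (0 : ℂ) ∈ Metric.closedBall (0 : ℂ) 1 := by simp
  have hge : r ≤ ‖g 0‖ := by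
    have h1 := hlow 0 hmem0
    have h2 : 0 < ‖g 0‖ := norm_pos_iff.2 (h0 0 hmem0)
    have h3 : 0 < r := lt_of_lt_of_le h2 (hup 0 hmem0)
    rw [norm_inv] at h1
    exact (inv_le_inv₀ h2 h3).1 h1
  have hmax : IsMaxOn (norm ∘ g) (Metric.ball 0 1) 0 := fun z hz =>
    (hup z (Metric.ball_subset_closedBall hz)).trans hge
  have := Complex.eqOn_closure_of_isPreconnected_of_isMaxOn_norm
    (convex_ball (0 : ℂ) 1).isPreconnected Metric.isOpen_ball hdc (by simp) hmax
  rw [hcl] at this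
  exact this

/-! ### Automorphisms of the disc -/

/-- The Blaschke factor `(z - p) / (1 - conj(p) z)`. -/
def mob (p z : ℂ) : ℂ := (z - p) / (1 - (starRingEnd ℂ) p * z)

theorem mob_denom_ne_zero {p z : ℂ} (hp : ‖p‖ < 1) (hz : ‖z‖ ≤ 1) :
    1 - (starRingEnd ℂ) p * z ≠ 0 := by
  intro h
  have h1 : ‖(starRingEnd ℂ) p * z‖ = 1 := by
    rw [← sub_eq_zero.1 h, norm_one]
  rw [norm_mul, RCLike.norm_conj] at h1
  nlinarith [norm_nonneg p, norm_nonneg z]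

theorem norm_mob_identity (p z : ℂ) :
    ‖1 - (starRingEnd ℂ) p * z‖ ^ 2 - ‖z - p‖ ^ 2 = (1 - ‖p‖ ^ 2) * (1 - ‖z‖ ^ 2) := by
  simp only [← Complex.normSq_eq_norm_sq, Complex.normSq_apply, Complex.sub_re, Complex.sub_im,
    Complex.mul_re, Complex.mul_im, Complex.conj_re, Complex.conj_im, Complex.one_re,
    Complex.one_im]
  ring

theorem norm_mob_sphere {p z : ℂ} (hp : ‖p‖ < 1) (hz : ‖z‖ = 1) : ‖mob p z‖ = 1 := by
  have h1 := norm_mob_identity p z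
  rw [hz] at h1
  have h2 : ‖1 - (starRingEnd ℂ) p * z‖ ≠ 0 := norm_ne_zero_iff.2 (mob_denom_ne_zero hp hz.le)
  rw [mob, norm_div, div_eq_one_iff_eq h2]
  have h3 : ‖z - p‖ ^ 2 = ‖1 - (starRingEnd ℂ) p * z‖ ^ 2 := by linarith
  exact (pow_left_inj₀ (norm_nonneg _) (norm_nonneg _) two_ne_zero).1 h3

theorem norm_mob_lt {p z : ℂ} (hp : ‖p‖ < 1) (hz : ‖z‖ < 1) : ‖mob p z‖ < 1 := by
  have h1 := norm_mob_identity p z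
  have h2 : 0 < ‖1 - (starRingEnd ℂ) p * z‖ := norm_pos_iff.2 (mob_denom_ne_zero hp hz.le)
  rw [mob, norm_div, div_lt_one h2]
  have h3 : 0 < (1 - ‖p‖ ^ 2) * (1 - ‖z‖ ^ 2) := by
    have := norm_nonneg p
    have := norm_nonneg z
    refine mul_pos ?_ ?_ <;> nlinarith
  exact lt_of_pow_lt_pow_left₀ 2 h2.le (by linarith)

theorem norm_mob_le {p z : ℂ} (hp : ‖p‖ < 1) (hz : ‖z‖ ≤ 1) : ‖mob p z‖ ≤ 1 := by
  rcases hz.lt_or_eq with h | h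
  · exact (norm_mob_lt hp h).le
  · exact (norm_mob_sphere hp h).le

theorem mob_self (p : ℂ) : mob p p = 0 := by simp [mob]

theorem mob_eq_zero {p z : ℂ} (hp : ‖p‖ < 1) (hz : ‖z‖ ≤ 1) : mob p z = 0 ↔ z = p := by
  rw [mob, div_eq_zero_iff, or_iff_left (mob_denom_ne_zero hp hz), sub_eq_zero]

theorem continuousOn_mob {p : ℂ} (hp : ‖p‖ < 1) : ContinuousOn (mob p) (Metric.closedBall 0 1) := by
  unfold mob
  exact ContinuousOn.div (by fun_prop) (by fun_prop) fun z hz =>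
    mob_denom_ne_zero hp (mem_closedBall_zero_iff.1 hz)

theorem differentiableOn_mob {p : ℂ} (hp : ‖p‖ < 1) :
    DifferentiableOn ℂ (mob p) (Metric.ball 0 1) := by
  unfold mob
  exact DifferentiableOn.div (by fun_prop) (by fun_prop) fun z hz =>
    mob_denom_ne_zero hp (mem_ball_zero_iff.1 hz).le

theorem mob_neg_mob {p z : ℂ} (hp : ‖p‖ < 1) (hz : ‖z‖ ≤ 1) : mob (-p) (mob p z) = z := by
  have h1 := mob_denom_ne_zero hp hz
  have h2 : 1 - (starRingEnd ℂ) p * p ≠ 0 := mob_denom_ne_zero hp hp.le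
  have h3 : 1 - (starRingEnd ℂ) p * z + (starRingEnd ℂ) p * (z - p) ≠ 0 := by
    have : 1 - (starRingEnd ℂ) p * z + (starRingEnd ℂ) p * (z - p) = 1 - (starRingEnd ℂ) p * p := by
      ring
    rwa [this]
  rw [mob, mob, map_neg, sub_neg_eq_add, neg_mul, sub_neg_eq_add, div_add' _ _ _ h1,
    mul_div_assoc', one_add_div h1, div_div_div_cancel_right₀ h1, div_eq_iff h3]
  ring

theorem mob_mob_neg {p z : ℂ} (hp : ‖p‖ < 1) (hz : ‖z‖ ≤ 1) : mob p (mob (-p) z) = z := by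
  have := mob_neg_mob (p := -p) (z := z) (by rwa [norm_neg]) hz
  rwa [neg_neg] at this

/-- The Blaschke factor as a homeomorphism of the closed disc. -/
def mobHomeo (p : ℂ) (hp : ‖p‖ < 1) : ClosedDisc ≃ₜ ClosedDisc where
  toFun z := ⟨mob p z, mem_closedBall_zero_iff.2 (norm_mob_le hp (mem_closedBall_zero_iff.1 z.2))⟩
  invFun z := ⟨mob (-p) z, mem_closedBall_zero_iff.2
    (norm_mob_le (by rwa [norm_neg]) (mem_closedBall_zero_iff.1 z.2))⟩
  left_inv z := Subtype.ext (mob_neg_mob hp (mem_closedBall_zero_iff.1 z.2))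
  right_inv z := Subtype.ext (mob_mob_neg hp (mem_closedBall_zero_iff.1 z.2))
  continuous_toFun := by
    exact ((continuousOn_mob hp).comp_continuous continuous_subtype_val fun z => z.2).subtype_mk _
  continuous_invFun := by
    exact ((continuousOn_mob (p := -p) (by rwa [norm_neg])).comp_continuous
      continuous_subtype_val fun z => z.2).subtype_mk _

theorem isDiscAut_mobHomeo (p : ℂ) (hp : ‖p‖ < 1) : PolytopeData.IsDiscAut (mobHomeo p hp) := by
  have hp' : ‖-p‖ < 1 := by rwa [norm_neg]
  exact ⟨mob p, mob (-p), differentiableOn_mob hp, differentiableOn_mob hp',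
    fun z hz => mem_ball_zero_iff.2 (norm_mob_lt hp (mem_ball_zero_iff.1 hz)),
    fun z hz => mem_ball_zero_iff.2 (norm_mob_lt hp' (mem_ball_zero_iff.1 hz)),
    fun _ => rfl, fun _ => rfl⟩

/-- The Schwarz–Pick lemma. -/
theorem norm_mob_map_le {g : ℂ → ℂ} (hg : DifferentiableOn ℂ g (Metric.ball 0 1))
    (hm : Set.MapsTo g (Metric.ball 0 1) (Metric.ball 0 1)) {p z : ℂ} (hp : ‖p‖ < 1)
    (hz : ‖z‖ < 1) : ‖mob (g p) (g z)‖ ≤ ‖mob p z‖ := by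
  have hp' : ‖-p‖ < 1 := by rwa [norm_neg]
  have hgp : ‖g p‖ < 1 := mem_ball_zero_iff.1 (hm (mem_ball_zero_iff.2 hp))
  have hm1 : Set.MapsTo (mob (-p)) (Metric.ball 0 1) (Metric.ball 0 1) := fun z hz =>
    mem_ball_zero_iff.2 (norm_mob_lt hp' (mem_ball_zero_iff.1 hz))
  have hm2 : Set.MapsTo (mob (g p)) (Metric.ball 0 1) (Metric.ball 0 1) := fun z hz =>
    mem_ball_zero_iff.2 (norm_mob_lt hgp (mem_ball_zero_iff.1 hz))
  have hd := (differentiableOn_mob hgp).comp (hg.comp (differentiableOn_mob hp') hm1) (hm.comp hm1)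
  have h := Complex.norm_le_norm_of_mapsTo_ball hd
    (fun z hz => Metric.ball_subset_closedBall (hm2 (hm (hm1 hz))))
    (by simp [mob]) (norm_mob_lt hp hz)
  simpa [mob_neg_mob hp hz.le] using h

/-- Disc automorphisms preserve the pseudo-hyperbolic distance. -/
theorem norm_mob_discAut {e : ClosedDisc ≃ₜ ClosedDisc} (he : PolytopeData.IsDiscAut e)
    {p z : ClosedDisc} (hp : ‖(p : ℂ)‖ < 1) (hz : ‖(z : ℂ)‖ < 1) :
    ‖mob (e p) (e z)‖ = ‖mob p z‖ := by
  obtain ⟨g, g', hg, hg', hm, hm', heg, heg'⟩ := he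
  have h1 := norm_mob_map_le hg hm hp hz
  have hinv : ∀ y : ClosedDisc, g' (g y) = y := by
    intro y
    rw [← heg y, ← heg', e.symm_apply_apply]
  have h2 := norm_mob_map_le hg' hm' (mem_ball_zero_iff.1 (hm (mem_ball_zero_iff.2 hp)))
    (mem_ball_zero_iff.1 (hm (mem_ball_zero_iff.2 hz)))
  rw [hinv, hinv] at h2
  rw [heg, heg]
  exact le_antisymm h1 h2

end DiscAnalysis

namespace PolytopeData

variable {n m : ℕ} {P : PolytopeData n m} {u : Fin n → ℝ}

open DiscAnalysis

/-! ### Isolated zeros of an orbi-disc -/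

/-- The underlying map of the orbi-disc, as a function on the plane which is constant off the
disc. -/
def OrbiDisc.ext (D : P.OrbiDisc u) (z : ℂ) : P.X :=
  open scoped Classical in
  if h : z ∈ Metric.closedBall (0 : ℂ) 1 then D.map ⟨z, h⟩ else D.map ⟨0, by simp⟩

theorem OrbiDisc.ext_of_mem (D : P.OrbiDisc u) {z : ℂ} (h : z ∈ Metric.closedBall (0 : ℂ) 1) :
    D.ext z = D.map ⟨z, h⟩ := dif_pos h

theorem OrbiDisc.ext_coe (D : P.OrbiDisc u) (z : ClosedDisc) : D.ext z = D.map z :=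
  D.ext_of_mem z.2

theorem OrbiDisc.ext_lift (D : P.OrbiDisc u) (l : P.LocalLift D.map D.pt) {z : ℂ} (hV : z ∈ l.V)
    (h : z ∈ Metric.closedBall (0 : ℂ) 1) : D.ext z = P.chart l.cone (l.F z) := by
  rw [D.ext_of_mem h]
  exact l.lifts ⟨z, h⟩ hV

theorem OrbiDisc.ext_orbiLift (D : P.OrbiDisc u) (o : P.OrbiLift D.map D.pt D.order) {ζ : ℂ}
    (hζ : ζ ∈ Metric.ball (0 : ℂ) o.ε) : D.ext (D.pt + ζ ^ D.order) = P.chart o.cone (o.F ζ) := by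
  have h := Metric.ball_subset_closedBall (o.small ζ hζ)
  rw [D.ext_of_mem h]
  exact o.lifts ζ hζ ⟨_, h⟩ rfl

theorem OrbiDisc.order_ne_zero (D : P.OrbiDisc u) : D.order ≠ 0 := by
  have := D.two_le_order
  omega

theorem OrbiDisc.norm_pt_lt (D : P.OrbiDisc u) : ‖D.pt‖ < 1 := mem_ball_zero_iff.1 D.pt_mem

theorem OrbiDisc.exists_lift_at (D : P.OrbiDisc u) {z : ℂ} (h : z ∈ Metric.closedBall (0 : ℂ) 1)
    (hz : z ≠ D.pt) : ∃ l : P.LocalLift D.map D.pt, z ∈ l.V :=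
  D.exists_lift ⟨z, h⟩ hz

theorem OrbiDisc.continuousOn_ext (D : P.OrbiDisc u) :
    ContinuousOn D.ext (Metric.closedBall 0 1) := by
  rw [continuousOn_iff_continuous_domRestrict]
  have : (Metric.closedBall (0 : ℂ) 1).domRestrict D.ext = D.map := by
    ext z; exact D.ext_coe z
  rw [this]
  exact D.continuous

theorem LocalLift.differentiableAt {w : ClosedDisc → P.X} {p : ℂ} (l : P.LocalLift w p) {z : ℂ}
    (hV : z ∈ l.V) (hz : z ∈ Metric.ball (0 : ℂ) 1) : DifferentiableAt ℂ l.F z :=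
  l.holomorphic.differentiableAt ((l.isOpen.inter Metric.isOpen_ball).mem_nhds ⟨hV, hz⟩)

theorem LocalLift.analyticAt {w : ClosedDisc → P.X} {p : ℂ} (l : P.LocalLift w p) {z : ℂ}
    (hV : z ∈ l.V) (hz : z ∈ Metric.ball (0 : ℂ) 1) (j : Fin n) :
    AnalyticAt ℂ (fun z => l.F z j) z :=
  DifferentiableOn.analyticAt (fun _ hy => (differentiableAt_pi.1 (l.differentiableAt hy.1 hy.2)
    j).differentiableWithinAt) ((l.isOpen.inter Metric.isOpen_ball).mem_nhds ⟨hV, hz⟩)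

theorem OrbiLift.differentiableOn_coord {w : ClosedDisc → P.X} {p : ℂ} {k : ℕ}
    (o : P.OrbiLift w p k) (j : Fin n) :
    DifferentiableOn ℂ (fun ζ => o.F ζ j) (Metric.ball 0 o.ε) :=
  differentiableOn_pi.1 o.holomorphic j

theorem OrbiLift.equivariant_coord {w : ClosedDisc → P.X} {p : ℂ} {k : ℕ}
    (o : P.OrbiLift w p k) (j : Fin n) {ζ : ℂ} (hζ : ζ ∈ Metric.ball (0 : ℂ) o.ε) :
    o.F (Complex.exp (2 * Real.pi * Complex.I / k) * ζ) j =
      Complex.exp (2 * Real.pi * Complex.I * (o.wt j : ℂ) / k) * o.F ζ j := by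
  obtain ⟨ν, hν⟩ := QuotientAddGroup.mk_surjective (o.φ 1)
  rw [o.equivariant ν hν ζ hζ, o.wt_spec ν hν]

/-- Near an interior point, each homogeneous coordinate vanishes identically or has at most an
isolated zero. -/
theorem OrbiDisc.isZero_dichotomy (D : P.OrbiDisc u) (j : Fin m) {z : ℂ}
    (hz : z ∈ Metric.ball (0 : ℂ) 1) :
    (∀ᶠ y in 𝓝[≠] z, P.IsZero j (D.ext y)) ∨ ∀ᶠ y in 𝓝[≠] z, ¬ P.IsZero j (D.ext y) := by
  by_cases hzp : z = D.pt
  · subst hzp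
    obtain ⟨o⟩ := D.exists_orbiLift
    have hball := Metric.ball_mem_nhds (0 : ℂ) o.ε_pos
    by_cases hj : j ∈ Set.range o.cone.idx
    · obtain ⟨j, rfl⟩ := hj
      have hiff : ∀ ζ ∈ Metric.ball (0 : ℂ) o.ε,
          (P.IsZero (o.cone.idx j) (D.ext (D.pt + ζ ^ D.order)) ↔ o.F ζ j = 0) := fun ζ hζ => by
        rw [D.ext_orbiLift o hζ, isZero_chart_idx]
      rcases ((o.differentiableOn_coord j).analyticAt
        hball).eventually_eq_zero_or_eventually_ne_zero with h | h
      · left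
        refine eventually_of_eventually_pow D.order_ne_zero ?_
        filter_upwards [nhdsWithin_le_nhds h, nhdsWithin_le_nhds hball] with ζ h1 h2
        exact (hiff ζ h2).2 h1
      · right
        refine eventually_of_eventually_pow D.order_ne_zero ?_
        filter_upwards [h, nhdsWithin_le_nhds hball] with ζ h1 h2
        exact (hiff ζ h2).not.2 h1
    · right
      refine eventually_of_eventually_pow D.order_ne_zero ?_
      filter_upwards [nhdsWithin_le_nhds hball] with ζ h2
      rw [D.ext_orbiLift o h2]
      exact P.not_isZero_chart _ _ hj
  · obtain ⟨l, hl⟩ := D.exists_lift_at (Metric.ball_subset_closedBall hz) hzp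
    have hnhds : l.V ∩ Metric.ball 0 1 ∈ 𝓝 z :=
      (l.isOpen.inter Metric.isOpen_ball).mem_nhds ⟨hl, hz⟩
    by_cases hj : j ∈ Set.range l.cone.idx
    · obtain ⟨j, rfl⟩ := hj
      have hiff : ∀ y ∈ l.V ∩ Metric.ball 0 1,
          (P.IsZero (l.cone.idx j) (D.ext y) ↔ l.F y j = 0) := fun y hy => by
        rw [D.ext_lift l hy.1 (Metric.ball_subset_closedBall hy.2), isZero_chart_idx]
      rcases (l.analyticAt hl hz j).eventually_eq_zero_or_eventually_ne_zero with h | h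
      · left
        filter_upwards [nhdsWithin_le_nhds h, nhdsWithin_le_nhds hnhds] with y h1 h2
        exact (hiff y h2).2 h1
      · right
        filter_upwards [h, nhdsWithin_le_nhds hnhds] with y h1 h2
        exact (hiff y h2).not.2 h1
    · right
      filter_upwards [nhdsWithin_le_nhds hnhds] with y h2
      rw [D.ext_lift l h2.1 (Metric.ball_subset_closedBall h2.2)]
      exact P.not_isZero_chart _ _ hj

theorem OrbiDisc.ext_mem_fiber (D : P.OrbiDisc u) {z : ℂ} (hz : ‖z‖ = 1) :
    D.ext z ∈ P.fiber u := by
  rw [D.ext_of_mem (mem_closedBall_zero_iff.2 hz.le)]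
  exact D.boundary _ hz

/-- Since the boundary lies in the open torus orbit, by the identity theorem an orbi-disc meets the
toric divisors in isolated points. -/
theorem OrbiDisc.eventually_isGeneric (hP : P.IsLabeledPolytope) (hu : u ∈ interior P.polytope)
    (D : P.OrbiDisc u) {z : ℂ} (hz : z ∈ Metric.ball (0 : ℂ) 1) :
    ∀ᶠ y in 𝓝[≠] z, P.IsGeneric (D.ext y) := by
  refine Filter.eventually_all.2 fun j => (D.isZero_dichotomy j hz).resolve_left fun h => ?_
  have hball : IsOpen (Metric.ball (0 : ℂ) 1) := Metric.isOpen_ball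
  set W : Set ℂ := {y | ∀ᶠ x in 𝓝 y, P.IsZero j (D.ext x)} with hW
  have hWo : IsOpen W := isOpen_setOfPred_eventually_nhds
  have hclos : ∀ y ∈ Metric.closedBall (0 : ℂ) 1,
      (∃ᶠ x in 𝓝[Metric.closedBall 0 1] y, P.IsZero j (D.ext x)) → P.IsZero j (D.ext y) := by
    intro y hy hf
    by_contra hn
    have h1 : {x : P.X | ¬ P.IsZero j x} ∈ 𝓝 (D.ext y) :=
      (P.isClosed_isZero j).isOpen_compl.mem_nhds hn
    have h2 := (D.continuousOn_ext y hy).eventually h1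
    exact hf h2
  have hup : ∀ y ∈ Metric.ball (0 : ℂ) 1, (∀ᶠ x in 𝓝[≠] y, P.IsZero j (D.ext x)) → y ∈ W := by
    intro y hy h1
    have h2 : P.IsZero j (D.ext y) := by
      refine hclos y (Metric.ball_subset_closedBall hy) ?_
      have h3 : 𝓝[≠] y ≤ 𝓝[Metric.closedBall 0 1] y := by
        rw [nhdsWithin_eq_nhds.2 (Metric.closedBall_mem_nhds_of_mem hy)]
        exact nhdsWithin_le_nhds
      exact (h1.frequently).filter_mono h3
    have h4 := eventually_nhdsWithin_iff.1 h1
    filter_upwards [h4] with x hx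
    by_cases hxy : x = y
    · rw [hxy]; exact h2
    · exact hx hxy
  have hsub : Metric.ball (0 : ℂ) 1 ⊆ W := by
    refine (convex_ball (0 : ℂ) 1).isPreconnected.subset_of_closure_inter_subset hWo
      ⟨z, hz, hup z hz h⟩ ?_
    rintro y ⟨hyc, hy⟩
    refine hup y hy ((D.isZero_dichotomy j hy).resolve_right fun hn => ?_)
    have h1 := eventually_nhdsWithin_iff.1 hn
    -- A point of `W` near `y` has a punctured neighborhood of zeros, arbitrarily close to `y`.
    obtain ⟨x', hx', hx'W⟩ := mem_closure_iff_nhds.1 hyc _ (eventually_eventually_nhds.2 h1)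
    obtain ⟨a, ⟨ha1, ha2⟩, ha3⟩ := ((((Filter.Eventually.and hx' hx'W).filter_mono
      (nhdsWithin_le_nhds (s := {x'}ᶜ))).and
      ((show ∀ᶠ a in 𝓝[≠] x', a ≠ y from by
        by_cases hxy : x' = y
        · rw [hxy]; exact self_mem_nhdsWithin
        · exact nhdsWithin_le_nhds (isOpen_ne.mem_nhds hxy))))).exists
    exact ha1 ha3 ha2
  have h1 : P.IsZero j (D.ext 1) := by
    refine hclos 1 (by simp) ?_
    have h2 : (1 : ℂ) ∈ closure (Metric.ball (0 : ℂ) 1) := by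
      rw [closure_ball _ one_ne_zero]; simp
    have h3 : ∃ᶠ x in 𝓝 (1 : ℂ), x ∈ Metric.ball (0 : ℂ) 1 := mem_closure_iff_frequently.1 h2
    rw [frequently_nhdsWithin_iff]
    exact h3.mono fun x hx => ⟨(hsub hx).self_of_nhds, Metric.ball_subset_closedBall hx⟩
  exact (hP.norm_torusCoord_fiber hu (D.ext_mem_fiber (by simp))).1 j h1

/-! ### The determinant of the Lagrangian frame -/

theorem DesingTriv.lagDet_eq {D : P.OrbiDisc u} (T : DesingTriv D) (l : P.LocalLift D.map D.pt)
    (z : ℂ) : T.lagDet l z = (T.A l z).det * (Complex.I ^ n * ∏ j, l.F z j) := by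
  rw [DesingTriv.lagDet, Matrix.det_mul, Matrix.det_diagonal, Finset.prod_mul_distrib]
  simp

/-- The complex determinant of the matrix of stacky vectors of a cone. -/
def coneDet (P : PolytopeData n m) (s : P.MaxCone) : ℂ := ((P.coneMat s).det : ℝ)

theorem IsLabeledPolytope.coneDet_ne_zero (hP : P.IsLabeledPolytope) (s : P.MaxCone) :
    P.coneDet s ≠ 0 := by
  simpa [coneDet] using hP.det_coneMat_ne_zero s

theorem det_map_coneMat (s : P.MaxCone) :
    ((P.coneMat s).map Complex.ofRealHom).det = P.coneDet s := by
  have := (RingHom.map_det Complex.ofRealHom (P.coneMat s)).symm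
  simpa [coneDet] using this

theorem det_jacobian {s s' : P.MaxCone} {τ : (Fin n → ℂ) → Fin n → ℂ} {x : Fin n → ℂ}
    (hτ : P.IsTransition s s' τ x) (hx : ∀ j, x j ≠ 0) :
    P.coneDet s' * (jacobian τ x).det * ∏ j, x j = P.coneDet s * ∏ j, τ x j := by
  have hx' : ∀ j, τ x j ≠ 0 := by
    rw [← P.isGeneric_chart s', hτ.self_of_nhds.2, P.isGeneric_chart]; exact hx
  have h := congrArg Matrix.det (P.jacobian_transition hτ hx)
  simp only [Matrix.det_mul, Matrix.det_diagonal, det_map_coneMat, Finset.prod_inv_distrib] at h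
  have h1 : ∏ j, x j ≠ 0 := Finset.prod_ne_zero_iff.2 fun j _ => hx j
  have h2 : ∏ j, τ x j ≠ 0 := Finset.prod_ne_zero_iff.2 fun j _ => hx' j
  field_simp at h
  linear_combination h

/-- Up to the determinants of the cones, the determinant of the Lagrangian frame does not depend
on the lift. -/
theorem DesingTriv.lagDet_div_eq (hP : P.IsLabeledPolytope) {D : P.OrbiDisc u} (T : DesingTriv D)
    (l l' : P.LocalLift D.map D.pt) {z : ℂ} (hz : z ∈ l.V ∩ l'.V ∩ Metric.closedBall 0 1) :
    T.lagDet l z / P.coneDet l.cone = T.lagDet l' z / P.coneDet l'.cone := by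
  have h1 := D.ext_lift l hz.1.1 hz.2
  have h2 := D.ext_lift l' hz.1.2 hz.2
  rw [T.lagDet_eq, T.lagDet_eq]
  by_cases hg : P.IsGeneric (D.ext z)
  · have hx : ∀ j, l.F z j ≠ 0 := by rwa [h1, isGeneric_chart] at hg
    have hchart : P.chart l'.cone (l'.F z) = P.chart l.cone (l.F z) := by rw [← h1, ← h2]
    obtain ⟨τ, hτ, hτx, hτl⟩ := hP.exists_transition l.cone l'.cone hx hchart
    have hmem : ∀ l : P.LocalLift D.map D.pt, z ∈ l.V →
        l.V ∩ Metric.closedBall 0 1 ∈ 𝓝[Metric.closedBall 0 1] z := fun l hl =>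
      Filter.inter_mem (nhdsWithin_le_nhds (l.isOpen.mem_nhds hl)) self_mem_nhdsWithin
    have hcont : ∀ l : P.LocalLift D.map D.pt, z ∈ l.V →
        Filter.Tendsto l.F (𝓝[Metric.closedBall 0 1] z) (𝓝 (l.F z)) := fun l hl =>
      (l.continuousOn z ⟨hl, hz.2⟩).mono_left (nhdsWithin_le_of_mem (hmem l hl))
    have hev := hτl _ l.F l'.F (hcont l hz.1.1) (hcont l' hz.1.2) (by
      filter_upwards [hmem l hz.1.1, hmem l' hz.1.2] with y hy hy'
      rw [← D.ext_lift l hy.1 hy.2, ← D.ext_lift l' hy'.1 hy.2])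
    have hA := congrArg Matrix.det (T.compat_A l l' z hz τ hτ hev)
    rw [Matrix.det_mul] at hA
    have hJ := det_jacobian hτ hx
    rw [hτx] at hJ
    rw [div_eq_div_iff (hP.coneDet_ne_zero _) (hP.coneDet_ne_zero _), ← hA]
    linear_combination (T.A l' z).det * Complex.I ^ n * hJ
  · have hzero : ∀ l : P.LocalLift D.map D.pt, D.ext z = P.chart l.cone (l.F z) →
        ∏ j, l.F z j = 0 := by
      intro l hl
      rw [hl, isGeneric_chart] at hg
      push Not at hg
      obtain ⟨j, hj⟩ := hg
      exact Finset.prod_eq_zero (Finset.mem_univ j) hj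
    rw [hzero l h1, hzero l' h2]
    simp

/-- At the orbifold point, the desingularization divides the coordinates by `ζ ^ wt`. -/
theorem DesingTriv.lagDet_div_eq_orbi (hP : P.IsLabeledPolytope) {D : P.OrbiDisc u}
    (T : DesingTriv D) (o : P.OrbiLift D.map D.pt D.order) (l : P.LocalLift D.map D.pt) {ζ : ℂ}
    (hζ : ζ ∈ Metric.ball (0 : ℂ) o.ε) (hζ0 : ζ ≠ 0) (hV : D.pt + ζ ^ D.order ∈ l.V) :
    T.lagDet l (D.pt + ζ ^ D.order) / P.coneDet l.cone =
      (T.B o (D.pt + ζ ^ D.order)).det * (Complex.I ^ n * ∏ j, (o.F ζ j / ζ ^ o.wt j)) /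
        P.coneDet o.cone := by
  set z := D.pt + ζ ^ D.order with hz
  have hzb : z ∈ Metric.ball (0 : ℂ) 1 := o.small ζ hζ
  have hzc := Metric.ball_subset_closedBall hzb
  have h1 := D.ext_lift l hV hzc
  have h2 := D.ext_orbiLift o hζ
  rw [T.lagDet_eq, Finset.prod_div_distrib]
  by_cases hg : P.IsGeneric (D.ext z)
  · have hx : ∀ j, o.F ζ j ≠ 0 := by rwa [h2, isGeneric_chart] at hg
    have hchart : P.chart l.cone (l.F z) = P.chart o.cone (o.F ζ) := by rw [← h1, ← h2]
    obtain ⟨τ, hτ, hτx, hτl⟩ := hP.exists_transition o.cone l.cone hx hchart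
    have hpow : Filter.Tendsto (fun η : ℂ => D.pt + η ^ D.order) (𝓝 ζ) (𝓝 z) := by
      have : Continuous fun η : ℂ => D.pt + η ^ D.order := by fun_prop
      exact this.tendsto ζ
    have hoε := Metric.isOpen_ball.mem_nhds hζ
    have hev := hτl (𝓝 ζ) o.F (fun η => l.F (D.pt + η ^ D.order))
      (o.holomorphic.continuousOn.continuousAt hoε)
      ((l.differentiableAt hV hzb).continuousAt.tendsto.comp hpow) (by
        filter_upwards [hoε, hpow.eventually (l.isOpen.mem_nhds hV)] with η hη hη'
        rw [← D.ext_orbiLift o hη, ← D.ext_lift l hη'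
          (Metric.ball_subset_closedBall (o.small η hη))])
    have hA := congrArg Matrix.det (T.compat_B o l ζ hζ hζ0 hV τ hτ hev)
    rw [Matrix.det_mul, Matrix.det_mul, Matrix.det_diagonal, Finset.prod_inv_distrib] at hA
    have hJ := det_jacobian hτ hx
    rw [hτx] at hJ
    rw [div_eq_div_iff (hP.coneDet_ne_zero _) (hP.coneDet_ne_zero _), div_eq_mul_inv]
    linear_combination Complex.I ^ n * (∏ j, o.F ζ j) * P.coneDet l.cone * hA -
      (T.A l z).det * Complex.I ^ n * hJ
  · have e1 : ∏ j, l.F z j = 0 := by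
      rw [h1, isGeneric_chart] at hg
      push Not at hg
      obtain ⟨j, hj⟩ := hg
      exact Finset.prod_eq_zero (Finset.mem_univ j) hj
    have e2 : ∏ j, o.F ζ j = 0 := by
      rw [h2, isGeneric_chart] at hg
      push Not at hg
      obtain ⟨j, hj⟩ := hg
      exact Finset.prod_eq_zero (Finset.mem_univ j) hj
    rw [e1, e2]
    simp

/-! ### Vanishing of the desingularized Maslov index -/

/-- At the orbifold point of an orbi-disc, each coordinate of an equivariant lift is a power of `ζ`
whose exponent has the weight as its residue, up to a factor without zero at the origin. -/
theorem OrbiDisc.exists_orbiLift_eq (hP : P.IsLabeledPolytope) (hu : u ∈ interior P.polytope)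
    (D : P.OrbiDisc u) (o : P.OrbiLift D.map D.pt D.order) :
    ∃ (q : Fin n → ℕ) (g : Fin n → ℂ → ℂ), (∀ j, ContinuousOn (g j) (Metric.ball 0 o.ε)) ∧
      (∀ j, g j 0 ≠ 0) ∧ ∀ j, ∀ ζ ∈ Metric.ball (0 : ℂ) o.ε,
        o.F ζ j = ζ ^ (o.wt j + D.order * q j) * g j ζ := by
  have hne : ∀ j, ¬ ∀ᶠ ζ in 𝓝 0, o.F ζ j = 0 := by
    intro j h
    have h1 := (tendsto_add_pow D.order_ne_zero).eventually
      (D.eventually_isGeneric hP hu D.pt_mem)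
    obtain ⟨ζ, ⟨hζ1, hζ2⟩, hζ3⟩ := ((h1.and (nhdsWithin_le_nhds h)).and
      (nhdsWithin_le_nhds (Metric.ball_mem_nhds (0 : ℂ) o.ε_pos))).exists
    rw [D.ext_orbiLift o hζ3, isGeneric_chart] at hζ1
    exact hζ1 j hζ2
  choose q g hg using fun j => exists_eq_pow_mul o.ε_pos (o.differentiableOn_coord j) (hne j)
    (o.wt_lt j) fun ζ hζ => o.equivariant_coord j hζ
  exact ⟨q, g, fun j => (hg j).1, fun j => (hg j).2.1, fun j => (hg j).2.2⟩

/-- The orbi-disc meets the toric divisors only at the orbifold point, and there with the smallest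
multiplicities that its weights allow. -/
structure OrbiDisc.IsMinimal (D : P.OrbiDisc u) : Prop where
  generic : ∀ z ∈ Metric.closedBall (0 : ℂ) 1, z ≠ D.pt → P.IsGeneric (D.ext z)
  orbi : ∀ o : P.OrbiLift D.map D.pt D.order, ∃ g : Fin n → ℂ → ℂ,
    (∀ j, ContinuousOn (g j) (Metric.ball 0 o.ε)) ∧ (∀ j, g j 0 ≠ 0) ∧
      ∀ j, ∀ ζ ∈ Metric.ball (0 : ℂ) o.ε, o.F ζ j = ζ ^ o.wt j * g j ζ

/-- In a trivialization of the desingularized bundle the determinant of the Lagrangian frame extends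
to a function on the disc. Its zeros, counted by the argument principle, are the
intersections with the toric divisors that exceed the weights. -/
theorem OrbiDisc.isMinimal_of_index_zero (hP : P.IsLabeledPolytope)
    (hu : u ∈ interior P.polytope) (D : P.OrbiDisc u) (hD : D.HasDesingMaslovIndex 0) :
    D.IsMinimal := by
  classical
  obtain ⟨T, θ, hθ, hTθ, hper⟩ := hD
  have hk := D.order_ne_zero
  -- Divided by the determinants of the cones, the Lagrangian determinants fit together off `z⁺`.
  obtain ⟨S₀, hS₀⟩ : ∃ S₀ : ℂ → ℂ, ∀ (l : P.LocalLift D.map D.pt),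
      ∀ z ∈ l.V ∩ Metric.closedBall 0 1, S₀ z = T.lagDet l z / P.coneDet l.cone := by
    have h1 : ∀ z : ℂ, ∃ c : ℂ, ∀ (l : P.LocalLift D.map D.pt),
        z ∈ l.V ∩ Metric.closedBall 0 1 → c = T.lagDet l z / P.coneDet l.cone := by
      intro z
      by_cases h : ∃ l : P.LocalLift D.map D.pt, z ∈ l.V ∩ Metric.closedBall 0 1
      · obtain ⟨l, hl⟩ := h
        exact ⟨_, fun l' hl' => T.lagDet_div_eq hP l l' ⟨⟨hl.1, hl'.1⟩, hl.2⟩⟩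
      · exact ⟨0, fun l hl => absurd ⟨l, hl⟩ h⟩
    choose S₀ hS₀ using h1
    exact ⟨S₀, fun l z hz => hS₀ z l hz⟩
  -- Order of vanishing at other interior points: the intersection number with the divisors.
  have hlocal : ∀ p ∈ Metric.ball (0 : ℂ) 1, p ≠ D.pt → ∃ N : ℕ, ∃ c : ℂ, c ≠ 0 ∧
      Filter.Tendsto (fun z => S₀ z / (z - p) ^ N) (𝓝[≠] p) (𝓝 c) := by
    intro p hp hpt
    obtain ⟨l, hl⟩ := D.exists_lift_at (Metric.ball_subset_closedBall hp) hpt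
    have hnhds : l.V ∩ Metric.ball 0 1 ∈ 𝓝 p :=
      (l.isOpen.inter Metric.isOpen_ball).mem_nhds ⟨hl, hp⟩
    have hne : ∀ j, ¬ ∀ᶠ z in 𝓝 p, l.F z j = 0 := by
      intro j h
      obtain ⟨z, ⟨hz1, hz2⟩, hz3⟩ := (((D.eventually_isGeneric hP hu hp).and
        (nhdsWithin_le_nhds h)).and (nhdsWithin_le_nhds hnhds)).exists
      rw [D.ext_lift l hz3.1 (Metric.ball_subset_closedBall hz3.2), isGeneric_chart] at hz1
      exact hz1 j hz2
    choose N g hga hg0 hFg using fun j =>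
      (l.analyticAt hl hp j).exists_eventuallyEq_pow_smul_nonzero_iff.2 (hne j)
    have hdetA : ContinuousAt (fun z => (T.A l z).det) p := by
      have h1 : ContinuousAt (T.A l) p := (T.continuousOn_A l).continuousAt
        (Filter.mem_of_superset hnhds fun z hz => ⟨hz.1, Metric.ball_subset_closedBall hz.2⟩)
      exact (Continuous.matrix_det continuous_id).continuousAt.comp h1
    refine ⟨∑ j, N j, (T.A l p).det * (Complex.I ^ n * ∏ j, g j p) / P.coneDet l.cone,
      div_ne_zero (mul_ne_zero (T.det_A l p ⟨hl, Metric.ball_subset_closedBall hp⟩)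
        (mul_ne_zero (pow_ne_zero _ Complex.I_ne_zero)
          (Finset.prod_ne_zero_iff.2 fun j _ => hg0 j))) (hP.coneDet_ne_zero _), ?_⟩
    have hlim : Filter.Tendsto (fun z => (T.A l z).det * (Complex.I ^ n * ∏ j, g j z) /
        P.coneDet l.cone) (𝓝[≠] p) (𝓝 ((T.A l p).det * (Complex.I ^ n * ∏ j, g j p) /
          P.coneDet l.cone)) := by
      refine Filter.Tendsto.mono_left ?_ nhdsWithin_le_nhds
      exact (hdetA.tendsto.mul ((tendsto_finsetProd _ fun j _ =>
        (hga j).continuousAt.tendsto).const_mul _)).div_const _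
    refine hlim.congr' ?_
    filter_upwards [nhdsWithin_le_nhds (Filter.eventually_all.2 hFg), nhdsWithin_le_nhds hnhds,
      self_mem_nhdsWithin] with z h1 h2 h3
    have h4 : (z - p) ^ (∑ j, N j) ≠ 0 := pow_ne_zero _ (sub_ne_zero.2 h3)
    rw [hS₀ l z ⟨h2.1, Metric.ball_subset_closedBall h2.2⟩, T.lagDet_eq]
    simp only [h1, smul_eq_mul, Finset.prod_mul_distrib, Finset.prod_pow_eq_pow_sum]
    rw [eq_div_iff h4]
    ring
  -- At the orbifold point the desingularization takes away the factors `ζ ^ wt_j`, so that only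
  -- `q_j`, the excess over the weights in units of the order, contributes.
  have horbi : ∀ (o : P.OrbiLift D.map D.pt D.order) (q : Fin n → ℕ) (g : Fin n → ℂ → ℂ),
      (∀ j, ContinuousOn (g j) (Metric.ball 0 o.ε)) → (∀ j, g j 0 ≠ 0) →
      (∀ j, ∀ ζ ∈ Metric.ball (0 : ℂ) o.ε, o.F ζ j = ζ ^ (o.wt j + D.order * q j) * g j ζ) →
      ∃ c : ℂ, c ≠ 0 ∧
        Filter.Tendsto (fun z => S₀ z / (z - D.pt) ^ (∑ j, q j)) (𝓝[≠] D.pt) (𝓝 c) := by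
    intro o q g hgc hg0 hFg
    have hball := Metric.ball_mem_nhds (0 : ℂ) o.ε_pos
    have hptB : D.pt ∈ Metric.ball D.pt (o.ε ^ D.order) :=
      Metric.mem_ball_self (pow_pos o.ε_pos _)
    have hdetB : ContinuousAt (fun z => (T.B o z).det) D.pt := by
      have h1 : ContinuousAt (T.B o) D.pt :=
        (T.continuousOn_B o).continuousAt (Metric.isOpen_ball.mem_nhds hptB)
      exact (Continuous.matrix_det continuous_id).continuousAt.comp h1
    refine ⟨(T.B o D.pt).det * (Complex.I ^ n * ∏ j, g j 0) / P.coneDet o.cone,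
      div_ne_zero (mul_ne_zero (T.det_B o _ hptB) (mul_ne_zero (pow_ne_zero _ Complex.I_ne_zero)
          (Finset.prod_ne_zero_iff.2 fun j _ => hg0 j))) (hP.coneDet_ne_zero _), ?_⟩
    refine tendsto_of_tendsto_pow hk ?_
    have hlim : Filter.Tendsto (fun ζ => (T.B o (D.pt + ζ ^ D.order)).det *
        (Complex.I ^ n * ∏ j, g j ζ) / P.coneDet o.cone) (𝓝[≠] 0)
        (𝓝 ((T.B o D.pt).det * (Complex.I ^ n * ∏ j, g j 0) / P.coneDet o.cone)) := by
      refine Filter.Tendsto.div_const (Filter.Tendsto.mul ?_ (Filter.Tendsto.const_mul _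
        (tendsto_finsetProd _ fun j _ => ?_))) _
      · exact hdetB.tendsto.comp ((tendsto_add_pow hk).mono_right nhdsWithin_le_nhds)
      · exact (((hgc j).continuousAt hball).tendsto).mono_left nhdsWithin_le_nhds
    refine hlim.congr' ?_
    filter_upwards [nhdsWithin_le_nhds hball, self_mem_nhdsWithin] with ζ hζ hζ0
    have hζ0' : ζ ≠ 0 := hζ0
    have hmem := Metric.ball_subset_closedBall (o.small ζ hζ)
    obtain ⟨l, hl⟩ := D.exists_lift_at hmem (by simpa [hk] using hζ0')
    have h1 : ∀ j, o.F ζ j / ζ ^ o.wt j = (ζ ^ D.order) ^ q j * g j ζ := by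
      intro j
      rw [hFg j ζ hζ, pow_add, pow_mul, div_eq_iff (pow_ne_zero _ hζ0')]
      ring
    rw [hS₀ l _ ⟨hl, hmem⟩, T.lagDet_div_eq_orbi hP o l hζ hζ0' hl]
    simp only [h1, Finset.prod_mul_distrib, Finset.prod_pow_eq_pow_sum, add_sub_cancel_left]
    rw [eq_div_iff (pow_ne_zero _ (pow_ne_zero _ hζ0'))]
    ring
  obtain ⟨o₀⟩ := D.exists_orbiLift
  obtain ⟨q₀, g₀, hg₀c, hg₀0, hFg₀⟩ := D.exists_orbiLift_eq hP hu o₀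
  obtain ⟨c₀, hc₀, hlim₀⟩ := horbi o₀ q₀ g₀ hg₀c hg₀0 hFg₀
  set N₀ := ∑ j, q₀ j with hN₀
  -- The value which extends the function continuously over the orbifold point.
  set s₀ : ℂ := if N₀ = 0 then c₀ else 0 with hs₀
  have hlimpt : Filter.Tendsto S₀ (𝓝[≠] D.pt) (𝓝 s₀) := by
    have h1 : Filter.Tendsto (fun z => (z - D.pt) ^ N₀) (𝓝[≠] D.pt) (𝓝 (0 ^ N₀)) := by
      have : Continuous fun z : ℂ => (z - D.pt) ^ N₀ := by fun_prop
      have h := (this.tendsto D.pt).mono_left (nhdsWithin_le_nhds (s := {D.pt}ᶜ))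
      rwa [sub_self] at h
    have h2 : c₀ * 0 ^ N₀ = s₀ := by
      rw [hs₀]
      split_ifs with h
      · rw [h, pow_zero, mul_one]
      · rw [zero_pow h, mul_zero]
    rw [← h2]
    refine (hlim₀.mul h1).congr' ?_
    filter_upwards [self_mem_nhdsWithin] with z hz
    rw [div_mul_cancel₀ _ (pow_ne_zero _ (sub_ne_zero.2 hz))]
  set S : ℂ → ℂ := Function.update S₀ D.pt s₀ with hS
  have hSne : ∀ z, z ≠ D.pt → S z = S₀ z := fun z hz => Function.update_of_ne hz _ _
  have hSpt : S D.pt = s₀ := Function.update_self _ _ _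
  have hSc : ContinuousOn S (Metric.closedBall 0 1) := by
    intro z hz
    by_cases hzp : z = D.pt
    · subst hzp
      refine ContinuousAt.continuousWithinAt ?_
      exact continuousAt_update_same.2 hlimpt
    · obtain ⟨l, hl⟩ := D.exists_lift_at hz hzp
      have hmem : l.V ∩ Metric.closedBall 0 1 ∈ 𝓝[Metric.closedBall 0 1] z :=
        Filter.inter_mem (nhdsWithin_le_nhds (l.isOpen.mem_nhds hl)) self_mem_nhdsWithin
      have hA : ContinuousWithinAt (fun z => T.lagDet l z / P.coneDet l.cone)
          (l.V ∩ Metric.closedBall 0 1) z := by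
        simp only [T.lagDet_eq]
        refine ContinuousWithinAt.div_const (ContinuousWithinAt.mul ?_
          (continuousWithinAt_const.mul (tendsto_finsetProd _ fun j _ => ?_))) _
        · exact (Continuous.matrix_det continuous_id).continuousAt.comp_continuousWithinAt
            (T.continuousOn_A l z ⟨hl, hz⟩)
        · exact (continuous_apply j).continuousAt.comp_continuousWithinAt
            (l.continuousOn z ⟨hl, hz⟩)
      have heq : ∀ y ∈ l.V ∩ Metric.closedBall 0 1, S y = T.lagDet l y / P.coneDet l.cone := by
        intro y hy
        rw [hSne y (fun h => l.avoids (h ▸ hy.1)), hS₀ l y hy]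
      exact (hA.congr heq (heq z ⟨hl, hz⟩)).mono_of_mem_nhdsWithin hmem
  have hzero : ∀ z ∈ Metric.closedBall (0 : ℂ) 1, z ≠ D.pt →
      (S z ≠ 0 ↔ P.IsGeneric (D.ext z)) := by
    intro z hz hzp
    obtain ⟨l, hl⟩ := D.exists_lift_at hz hzp
    rw [hSne z hzp, hS₀ l z ⟨hl, hz⟩, T.lagDet_eq, D.ext_lift l hl hz, isGeneric_chart]
    have h1 := T.det_A l z ⟨hl, hz⟩
    have h2 := hP.coneDet_ne_zero l.cone
    simp [h1, h2, Finset.prod_eq_zero_iff]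
  have hptn : ∀ z : ℂ, ‖z‖ = 1 → z ≠ D.pt := by
    rintro z hz rfl
    exact D.norm_pt_lt.ne hz
  have hmain : ∀ z ∈ Metric.closedBall (0 : ℂ) 1, S z ≠ 0 := by
    refine ne_zero_of_winding_eq_zero hSc (fun z hz => ?_) (fun p hp => ?_) hθ (fun t => ?_) ?_
    · exact (hzero z (mem_closedBall_zero_iff.2 hz.le) (hptn z hz)).2
        (hP.norm_torusCoord_fiber hu (D.ext_mem_fiber hz)).1
    · by_cases hpp : p = D.pt
      · subst hpp
        refine ⟨N₀, c₀, hc₀, hlim₀.congr' ?_⟩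
        filter_upwards [self_mem_nhdsWithin] with z hz
        rw [hSne z hz]
      · obtain ⟨N, c, hc, hlim⟩ := hlocal p hp hpp
        refine ⟨N, c, hc, hlim.congr' ?_⟩
        filter_upwards [nhdsWithin_le_nhds (isOpen_ne.mem_nhds hpp)] with z hz
        rw [hSne z hz]
    · have hE : ‖Complex.exp (t * Complex.I)‖ = 1 := Complex.norm_exp_ofReal_mul_I t
      have hEc : Complex.exp (t * Complex.I) ∈ Metric.closedBall (0 : ℂ) 1 :=
        mem_closedBall_zero_iff.2 hE.le
      obtain ⟨l, hl⟩ := D.exists_lift_at hEc (hptn _ hE)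
      rw [← hTθ t l hl, hSne _ (hptn _ hE), hS₀ l _ ⟨hl, hEc⟩, norm_div, Complex.ofReal_div,
        div_pow, div_pow]
      have h1 : ((‖P.coneDet l.cone‖ : ℝ) : ℂ) ^ 2 = P.coneDet l.cone ^ 2 := by
        rw [coneDet, Complex.norm_real, Real.norm_eq_abs, ← Complex.ofReal_pow, sq_abs]
        push_cast
        ring
      rw [h1, div_div_div_cancel_right₀ (pow_ne_zero _ (hP.coneDet_ne_zero _))]
    · simpa [sub_eq_zero] using hper
  refine ⟨fun z hz hzp => (hzero z hz hzp).1 (hmain z hz), fun o => ?_⟩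
  obtain ⟨q, g, hgc, hg0, hFg⟩ := D.exists_orbiLift_eq hP hu o
  obtain ⟨c, hc, hlim⟩ := horbi o q g hgc hg0 hFg
  have hsum : ∑ j, q j = 0 := by
    by_contra hne
    have h1 : Filter.Tendsto (fun z => (z - D.pt) ^ (∑ j, q j)) (𝓝[≠] D.pt) (𝓝 0) := by
      have : Continuous fun z : ℂ => (z - D.pt) ^ (∑ j, q j) := by fun_prop
      have h := (this.tendsto D.pt).mono_left (nhdsWithin_le_nhds (s := {D.pt}ᶜ))
      rwa [sub_self, zero_pow hne] at h
    have h2 : Filter.Tendsto S₀ (𝓝[≠] D.pt) (𝓝 0) := by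
      have := hlim.mul h1
      rw [mul_zero] at this
      refine this.congr' ?_
      filter_upwards [self_mem_nhdsWithin] with z hz
      rw [div_mul_cancel₀ _ (pow_ne_zero _ (sub_ne_zero.2 hz))]
    have h3 := hmain D.pt (Metric.ball_subset_closedBall D.pt_mem)
    rw [hSpt] at h3
    exact h3 (tendsto_nhds_unique hlimpt h2)
  -- The excesses are nonnegative with vanishing sum.
  have hq : ∀ j, q j = 0 := fun j => Finset.sum_eq_zero_iff.1 hsum j (Finset.mem_univ j)
  refine ⟨g, hgc, hg0, fun j ζ hζ => ?_⟩
  rw [hFg j ζ hζ, hq j, mul_zero, add_zero]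

/-! ### Minimal orbi-discs are monomial -/

/-- A family indexed by the facets of a cone, extended by zero to all facets. -/
def coneExtend {M : Type*} [Zero M] (P : PolytopeData n m) (s : P.MaxCone) (f : Fin n → M) :
    Fin m → M := Function.extend s.idx f 0

theorem coneExtend_idx {M : Type*} [Zero M] (s : P.MaxCone) (f : Fin n → M) (j : Fin n) :
    P.coneExtend s f (s.idx j) = f j := s.idx.injective.extend_apply _ _ _

theorem coneExtend_of_notMem {M : Type*} [Zero M] (s : P.MaxCone) (f : Fin n → M) {j : Fin m}
    (hj : j ∉ Set.range s.idx) : P.coneExtend s f j = 0 :=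
  Function.extend_apply' _ _ _ (by simpa using hj)

theorem isCone_coneExtend {M : Type*} [Zero M] (s : P.MaxCone) (f : Fin n → M) :
    P.IsCone {j | P.coneExtend s f j ≠ 0} :=
  s.isCone.mono fun _ hj => by_contra fun h => hj (coneExtend_of_notMem s f h)

theorem sum_coneExtend (s : P.MaxCone) (c : Fin n → ℝ) (i : Fin n) :
    ∑ j, P.coneExtend s c j * (P.stacky j i : ℝ) = ∑ j, c j * (P.stacky (s.idx j) i : ℝ) := by
  rw [P.sum_eq_sum_cone s]
  · simp only [coneExtend_idx]
  · intro j hj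
    rw [coneExtend_of_notMem s c hj, zero_mul]

theorem prod_pow_coneExtend (s : P.MaxCone) (d : Fin n → ℕ) (ζ : ℂ) (i : Fin n) :
    ∏ j, (ζ ^ P.coneExtend s d j) ^ P.stacky j i = P.coneMon s (fun j => ζ ^ d j) i := by
  rw [P.prod_eq_prod_cone s]
  · simp only [coneExtend_idx, coneMon]
  · intro j hj
    rw [coneExtend_of_notMem s d hj, pow_zero, one_zpow]

theorem IsLabeledPolytope.dualCoord_mem_Ico (hP : P.IsLabeledPolytope) {s : P.MaxCone}
    {ν : Fin n → ℤ} (hν : ν ∈ P.boxCone s) (j : Fin n) :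
    0 ≤ P.dualCoord s ν j ∧ P.dualCoord s ν j < 1 := by
  obtain ⟨c, hc, h⟩ := hν
  rw [hP.dualCoord_eq_of_sum s h]
  exact hc j

/-- The weights at the orbifold point are `k c_j` for the coordinates `c_j ∈ [0, 1)` of the twisted
sector. -/
theorem IsLabeledPolytope.wt_eq (hP : P.IsLabeledPolytope) {D : P.OrbiDisc u}
    (o : P.OrbiLift D.map D.pt D.order) {ν : Fin n → ℤ} (hν : ν ∈ P.boxCone o.cone)
    (h : o.φ 1 = (QuotientAddGroup.mk ν : (Fin n → ℤ) ⧸ P.coneLattice o.cone)) (j : Fin n) :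
    P.dualCoord o.cone ν j = o.wt j / D.order := by
  have hk : (D.order : ℝ) ≠ 0 := by exact_mod_cast D.order_ne_zero
  have h1 := o.wt_spec ν h.symm (fun _ => 1) j
  simp only [latAct, mul_one] at h1
  obtain ⟨a, ha⟩ := Complex.exp_eq_exp_iff_exists_int.1 h1
  have h2 : (P.dualCoord o.cone ν j : ℂ) = o.wt j / D.order + a := by
    have h3 : (2 * Real.pi * Complex.I : ℂ) ≠ 0 := Complex.two_pi_I_ne_zero
    refine mul_left_cancel₀ h3 ?_
    rw [ha]
    ring
  have h4 : P.dualCoord o.cone ν j = o.wt j / D.order + a := by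
    have h5 : ((P.dualCoord o.cone ν j : ℝ) : ℂ) = ((o.wt j / D.order + a : ℝ) : ℂ) := by
      rw [h2]; push_cast; ring
    exact_mod_cast h5
  obtain ⟨h6, h7⟩ := hP.dualCoord_mem_Ico hν j
  have h8 : (0 : ℝ) ≤ o.wt j / D.order := by positivity
  have h9 : (o.wt j / D.order : ℝ) < 1 := by
    rw [div_lt_one (by positivity)]
    exact_mod_cast o.wt_lt j
  have h10 : (a : ℝ) < 1 := by linarith
  have h11 : (-1 : ℝ) < a := by linarith
  have h12 : a = 0 := by
    have e1 : a < 1 := by exact_mod_cast h10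
    have e2 : -1 < a := by exact_mod_cast h11
    omega
  rw [h4, h12]
  simp

theorem sum_wt_mul {s : P.MaxCone} (hP : P.IsLabeledPolytope) {ν : Fin n → ℤ} {k : ℕ}
    (hk : k ≠ 0) {d : Fin n → ℕ} (h : ∀ j, P.dualCoord s ν j = d j / k) (i : Fin n) :
    ∑ j, (d j : ℤ) * P.stacky (s.idx j) i = k * ν i := by
  have hk' : (k : ℝ) ≠ 0 := by exact_mod_cast hk
  have h1 := hP.sum_dualCoord s ν i
  simp only [h] at h1
  have h2 : ∑ j, (d j : ℝ) * (P.stacky (s.idx j) i : ℝ) = k * ν i := by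
    rw [← h1, Finset.mul_sum]
    refine Finset.sum_congr rfl fun j _ => ?_
    field_simp
  exact_mod_cast h2

/-- A family of weights on a cone adapted to a sector turns powers of `ζ` into powers of `ζ ^ k`. -/
theorem coneMon_pow_wt {s : P.MaxCone} (hP : P.IsLabeledPolytope) {ν : Fin n → ℤ} {k : ℕ}
    (hk : k ≠ 0) {d : Fin n → ℕ} (h : ∀ j, P.dualCoord s ν j = d j / k) {ζ : ℂ} (hζ : ζ ≠ 0)
    (i : Fin n) : P.coneMon s (fun j => ζ ^ d j) i = (ζ ^ k) ^ ν i := by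
  rw [P.coneMon_pow s hζ, sum_wt_mul hP hk h, zpow_mul, zpow_natCast]

/-- The characters of the orbi-disc are the functions `C_i φ ^ ν_i`. -/
def OrbiDisc.HasCharacters (D : P.OrbiDisc u) (ν : Fin n → ℤ) (C : Fin n → ℂ) : Prop :=
  ∀ z ∈ Metric.closedBall (0 : ℂ) 1, z ≠ D.pt →
    ∀ i, P.torusCoord (D.ext z) i = C i * mob D.pt z ^ ν i

theorem OrbiDisc.IsMinimal.exists_factor (hP : P.IsLabeledPolytope) {D : P.OrbiDisc u}
    (hD : D.IsMinimal) (o : P.OrbiLift D.map D.pt D.order) {ν : Fin n → ℤ}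
    (hν : ν ∈ P.boxCone o.cone)
    (h : o.φ 1 = (QuotientAddGroup.mk ν : (Fin n → ℤ) ⧸ P.coneLattice o.cone)) :
    ∃ g : ℂ → Fin n → ℂ, ContinuousAt g 0 ∧ (∀ j, g 0 j ≠ 0) ∧
      (∀ ζ ∈ Metric.ball (0 : ℂ) o.ε, ∀ j, o.F ζ j = ζ ^ o.wt j * g ζ j) ∧
      ∀ᶠ ζ in 𝓝[≠] 0, ∀ i, P.torusCoord (D.ext (D.pt + ζ ^ D.order)) i =
        (ζ ^ D.order) ^ ν i * P.coneMon o.cone (g ζ) i := by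
  have hball := Metric.ball_mem_nhds (0 : ℂ) o.ε_pos
  obtain ⟨g, hgc, hg0, hFg⟩ := hD.orbi o
  refine ⟨fun ζ j => g j ζ, continuousAt_pi.2 fun j => (hgc j).continuousAt hball, hg0,
    fun ζ hζ j => hFg j ζ hζ, ?_⟩
  filter_upwards [nhdsWithin_le_nhds hball, self_mem_nhdsWithin] with ζ hζ hζ0 i
  rw [D.ext_orbiLift o hζ, torusCoord_chart,
    ← coneMon_pow_wt hP D.order_ne_zero (hP.wt_eq o hν h) hζ0, ← coneMon_mul]
  congr 1
  ext j
  exact hFg j ζ hζ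

/-- The characters of a minimal orbi-disc, divided by the powers of the Blaschke factor
that the twisted sector prescribes, have no zeros and constant modulus on the circle, so that they
are constant. -/
theorem OrbiDisc.IsMinimal.exists_characters (hP : P.IsLabeledPolytope)
    (hu : u ∈ interior P.polytope) {D : P.OrbiDisc u} (hD : D.IsMinimal) {ν : Fin n → ℤ}
    (hν : D.HasSector ν) :
    ∃ C : Fin n → ℂ, (∀ i, C i ≠ 0) ∧ (∀ i, ‖C i‖ = ∏ j, √(2 * P.ell j u) ^ P.stacky j i) ∧
      D.HasCharacters ν C := by
  obtain ⟨o, hνo, hφ⟩ := hν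
  obtain ⟨g, hgc, hg0, -, hg⟩ := hD.exists_factor hP o hνo hφ
  have hp := D.norm_pt_lt
  have key : ∀ i, ∃ C : ℂ, C ≠ 0 ∧ ‖C‖ = ∏ j, √(2 * P.ell j u) ^ P.stacky j i ∧
      ∀ z ∈ Metric.closedBall (0 : ℂ) 1, z ≠ D.pt →
        P.torusCoord (D.ext z) i = C * mob D.pt z ^ ν i := by
    intro i
    set f : ℂ → ℂ := fun z => P.torusCoord (D.ext z) i with hf
    have hf0 : ∀ z ∈ Metric.closedBall (0 : ℂ) 1, z ≠ D.pt → f z ≠ 0 := fun z hz hzp =>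
      P.torusCoord_ne_zero (hD.generic z hz hzp) i
    have hm0 : ∀ z ∈ Metric.closedBall (0 : ℂ) 1, z ≠ D.pt → mob D.pt z ≠ 0 := fun z hz hzp =>
      (mob_eq_zero hp (mem_closedBall_zero_iff.1 hz)).not.2 hzp
    have hfl : ∀ (l : P.LocalLift D.map D.pt), ∀ z ∈ l.V ∩ Metric.closedBall 0 1,
        f z = P.coneMon l.cone (l.F z) i ∧ ∀ j, l.F z j ≠ 0 := by
      intro l z hz
      have h1 := D.ext_lift l hz.1 hz.2
      have h2 := hD.generic z hz.2 fun h => l.avoids (h ▸ hz.1)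
      rw [h1, isGeneric_chart] at h2
      refine ⟨?_, h2⟩
      rw [hf]
      simp only [h1, torusCoord_chart]
    have hfc : ∀ z ∈ Metric.closedBall (0 : ℂ) 1, z ≠ D.pt →
        ContinuousWithinAt f (Metric.closedBall 0 1) z := by
      intro z hz hzp
      obtain ⟨l, hl⟩ := D.exists_lift_at hz hzp
      have hmem : l.V ∩ Metric.closedBall 0 1 ∈ 𝓝[Metric.closedBall 0 1] z :=
        Filter.inter_mem (nhdsWithin_le_nhds (l.isOpen.mem_nhds hl)) self_mem_nhdsWithin
      have h1 : ContinuousWithinAt (fun y => P.coneMon l.cone (l.F y) i)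
          (l.V ∩ Metric.closedBall 0 1) z :=
        (P.coneMon_continuousAt l.cone (hfl l z ⟨hl, hz⟩).2 i).comp_continuousWithinAt
          (l.continuousOn z ⟨hl, hz⟩)
      exact (h1.congr (fun y hy => (hfl l y hy).1)
        (hfl l z ⟨hl, hz⟩).1).mono_of_mem_nhdsWithin hmem
    have hfd : ∀ z ∈ Metric.ball (0 : ℂ) 1, z ≠ D.pt → DifferentiableAt ℂ f z := by
      intro z hz hzp
      have hzc := Metric.ball_subset_closedBall hz
      obtain ⟨l, hl⟩ := D.exists_lift_at hzc hzp
      have h1 : DifferentiableAt ℂ (fun y => P.coneMon l.cone (l.F y) i) z := by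
        unfold coneMon
        refine DifferentiableAt.fun_finsetProd fun j _ => ?_
        exact (differentiableAt_pi.1 (l.differentiableAt hl hz) j).zpow
          (Or.inl ((hfl l z ⟨hl, hzc⟩).2 j))
      refine h1.congr_of_eventuallyEq ?_
      filter_upwards [(l.isOpen.inter Metric.isOpen_ball).mem_nhds ⟨hl, hz⟩] with y hy
      exact (hfl l y ⟨hy.1, Metric.ball_subset_closedBall hy.2⟩).1
    -- The quotient by the power of the Blaschke factor extends over the orbifold point.
    set h₀ : ℂ → ℂ := fun z => f z / mob D.pt z ^ ν i with hh₀
    set L : ℂ := (1 - (starRingEnd ℂ) D.pt * D.pt) ^ ν i * P.coneMon o.cone (g 0) i with hL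
    have hL0 : L ≠ 0 := mul_ne_zero (zpow_ne_zero _ (mob_denom_ne_zero hp hp.le))
      (P.coneMon_ne_zero _ hg0 i)
    have hlim : Filter.Tendsto h₀ (𝓝[≠] D.pt) (𝓝 L) := by
      refine tendsto_of_tendsto_pow D.order_ne_zero ?_
      have h1 : Filter.Tendsto (fun ζ : ℂ => (1 - (starRingEnd ℂ) D.pt * (D.pt + ζ ^ D.order)) ^ ν i
          * P.coneMon o.cone (g ζ) i) (𝓝[≠] 0) (𝓝 L) := by
        refine Filter.Tendsto.mul ?_ ?_
        · have h2 : Filter.Tendsto (fun ζ : ℂ => 1 - (starRingEnd ℂ) D.pt * (D.pt + ζ ^ D.order))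
              (𝓝[≠] 0) (𝓝 (1 - (starRingEnd ℂ) D.pt * D.pt)) :=
            (((tendsto_add_pow D.order_ne_zero).mono_right nhdsWithin_le_nhds).const_mul
              _).const_sub _
          exact h2.zpow₀ _ (Or.inl (mob_denom_ne_zero hp hp.le))
        · have h2 : ContinuousAt (fun ζ => P.coneMon o.cone (g ζ) i) 0 :=
            ContinuousAt.comp (f := g) (P.coneMon_continuousAt o.cone hg0 i) hgc
          exact h2.tendsto.mono_left nhdsWithin_le_nhds
      refine h1.congr' ?_
      filter_upwards [hg, self_mem_nhdsWithin] with ζ hζ hζ0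
      have hζk : ζ ^ D.order ≠ 0 := pow_ne_zero _ hζ0
      rw [hh₀]
      simp only [hf, hζ, mob, add_sub_cancel_left, div_zpow]
      rw [div_div_eq_mul_div, eq_div_iff (zpow_ne_zero _ hζk)]
      ring
    set H : ℂ → ℂ := Function.update h₀ D.pt L with hH
    have hHne : ∀ z, z ≠ D.pt → H z = h₀ z := fun z hz => Function.update_of_ne hz _ _
    have hHpt : H D.pt = L := Function.update_self _ _ _
    have hHpc : ContinuousAt H D.pt := continuousAt_update_same.2 hlim
    have hHc : ContinuousOn H (Metric.closedBall 0 1) := by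
      intro z hz
      by_cases hzp : z = D.pt
      · rw [hzp]; exact hHpc.continuousWithinAt
      · have h1 : ContinuousWithinAt h₀ (Metric.closedBall 0 1) z :=
          (hfc z hz hzp).div ((continuousOn_mob hp z hz).zpow₀ _ (Or.inl (hm0 z hz hzp)))
            (zpow_ne_zero _ (hm0 z hz hzp))
        refine h1.congr_of_eventuallyEq ?_ (hHne z hzp)
        filter_upwards [nhdsWithin_le_nhds (isOpen_ne.mem_nhds hzp)] with y hy
        exact hHne y hy
    have hHd : DifferentiableOn ℂ H (Metric.ball 0 1) := by
      refine (Complex.differentiableOn_compl_singleton_and_continuousAt_iff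
        (Metric.isOpen_ball.mem_nhds D.pt_mem)).1 ⟨?_, hHpc⟩
      rintro z ⟨hz, hzp⟩
      have hzc := Metric.ball_subset_closedBall hz
      have h1 : DifferentiableAt ℂ h₀ z :=
        (hfd z hz hzp).div (((differentiableOn_mob hp).differentiableAt
          (Metric.isOpen_ball.mem_nhds hz)).zpow (Or.inl (hm0 z hzc hzp)))
          (zpow_ne_zero _ (hm0 z hzc hzp))
      refine (h1.congr_of_eventuallyEq ?_).differentiableWithinAt
      filter_upwards [isOpen_ne.mem_nhds hzp] with y hy
      exact hHne y hy
    have hH0 : ∀ z ∈ Metric.closedBall (0 : ℂ) 1, H z ≠ 0 := by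
      intro z hz
      by_cases hzp : z = D.pt
      · rw [hzp, hHpt]; exact hL0
      · rw [hHne z hzp]
        exact div_ne_zero (hf0 z hz hzp) (zpow_ne_zero _ (hm0 z hz hzp))
    have hHn : ∀ z : ℂ, ‖z‖ = 1 → ‖H z‖ = ∏ j, √(2 * P.ell j u) ^ P.stacky j i := by
      intro z hz
      have hzp : z ≠ D.pt := by rintro rfl; exact hp.ne hz
      rw [hHne z hzp, hh₀]
      simp only [norm_div, norm_zpow, norm_mob_sphere hp hz, one_zpow, div_one]
      exact (hP.norm_torusCoord_fiber hu (D.ext_mem_fiber hz)).2 i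
    have hconst := eq_const_of_norm_sphere hHc hHd hH0 hHn
    refine ⟨H 0, hH0 0 (by simp), ?_, fun z hz hzp => ?_⟩
    · rw [← hHn 1 (by simp), hconst 1 (by simp)]
    · rw [← hconst z hz, hHne z hzp, hh₀]
      simp only
      rw [div_mul_cancel₀ _ (zpow_ne_zero _ (hm0 z hz hzp))]
  choose C hC using key
  exact ⟨C, fun i => (hC i).1, fun i => (hC i).2.1, fun z hz hzp i => (hC i).2.2 z hz hzp⟩

/-! ### The monomial form -/

theorem prod_chartCoord (s : P.MaxCone) (x : Fin n → ℂ) (i : Fin n) :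
    ∏ j, P.chartCoord s x j ^ P.stacky j i = P.coneMon s x i :=
  congrFun (P.torusCoord_chart s x) i

theorem chartCoord_ne_zero (s : P.MaxCone) {x : Fin n → ℂ} (hx : ∀ j, x j ≠ 0) (j : Fin m) :
    P.chartCoord s x j ≠ 0 :=
  (P.isGeneric_chart s x).2 hx j

theorem prod_pow_wt {s : P.MaxCone} (hP : P.IsLabeledPolytope) {ν : Fin n → ℤ} {k : ℕ}
    (hk : k ≠ 0) {d : Fin n → ℕ} (h : ∀ j, P.dualCoord s ν j = d j / k) {ζ : ℂ} (hζ : ζ ≠ 0)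
    (i : Fin n) : ∏ j, (ζ ^ P.coneExtend s d j) ^ P.stacky j i = (ζ ^ k) ^ ν i := by
  rw [prod_pow_coneExtend, coneMon_pow_wt hP hk h hζ]

/-- Prescribed characters of the right modulus are those of a point over the torus fiber. -/
theorem IsLabeledPolytope.exists_fiber_coord (hP : P.IsLabeledPolytope)
    (hu : u ∈ interior P.polytope) (s : P.MaxCone) {C : Fin n → ℂ}
    (hC : ∀ i, ‖C i‖ = ∏ j, √(2 * P.ell j u) ^ P.stacky j i) :
    ∃ a : Fin m → ℂ, (∀ j, a j ≠ 0) ∧ (∀ j, ‖a j‖ ^ 2 / 2 = P.ell j u) ∧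
      ∀ i, ∏ j, a j ^ P.stacky j i = C i := by
  have hr : ∀ j, 0 < √(2 * P.ell j u) := fun j =>
    Real.sqrt_pos.2 (mul_pos two_pos (hP.ell_pos hu j))
  set R : Fin n → ℂ := fun i => ∏ j, (√(2 * P.ell j u) : ℂ) ^ P.stacky j i with hR
  have hR0 : ∀ i, R i ≠ 0 := fun i => Finset.prod_ne_zero_iff.2 fun j _ =>
    zpow_ne_zero _ (by exact_mod_cast (hr j).ne')
  have hRn : ∀ i, ‖R i‖ = ‖C i‖ := by
    intro i
    rw [hC, hR]
    simp only [norm_prod, norm_zpow, Complex.norm_real, Real.norm_of_nonneg (hr _).le]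
  have hy : ∀ i, ‖C i / R i‖ = 1 := fun i => by
    rw [norm_div, hRn, div_self]
    rw [← hRn]
    exact norm_ne_zero_iff.2 (hR0 i)
  obtain ⟨x, hx0, hx, hxn⟩ := hP.exists_coneMon_eq s (y := fun i => C i / R i) fun i => by
    rw [← norm_ne_zero_iff, hy]
    exact one_ne_zero
  have hxn' := hxn hy
  have hcn : ∀ j, ‖P.chartCoord s x j‖ = 1 := by
    intro j
    by_cases hj : j ∈ Set.range s.idx
    · obtain ⟨j, rfl⟩ := hj
      rw [chartCoord_idx, hxn']
    · rw [P.chartCoord_of_notMem s x hj, norm_one]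
  refine ⟨fun j => √(2 * P.ell j u) * P.chartCoord s x j, fun j => mul_ne_zero
    (by exact_mod_cast (hr j).ne') (chartCoord_ne_zero s hx0 j), fun j => ?_, fun i => ?_⟩
  · rw [norm_mul, hcn, mul_one, Complex.norm_real, Real.norm_of_nonneg (hr j).le,
      Real.sq_sqrt (mul_pos two_pos (hP.ell_pos hu j)).le]
    ring
  · simp only [mul_zpow, Finset.prod_mul_distrib]
    rw [prod_chartCoord, hx]
    exact mul_div_cancel₀ _ (hR0 i)

/-- A minimal orbi-disc is monomial. Off the orbifold point this follows from the characters; at the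
orbifold point the two points are compared by the element of `K_ℂ` that the limits of the
coordinates give. -/
theorem OrbiDisc.IsMinimal.hasMonomialForm (hP : P.IsLabeledPolytope)
    (hu : u ∈ interior P.polytope) {D : P.OrbiDisc u} (hD : D.IsMinimal) {ν : Fin n → ℤ}
    (hν : D.HasSector ν) : D.HasMonomialForm ν := by
  obtain ⟨C, -, hCn, hCh⟩ := hD.exists_characters hP hu hν
  obtain ⟨o, hνo, hφ⟩ := hν
  have hk := D.order_ne_zero
  have hp := D.norm_pt_lt
  obtain ⟨a, ha0, han, haC⟩ := hP.exists_fiber_coord hu o.cone hCn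
  have hwt := hP.wt_eq o hνo hφ
  have hcd : ∀ j, P.coneExtend o.cone (P.dualCoord o.cone ν) j
      = P.coneExtend o.cone o.wt j / D.order := by
    intro j
    by_cases hj : j ∈ Set.range o.cone.idx
    · obtain ⟨j, rfl⟩ := hj
      rw [coneExtend_idx, coneExtend_idx, hwt]
    · rw [coneExtend_of_notMem _ _ hj, coneExtend_of_notMem _ _ hj]
      simp
  refine ⟨a, P.coneExtend o.cone (P.dualCoord o.cone ν), P.coneExtend o.cone o.wt, han, fun j => ?_,
    isCone_coneExtend _ _, fun i => ?_, hcd, fun z ζ hζ => ?_⟩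
  · by_cases hj : j ∈ Set.range o.cone.idx
    · obtain ⟨j, rfl⟩ := hj
      rw [coneExtend_idx]
      exact hP.dualCoord_mem_Ico hνo j
    · rw [coneExtend_of_notMem _ _ hj]
      simp
  · rw [sum_coneExtend, hP.sum_dualCoord]
  · change ζ ^ D.order = mob D.pt z at hζ
    have hzc := z.2
    have hU : (fun j => a j * ζ ^ P.coneExtend o.cone o.wt j) ∈ P.U := by
      refine (isCone_coneExtend o.cone o.wt).mono fun j hj h0 => ?_
      change a j * ζ ^ P.coneExtend o.cone o.wt j = 0 at hj
      rw [h0, pow_zero, mul_one] at hj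
      exact ha0 j hj
    refine ⟨hU, ?_⟩
    rw [← D.ext_coe]
    by_cases hzp : (z : ℂ) = D.pt
    · have hζ0 : ζ = 0 := by
        rw [hzp, mob_self] at hζ
        exact (pow_eq_zero_iff hk).1 hζ
      obtain ⟨g, hgc, hg0, hgF, hg⟩ := hD.exists_factor hP o hνo hφ
      set q : ℂ := 1 - (starRingEnd ℂ) D.pt * D.pt with hq
      have hq0 : q ≠ 0 := mob_denom_ne_zero hp hp.le
      -- The constants of the characters are read off as limits at the orbifold point, where the
      -- denominator of the Blaschke factor tends to `q`.
      have hlimC : ∀ i, q ^ ν i * P.coneMon o.cone (g 0) i = C i := by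
        intro i
        have h1 : Filter.Tendsto (fun ζ : ℂ => (1 - (starRingEnd ℂ) D.pt *
            (D.pt + ζ ^ D.order)) ^ ν i * P.coneMon o.cone (g ζ) i) (𝓝[≠] 0)
            (𝓝 (q ^ ν i * P.coneMon o.cone (g 0) i)) := by
          refine Filter.Tendsto.mul ?_ ?_
          · have h2 : Filter.Tendsto (fun ζ : ℂ => 1 - (starRingEnd ℂ) D.pt *
                (D.pt + ζ ^ D.order)) (𝓝[≠] 0) (𝓝 q) :=
              (((tendsto_add_pow hk).mono_right nhdsWithin_le_nhds).const_mul _).const_sub _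
            exact h2.zpow₀ _ (Or.inl hq0)
          · have h2 : ContinuousAt (fun ζ => P.coneMon o.cone (g ζ) i) 0 :=
              ContinuousAt.comp (f := g) (P.coneMon_continuousAt o.cone hg0 i) hgc
            exact h2.tendsto.mono_left nhdsWithin_le_nhds
        refine tendsto_nhds_unique h1 (tendsto_const_nhds.congr' ?_)
        filter_upwards [hg, self_mem_nhdsWithin,
          nhdsWithin_le_nhds (Metric.ball_mem_nhds (0 : ℂ) o.ε_pos)] with η hη hη0 hηε
        have hηk : η ^ D.order ≠ 0 := pow_ne_zero _ hη0
        have hmem := Metric.ball_subset_closedBall (o.small η hηε)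
        have h2 := hCh _ hmem (by simpa using hηk) i
        have h3 : 1 - (starRingEnd ℂ) D.pt * (D.pt + η ^ D.order) ≠ 0 :=
          mob_denom_ne_zero hp (mem_closedBall_zero_iff.1 hmem)
        rw [hη i, mob, add_sub_cancel_left, div_zpow] at h2
        have h4 := zpow_ne_zero (ν i) hηk
        have h5 := zpow_ne_zero (ν i) h3
        field_simp at h2
        linear_combination -h2
      -- The factor `q` of the Blaschke denominator is absorbed by powers of a `k`-th root.
      set r := root D.order q with hr
      have hrk : r ^ D.order = q := root_pow hk q
      have hr0 : r ≠ 0 := by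
        intro h
        rw [h, zero_pow hk] at hrk
        exact hq0 hrk.symm
      have hF0 : D.ext z = P.chart o.cone (o.F 0) := by
        rw [← D.ext_orbiLift o (Metric.mem_ball_self o.ε_pos), zero_pow hk, add_zero, hzp]
      rw [hF0, chart]
      refine P.point_eq_point (fun j => a j / P.chartCoord o.cone (g 0) j *
        (r ^ P.coneExtend o.cone o.wt j)⁻¹) (fun j => mul_ne_zero (div_ne_zero (ha0 j)
        (chartCoord_ne_zero _ hg0 j)) (inv_ne_zero (pow_ne_zero _ hr0))) (fun i => ?_) fun j => ?_
      · simp only [mul_zpow, div_zpow, inv_zpow, Finset.prod_mul_distrib, Finset.prod_div_distrib,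
          Finset.prod_inv_distrib]
        rw [haC, prod_chartCoord, prod_pow_wt hP hk hwt hr0, hrk, ← hlimC]
        have h4 := zpow_ne_zero (ν i) hq0
        have h5 := P.coneMon_ne_zero o.cone hg0 i
        field_simp
      · rw [hζ0]
        by_cases hj : j ∈ Set.range o.cone.idx
        · obtain ⟨j, rfl⟩ := hj
          simp only [chartCoord_idx, coneExtend_idx]
          rw [hgF 0 (Metric.mem_ball_self o.ε_pos)]
          by_cases hw : o.wt j = 0
          · simp only [hw, pow_zero]
            field_simp [hg0 j]
          · simp [zero_pow hw]
        · rw [P.chartCoord_of_notMem _ _ hj, P.chartCoord_of_notMem _ _ hj,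
            coneExtend_of_notMem _ _ hj]
          simp
    · have hζ0 : ζ ≠ 0 := by
        rintro rfl
        rw [zero_pow hk] at hζ
        exact hzp ((mob_eq_zero hp (mem_closedBall_zero_iff.1 hzc)).1 hζ.symm)
      refine P.torusCoord_injOn (hD.generic z hzc hzp)
        (fun j => mul_ne_zero (ha0 j) (pow_ne_zero _ hζ0)) ?_
      ext i
      rw [hCh z hzc hzp, torusCoord_point]
      simp only [mul_zpow, Finset.prod_mul_distrib]
      rw [haC, prod_pow_wt hP hk hwt hζ0, hζ]

/-! ### The sector is an invariant -/

theorem IsLabeledPolytope.exists_sector (hP : P.IsLabeledPolytope) (D : P.OrbiDisc u) :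
    ∃ ν, D.HasSector ν := by
  obtain ⟨o⟩ := D.exists_orbiLift
  obtain ⟨ν', hν'⟩ := QuotientAddGroup.mk_surjective (o.φ 1)
  set c := P.dualCoord o.cone ν' with hc
  -- The fractional parts of the coordinates represent the class in the box.
  set ν : Fin n → ℤ := ν' - ∑ j, ⌊c j⌋ • P.stacky (o.cone.idx j) with hν
  have hsum : ∀ i, (ν i : ℝ) = ∑ j, Int.fract (c j) * (P.stacky (o.cone.idx j) i : ℝ) := by
    intro i
    rw [hν]
    simp only [Pi.sub_apply, Finset.sum_apply, Pi.smul_apply, smul_eq_mul]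
    push_cast
    rw [← hP.sum_dualCoord o.cone ν' i, ← Finset.sum_sub_distrib]
    refine Finset.sum_congr rfl fun j _ => ?_
    rw [← hc, ← sub_mul, Int.self_sub_floor]
  refine ⟨ν, o, ⟨fun j => Int.fract (c j), fun j => ⟨Int.fract_nonneg _, Int.fract_lt_one _⟩, hsum⟩,
    ?_⟩
  rw [← hν', hP.mk_eq_mk_iff]
  intro j
  refine ⟨-⌊c j⌋, ?_⟩
  rw [hP.dualCoord_eq_of_sum o.cone hsum, ← hc]
  push_cast
  exact (Int.self_sub_floor (c j)).symm.trans (sub_eq_add_neg _ _)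

theorem OrbiDisc.HasSector.mem_box' {D : P.OrbiDisc u} {ν : Fin n → ℤ} (h : D.HasSector ν) :
    ν ∈ P.box' := by
  obtain ⟨o, hν, hφ⟩ := h
  refine ⟨Set.mem_iUnion.2 ⟨o.cone, hν⟩, ?_⟩
  rintro rfl
  have h1 : (1 : ZMod D.order) = 0 := o.injective (by rw [hφ, map_zero]; rfl)
  have h2 := D.two_le_order
  have : Fact (1 < D.order) := ⟨h2⟩
  exact one_ne_zero h1

theorem eq_of_zpow_eq {c c' : ℝ} (hc' : 0 < c') {a b : ℤ}
    (h : ∀ r : ℝ, 0 < r → r < 1 → c * r ^ a = c' * r ^ b) : a = b := by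
  have h1 := h (1 / 2) (by norm_num) (by norm_num)
  have h2 := h ((1 / 2) ^ 2) (by norm_num) (by norm_num)
  have e : ∀ a : ℤ, ((1 / 2 : ℝ) ^ 2) ^ a = ((1 / 2 : ℝ) ^ a) ^ 2 := by
    intro a
    rw [← zpow_natCast, ← zpow_natCast, ← zpow_mul, ← zpow_mul, mul_comm]
  rw [e, e] at h2
  set x := (1 / 2 : ℝ) ^ a with hx
  set y := (1 / 2 : ℝ) ^ b with hy
  have hy0 : 0 < y := by positivity
  have h3 : c' * y * x = c' * y * y := by
    rw [← h1]
    linear_combination h2 - y * h1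
  have h4 : x = y := mul_left_cancel₀ (by positivity) h3
  exact zpow_right_injective₀ (by norm_num) (by norm_num) h4

/-- Equivalent minimal orbi-discs have the same sector: it is the order of vanishing of the
characters at the orbifold point. -/
theorem OrbiDisc.IsMinimal.sector_eq (hP : P.IsLabeledPolytope) (hu : u ∈ interior P.polytope)
    {D D' : P.OrbiDisc u} (hD : D.IsMinimal) (hD' : D'.IsMinimal) (hDD : D.Equivalent D')
    {ν ν' : Fin n → ℤ} (hν : D.HasSector ν) (hν' : D'.HasSector ν') : ν = ν' := by
  obtain ⟨C, -, -, hC⟩ := hD.exists_characters hP hu hν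
  obtain ⟨C', hC0', -, hC'⟩ := hD'.exists_characters hP hu hν'
  obtain ⟨-, e, he, hpt, t, ht⟩ := hDD
  have hp := D.norm_pt_lt
  ext i
  refine eq_of_zpow_eq (c := ‖C i‖) (norm_pos_iff.2 (hC0' i)) fun r hr0 hr1 => ?_
  -- Moduli of the characters are compared at a point with Blaschke factor of modulus `r`.
  have hrn : ‖(r : ℂ)‖ = r := by rw [Complex.norm_real, Real.norm_of_nonneg hr0.le]
  have hz1 : ‖mob (-D.pt) r‖ < 1 := norm_mob_lt (by rwa [norm_neg]) (by rwa [hrn])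
  set z : ClosedDisc := ⟨mob (-D.pt) r, mem_closedBall_zero_iff.2 hz1.le⟩ with hz
  have hmz : mob D.pt z = r := mob_mob_neg hp (by rw [hrn]; exact hr1.le)
  have hzp : (z : ℂ) ≠ D.pt := by
    intro h
    rw [h, mob_self] at hmz
    exact hr0.ne (by exact_mod_cast hmz)
  set p : ClosedDisc := ⟨D.pt, mem_closedBall_zero_iff.2 hp.le⟩ with hpd
  have hep : (e p : ℂ) = D'.pt := (hpt p).1 rfl
  have hmod : ‖mob D'.pt (e z)‖ = r := by
    rw [← hep, norm_mob_discAut he hp hz1]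
    change ‖mob D.pt z‖ = r
    rw [hmz, hrn]
  have h1 := hC z z.2 hzp i
  have h2 := hC' (e z) (e z).2 ((hpt z).not.1 hzp) i
  rw [D'.ext_coe, ht, torusCoord_torusAct, ← D.ext_coe, h1] at h2
  have h3 := congrArg norm h2
  simp only [norm_mul, norm_prod, norm_zpow, Circle.norm_coe, one_zpow, Finset.prod_const_one,
    one_mul, hmz, hrn, hmod] at h3
  exact h3

theorem OrbiDisc.Equivalent.refl (D : P.OrbiDisc u) : D.Equivalent D :=
  ⟨rfl, Homeomorph.refl _, IsDiscAut.refl, fun _ => Iff.rfl, 1, fun _ => (P.torusAct_one _).symm⟩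

/-- The homomorphism at the orbifold point being injective, its order is the least common
denominator of the coordinates of the sector. -/
theorem IsLabeledPolytope.order_dvd_iff (hP : P.IsLabeledPolytope) {D : P.OrbiDisc u}
    (o : P.OrbiLift D.map D.pt D.order) {ν : Fin n → ℤ}
    (hφ : o.φ 1 = (QuotientAddGroup.mk ν : (Fin n → ℤ) ⧸ P.coneLattice o.cone)) (k : ℕ) :
    D.order ∣ k ↔ ∀ j, ∃ a : ℤ, k * P.coneExtend o.cone (P.dualCoord o.cone ν) j = a := by
  have h1 : o.φ (k : ZMod D.order) =
      (QuotientAddGroup.mk (k • ν) : (Fin n → ℤ) ⧸ P.coneLattice o.cone) := by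
    rw [← nsmul_one, map_nsmul, hφ]
    rfl
  rw [← ZMod.natCast_eq_zero_iff, ← map_eq_zero_iff o.φ o.injective, h1,
    QuotientAddGroup.eq_zero_iff, hP.mem_coneLattice, dualCoord_nsmul]
  simp only [Pi.smul_apply, smul_eq_mul]
  refine ⟨fun h j => ?_, fun h j => ?_⟩
  · by_cases hj : j ∈ Set.range o.cone.idx
    · obtain ⟨j, rfl⟩ := hj
      rw [coneExtend_idx]
      exact h j
    · exact ⟨0, by rw [coneExtend_of_notMem _ _ hj]; simp⟩
  · have := h (o.cone.idx j)
    rwa [coneExtend_idx] at this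

theorem OrbiDisc.order_eq_of_sector (hP : P.IsLabeledPolytope) {D D' : P.OrbiDisc u}
    {ν : Fin n → ℤ} (hν : D.HasSector ν) (hν' : D'.HasSector ν) : D.order = D'.order := by
  obtain ⟨o, hνo, hφ⟩ := hν
  obtain ⟨o', hνo', hφ'⟩ := hν'
  have hnn : ∀ s : P.MaxCone, ν ∈ P.boxCone s → ∀ j, 0 ≤ P.coneExtend s (P.dualCoord s ν) j := by
    intro s hs j
    by_cases hj : j ∈ Set.range s.idx
    · obtain ⟨j, rfl⟩ := hj
      rw [coneExtend_idx]
      exact (hP.dualCoord_mem_Ico hs j).1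
    · rw [coneExtend_of_notMem _ _ hj]
  have hc := hP.cone_coeff_unique (hnn _ hνo) (hnn _ hνo') (isCone_coneExtend _ _)
    (isCone_coneExtend _ _) fun i => by
      rw [sum_coneExtend, sum_coneExtend, hP.sum_dualCoord, hP.sum_dualCoord]
  have h1 : ∀ k, D.order ∣ k ↔ D'.order ∣ k := fun k => by
    rw [hP.order_dvd_iff o hφ, hP.order_dvd_iff o' hφ', hc]
  exact Nat.dvd_antisymm ((h1 _).2 dvd_rfl) ((h1 _).1 dvd_rfl)

/-- Minimal orbi-discs with the same sector are equivalent: both are monomial with the same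
exponents, so that they differ by the Blaschke factors and a rotation. -/
theorem OrbiDisc.IsMinimal.equivalent (hP : P.IsLabeledPolytope) (hu : u ∈ interior P.polytope)
    {D D' : P.OrbiDisc u} (hD : D.IsMinimal) (hD' : D'.IsMinimal)
    {ν : Fin n → ℤ} (hν : D.HasSector ν) (hν' : D'.HasSector ν) : D.Equivalent D' := by
  have hord := OrbiDisc.order_eq_of_sector hP hν hν'
  obtain ⟨a, c, d, ha, hc, hcI, hcν, hcd, hform⟩ := hD.hasMonomialForm hP hu hν
  obtain ⟨a', c', d', ha', hc', hcI', hcν', hcd', hform'⟩ := hD'.hasMonomialForm hP hu hν'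
  have hcc : c = c' := hP.cone_coeff_unique (fun j => (hc j).1) (fun j => (hc' j).1) hcI hcI'
    fun i => by rw [← hcν, ← hcν']
  have hk : (D.order : ℝ) ≠ 0 := by exact_mod_cast D.order_ne_zero
  have hdd : d = d' := by
    ext j
    have h1 := hcd j
    rw [hcc, hcd' j, ← hord, div_left_inj' hk] at h1
    exact_mod_cast h1.symm
  subst hdd
  have hp := D.norm_pt_lt
  have hp' := D'.norm_pt_lt
  have hnorm : ∀ j, ‖a' j‖ = ‖a j‖ := by
    intro j
    have h1 := (ha j).trans (ha' j).symm
    have h2 : ‖a' j‖ ^ 2 = ‖a j‖ ^ 2 := by linarith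
    exact (pow_left_inj₀ (norm_nonneg _) (norm_nonneg _) two_ne_zero).1 h2
  have ha0 : ∀ j, a j ≠ 0 := by
    intro j h
    have h1 := ha j
    have h2 := hP.ell_pos hu j
    rw [h, norm_zero] at h1
    linarith
  have hq : ∀ j, ‖a' j / a j‖ = 1 := fun j => by
    rw [norm_div, hnorm, div_self (norm_ne_zero_iff.2 (ha0 j))]
  -- The automorphism `φ'⁻¹ ∘ φ` of the disc and the rotations `a'_j / a_j` match the two forms.
  refine ⟨hord, (mobHomeo D.pt hp).trans (mobHomeo D'.pt hp').symm,
    (isDiscAut_mobHomeo _ _).trans (isDiscAut_mobHomeo _ _).symm, fun z => ?_,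
    fun j => ⟨a' j / a j, mem_sphere_zero_iff_norm.2 (hq j)⟩, fun z => ?_⟩
  · have hz := mem_closedBall_zero_iff.1 z.2
    change (z : ℂ) = D.pt ↔ mob (-D'.pt) (mob D.pt z) = D'.pt
    have hmz := norm_mob_le hp hz
    rw [← mob_eq_zero hp hz, ← mob_eq_zero hp' (norm_mob_le (by rwa [norm_neg]) hmz),
      mob_mob_neg hp' hmz]
  · set e := (mobHomeo D.pt hp).trans (mobHomeo D'.pt hp').symm with he
    have hez : mob D'.pt (e z) = mob D.pt z :=
      mob_mob_neg hp' (norm_mob_le hp (mem_closedBall_zero_iff.1 z.2))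
    have hζ : root D.order (mob D.pt z) ^ D.order = mob D.pt z := root_pow D.order_ne_zero _
    obtain ⟨h1, h2⟩ := hform z _ hζ
    obtain ⟨h3, h4⟩ := hform' (e z) (root D.order (mob D.pt z)) (by
      rw [← hord, hζ]; exact hez.symm)
    rw [h2, h4]
    refine P.point_eq_point 1 (by simp) (by simp) fun j => ?_
    change a' j / a j * (a j * _) = 1 * (a' j * _)
    field_simp [ha0 j]

/-! ### The index of a minimal orbi-disc -/

theorem OrbiDisc.IsMinimal.lift_ne_zero {D : P.OrbiDisc u} (hD : D.IsMinimal)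
    (l : P.LocalLift D.map D.pt) {z : ℂ} (hz : z ∈ l.V ∩ Metric.closedBall 0 1) (j : Fin n) :
    l.F z j ≠ 0 := by
  have h := hD.generic z hz.2 fun h => l.avoids (h ▸ hz.1)
  rw [D.ext_lift l hz.1 hz.2, isGeneric_chart] at h
  exact h j

theorem OrbiDisc.IsMinimal.orbiLift_ne_zero {D : P.OrbiDisc u} (hD : D.IsMinimal)
    (o : P.OrbiLift D.map D.pt D.order) {ζ : ℂ} (hζ : ζ ∈ Metric.ball (0 : ℂ) o.ε) (hζ0 : ζ ≠ 0)
    (j : Fin n) : o.F ζ j ≠ 0 := by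
  have h := hD.generic _ (Metric.ball_subset_closedBall (o.small ζ hζ))
    (by simpa [D.order_ne_zero] using hζ0)
  rw [D.ext_orbiLift o hζ, isGeneric_chart] at h
  exact h j

/-- The coordinates of an equivariant lift, divided by `ζ ^ wt`, are functions of `ζ ^ k`. -/
theorem OrbiLift.factor_invariant {w : ClosedDisc → P.X} {p : ℂ} {k : ℕ} (hk : k ≠ 0)
    (o : P.OrbiLift w p k) {j : Fin n} {g : ℂ → ℂ}
    (hg : ∀ ζ ∈ Metric.ball (0 : ℂ) o.ε, o.F ζ j = ζ ^ o.wt j * g ζ) {ζ ζ' : ℂ}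
    (hζ : ζ ∈ Metric.ball (0 : ℂ) o.ε) (h : ζ ^ k = ζ' ^ k) : g ζ = g ζ' := by
  by_cases hζ0 : ζ = 0
  · have h1 : ζ' = 0 := by
      rw [hζ0, zero_pow hk] at h
      exact (pow_eq_zero_iff hk).1 h.symm
    rw [hζ0, h1]
  · set ω := Complex.exp (2 * Real.pi * Complex.I / k) with hω
    have hprim : IsPrimitiveRoot ω k := Complex.isPrimitiveRoot_exp k hk
    have hωn : ‖ω‖ = 1 := hprim.norm'_eq_one hk
    have hω0 : ω ≠ 0 := hprim.ne_zero hk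
    have hmem : ∀ a : ℕ, ω ^ a * ζ ∈ Metric.ball (0 : ℂ) o.ε := by
      intro a
      rw [mem_ball_zero_iff, norm_mul, norm_pow, hωn, one_pow, one_mul]
      exact mem_ball_zero_iff.1 hζ
    have hpow : ∀ a : ℕ, g (ω ^ a * ζ) = g ζ := by
      intro a
      induction a with
      | zero => simp
      | succ a ih =>
        have h1 := o.equivariant_coord j (hmem a)
        have h2 : Complex.exp (2 * Real.pi * Complex.I * (o.wt j : ℂ) / k) = ω ^ o.wt j := by
          rw [hω, ← Complex.exp_nat_mul]; congr 1; ring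
        have h3 : Complex.exp (2 * Real.pi * Complex.I / k) * (ω ^ a * ζ) = ω ^ (a + 1) * ζ := by
          rw [← hω, pow_succ]; ring
        rw [h2, h3, hg _ (hmem _), hg _ (hmem _), pow_succ] at h1
        rw [← ih]
        have h4 : (ω ^ a * ω * ζ) ^ o.wt j ≠ 0 :=
          pow_ne_zero _ (mul_ne_zero (mul_ne_zero (pow_ne_zero _ hω0) hω0) hζ0)
        refine mul_left_cancel₀ h4 ?_
        rw [pow_succ, h1]
        simp only [mul_pow]
        ring
    have h5 : (ζ' / ζ) ^ k = 1 := by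
      rw [div_pow, h, div_self]
      rw [← h]
      exact pow_ne_zero _ hζ0
    have : NeZero k := ⟨hk⟩
    obtain ⟨a, -, ha⟩ := hprim.eq_pow_of_pow_eq_one h5
    have h6 : ζ' = ω ^ a * ζ := by rw [ha, div_mul_cancel₀ _ hζ0]
    rw [h6, hpow]

/-- A minimal orbi-disc has desingularized Maslov index zero: the logarithmic vector fields of the
torus action trivialize the desingularized bundle, and the Lagrangian tangent spaces are constant
in this frame. -/
theorem OrbiDisc.IsMinimal.hasDesingMaslovIndex (hP : P.IsLabeledPolytope) {D : P.OrbiDisc u}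
    (hD : D.IsMinimal) : D.HasDesingMaslovIndex 0 := by
  have hk := D.order_ne_zero
  choose g hgc hg0 hgF using hD.orbi
  have hgne : ∀ (o : P.OrbiLift D.map D.pt D.order) (j : Fin n), ∀ ζ ∈ Metric.ball (0 : ℂ) o.ε,
      g o j ζ ≠ 0 := by
    intro o j ζ hζ
    by_cases h0 : ζ = 0
    · rw [h0]; exact hg0 o j
    · have h1 := hD.orbiLift_ne_zero o hζ h0 j
      rw [hgF o j ζ hζ] at h1
      exact right_ne_zero_of_mul h1
  have hdet : ∀ (s : P.MaxCone) (x : Fin n → ℂ),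
      ((P.coneMat s).map Complex.ofRealHom * Matrix.diagonal fun j => (x j)⁻¹).det =
        P.coneDet s * (∏ j, x j)⁻¹ := by
    intro s x
    rw [Matrix.det_mul, Matrix.det_diagonal, det_map_coneMat, Finset.prod_inv_distrib]
  have hdet0 : ∀ (s : P.MaxCone) (x : Fin n → ℂ), (∀ j, x j ≠ 0) →
      ((P.coneMat s).map Complex.ofRealHom * Matrix.diagonal fun j => (x j)⁻¹).det ≠ 0 := by
    intro s x hx
    rw [hdet]
    exact mul_ne_zero (hP.coneDet_ne_zero s)
      (inv_ne_zero (Finset.prod_ne_zero_iff.2 fun j _ => hx j))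
  have hdiag : Continuous fun x : Fin n → ℂ => Matrix.diagonal x :=
    Continuous.matrix_diagonal continuous_id
  -- Off the orbifold point the frame is `B · diag(x)⁻¹`; at the orbifold point the powers
  -- `ζ ^ wt_j` are absorbed by the desingularization, and the remaining factors `g_j` descend to `z`.
  let T : DesingTriv D :=
    { A := fun l z => (P.coneMat l.cone).map Complex.ofRealHom *
        Matrix.diagonal fun j => (l.F z j)⁻¹
      continuousOn_A := fun l => by
        refine continuousOn_const.mul (hdiag.comp_continuousOn (continuousOn_pi.2 fun j => ?_))
        exact ((continuous_apply j).comp_continuousOn l.continuousOn).inv₀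
          fun z hz => hD.lift_ne_zero l hz j
      det_A := fun l z hz => hdet0 _ _ (hD.lift_ne_zero l hz)
      compat_A := fun l l' z hz τ hτ hev => by
        have h1 := P.jacobian_transition hτ (hD.lift_ne_zero l ⟨hz.1.1, hz.2⟩)
        rw [hev.self_of_nhdsWithin hz.2] at h1
        exact h1
      B := fun o z => (P.coneMat o.cone).map Complex.ofRealHom *
        Matrix.diagonal fun j => (g o j (root D.order (z - D.pt)))⁻¹
      continuousOn_B := fun o => by
        refine continuousOn_const.mul (hdiag.comp_continuousOn (continuousOn_pi.2 fun j => ?_))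
        intro z hz
        have hz' := root_mem_ball hk o.ε_pos hz
        refine ((continuousAt_comp_root hk Metric.isOpen_ball (hgc o j)
          (fun ζ hζ ζ' _ h => o.factor_invariant hk (hgF o j) hζ h)
          (fun ζ hζ ζ' h => ?_) hz').inv₀ (hgne o j _ hz')).continuousWithinAt
        rw [mem_ball_zero_iff] at hζ ⊢
        have h1 : ‖ζ'‖ ^ D.order = ‖ζ‖ ^ D.order := by rw [← norm_pow, h, norm_pow]
        rwa [(pow_left_inj₀ (norm_nonneg _) (norm_nonneg _) hk).1 h1]
      det_B := fun o z hz => hdet0 _ _ fun j => hgne o j _ (root_mem_ball hk o.ε_pos hz)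
      compat_B := fun o l ζ hζ hζ0 hV τ hτ hev => by
        have h1 := P.jacobian_transition hτ (hD.orbiLift_ne_zero o hζ hζ0)
        rw [hev.self_of_nhds] at h1
        rw [h1, mul_assoc, Matrix.diagonal_mul_diagonal]
        congr 2
        ext j
        have h2 : g o j (root D.order (D.pt + ζ ^ D.order - D.pt)) = g o j ζ := by
          refine (o.factor_invariant hk (hgF o j) hζ ?_).symm
          rw [root_pow hk]
          ring
        rw [h2, hgF o j ζ hζ, mul_inv, mul_comm] }
  -- The Lagrangian determinant is `i ^ n` times a real constant.
  refine ⟨T, fun _ => n * Real.pi, continuous_const, fun t l hV => ?_, by simp⟩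
  have hE : Complex.exp (t * Complex.I) ∈ Metric.closedBall (0 : ℂ) 1 :=
    mem_closedBall_zero_iff.2 (Complex.norm_exp_ofReal_mul_I t).le
  have hne := hD.lift_ne_zero l ⟨hV, hE⟩
  have h1 : T.lagDet l (Complex.exp (t * Complex.I)) = P.coneDet l.cone * Complex.I ^ n := by
    rw [T.lagDet_eq]
    change ((P.coneMat l.cone).map Complex.ofRealHom * Matrix.diagonal fun j => (l.F _ j)⁻¹).det *
      _ = _
    rw [hdet]
    have h2 : ∏ j, l.F (Complex.exp (t * Complex.I)) j ≠ 0 :=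
      Finset.prod_ne_zero_iff.2 fun j _ => hne j
    field_simp
  have h3 : ((‖P.coneDet l.cone‖ : ℝ) : ℂ) ^ 2 = P.coneDet l.cone ^ 2 := by
    rw [coneDet, Complex.norm_real, Real.norm_eq_abs, ← Complex.ofReal_pow, sq_abs]
    push_cast
    ring
  rw [h1, norm_mul, norm_pow, Complex.norm_I, one_pow, mul_one, h3, mul_pow,
    mul_div_cancel_left₀ _ (pow_ne_zero _ (hP.coneDet_ne_zero _)), ← pow_mul, mul_comm n 2, pow_mul,
    Complex.I_sq, ← Complex.exp_pi_mul_I, ← Complex.exp_nat_mul]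
  congr 1
  push_cast
  ring

/-! ### Monomial orbi-discs -/

/-- The monomial curve `(b_1 ζ^{d_1}, …, b_n ζ^{d_n})` in a chart. -/
def monCurve (b : Fin n → ℂ) (d : Fin n → ℕ) (ζ : ℂ) : Fin n → ℂ := fun j => b j * ζ ^ d j

theorem continuous_chart (s : P.MaxCone) : Continuous (P.chart s) := by
  have h1 : Continuous (P.chartCoord s) := by
    refine continuous_pi fun j => ?_
    by_cases hj : j ∈ Set.range s.idx
    · obtain ⟨j, rfl⟩ := hj
      simp only [chartCoord_idx]
      exact continuous_apply j
    · simp only [P.chartCoord_of_notMem s _ hj]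
      exact continuous_const
  exact continuous_quotient_mk'.comp (h1.subtype_mk _)

theorem continuous_monCurve (b : Fin n → ℂ) (d : Fin n → ℕ) : Continuous (monCurve b d) := by
  unfold monCurve
  fun_prop

theorem differentiable_monCurve (b : Fin n → ℂ) (d : Fin n → ℕ) :
    Differentiable ℂ (monCurve b d) := by
  unfold monCurve
  fun_prop

theorem monCurve_ne_zero {b : Fin n → ℂ} (hb : ∀ j, b j ≠ 0) (d : Fin n → ℕ) {ζ : ℂ}
    (hζ : ζ ≠ 0) (j : Fin n) : monCurve b d ζ j ≠ 0 := mul_ne_zero (hb j) (pow_ne_zero _ hζ)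

theorem torusCoord_monCurve (s : P.MaxCone) (b : Fin n → ℂ) (d : Fin n → ℕ) (ζ : ℂ) (i : Fin n) :
    P.torusCoord (P.chart s (monCurve b d ζ)) i =
      P.coneMon s b i * P.coneMon s (fun j => ζ ^ d j) i := by
  rw [torusCoord_chart, ← coneMon_mul]
  rfl

/-- With weights adapted to a sector, the monomial curve depends only on `ζ ^ k`. -/
theorem chart_monCurve_eq (hP : P.IsLabeledPolytope) {s : P.MaxCone} {ν : Fin n → ℤ} {k : ℕ}
    (hk : k ≠ 0) {d : Fin n → ℕ} (h : ∀ j, P.dualCoord s ν j = d j / k) {b : Fin n → ℂ}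
    (hb : ∀ j, b j ≠ 0) {ζ ζ' : ℂ} (hζ : ζ ^ k = ζ' ^ k) :
    P.chart s (monCurve b d ζ) = P.chart s (monCurve b d ζ') := by
  by_cases h0 : ζ = 0
  · rw [h0, zero_pow hk] at hζ
    rw [h0, (pow_eq_zero_iff hk).1 hζ.symm]
  · have h0' : ζ' ≠ 0 := by
      rintro rfl
      rw [zero_pow hk] at hζ
      exact h0 ((pow_eq_zero_iff hk).1 hζ)
    refine P.torusCoord_injOn ((P.isGeneric_chart _ _).2 (monCurve_ne_zero hb d h0))
      ((P.isGeneric_chart _ _).2 (monCurve_ne_zero hb d h0')) ?_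
    ext i
    rw [torusCoord_monCurve, torusCoord_monCurve, coneMon_pow_wt hP hk h h0,
      coneMon_pow_wt hP hk h h0', hζ]

/-- A lattice vector has finite order modulo the sublattice of a cone: it is killed by the
determinant. -/
theorem IsLabeledPolytope.exists_nsmul_mem (hP : P.IsLabeledPolytope) (s : P.MaxCone)
    (ν : Fin n → ℤ) : ∃ K : ℕ, 0 < K ∧ K • ν ∈ P.coneLattice s := by
  set M : Matrix (Fin n) (Fin n) ℤ := Matrix.of fun i j => P.stacky (s.idx j) i with hM
  have hdet : M.det ≠ 0 := by
    intro h
    have h1 := RingHom.map_det (Int.castRingHom ℝ) M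
    rw [h, map_zero] at h1
    exact hP.det_coneMat_ne_zero s h1.symm
  have hmem : M.det • ν ∈ P.coneLattice s := by
    rw [hP.mem_coneLattice]
    have h1 : M.mulVec (M.adjugate.mulVec ν) = M.det • ν := by
      rw [Matrix.mulVec_mulVec, Matrix.mul_adjugate, Matrix.smul_mulVec, Matrix.one_mulVec]
    have h2 := hP.dualCoord_eq_of_sum s (ν := M.det • ν)
      (c := fun j => ((M.adjugate.mulVec ν) j : ℝ)) fun i => by
        rw [← h1]
        simp only [Matrix.mulVec, dotProduct, hM, Matrix.of_apply]
        push_cast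
        exact Finset.sum_congr rfl fun j _ => mul_comm _ _
    intro j
    exact ⟨_, congrFun h2 j⟩
  refine ⟨M.det.natAbs, Int.natAbs_pos.2 hdet, ?_⟩
  rcases Int.natAbs_eq M.det with h | h
  · rw [h, natCast_zsmul] at hmem
    exact hmem
  · rw [h, neg_smul, natCast_zsmul] at hmem
    exact neg_mem_iff.1 hmem

/-- The order of a nonzero element of the box and the weights `d_j = k c_j`. -/
theorem IsLabeledPolytope.exists_order (hP : P.IsLabeledPolytope) {s : P.MaxCone} {ν : Fin n → ℤ}
    (hν : ν ∈ P.boxCone s) (hν0 : ν ≠ 0) :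
    ∃ k : ℕ, 2 ≤ k ∧ addOrderOf (QuotientAddGroup.mk ν : (Fin n → ℤ) ⧸ P.coneLattice s) = k ∧
      ∃ d : Fin n → ℕ, (∀ j, d j < k) ∧ ∀ j, P.dualCoord s ν j = d j / k := by
  set x : (Fin n → ℤ) ⧸ P.coneLattice s := QuotientAddGroup.mk ν with hx
  obtain ⟨K, hK, hKν⟩ := hP.exists_nsmul_mem s ν
  have hc := hP.dualCoord_mem_Ico hν
  have hpos : 0 < addOrderOf x := by
    rw [addOrderOf_pos_iff, isOfFinAddOrder_iff_nsmul_eq_zero]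
    exact ⟨K, hK, (QuotientAddGroup.eq_zero_iff (K • ν)).2 hKν⟩
  have hone : addOrderOf x ≠ 1 := by
    rw [Ne, AddMonoid.addOrderOf_eq_one_iff, hx, QuotientAddGroup.eq_zero_iff, hP.mem_coneLattice]
    intro h
    refine hν0 ?_
    have h1 : ∀ j, P.dualCoord s ν j = 0 := by
      intro j
      obtain ⟨a, ha⟩ := h j
      obtain ⟨h2, h3⟩ := hc j
      rw [ha] at h2 h3 ⊢
      have e1 : 0 ≤ a := by exact_mod_cast h2
      have e2 : a < 1 := by exact_mod_cast h3
      have e3 : a = 0 := by omega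
      rw [e3, Int.cast_zero]
    ext i
    have h2 := hP.sum_dualCoord s ν i
    simp only [h1, zero_mul, Finset.sum_const_zero] at h2
    exact_mod_cast h2.symm
  have hmem : addOrderOf x • ν ∈ P.coneLattice s := by
    rw [← QuotientAddGroup.eq_zero_iff]
    exact addOrderOf_nsmul_eq_zero x
  rw [hP.mem_coneLattice] at hmem
  have hkR : (0 : ℝ) < addOrderOf x := by exact_mod_cast hpos
  have hd : ∀ j, ∃ d : ℕ, d < addOrderOf x ∧ P.dualCoord s ν j = d / addOrderOf x := by
    intro j
    obtain ⟨a, ha⟩ := hmem j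
    rw [dualCoord_nsmul, Pi.smul_apply, smul_eq_mul] at ha
    obtain ⟨h2, h3⟩ := hc j
    have h4 : (0 : ℝ) ≤ a := by rw [← ha]; positivity
    have h5 : 0 ≤ a := by exact_mod_cast h4
    obtain ⟨d, rfl⟩ := Int.eq_ofNat_of_zero_le h5
    refine ⟨d, ?_, ?_⟩
    · have h6 : (d : ℝ) < addOrderOf x := by
        have : ((d : ℤ) : ℝ) = d := by norm_cast
        rw [← this, ← ha]
        nlinarith
      exact_mod_cast h6
    · rw [eq_div_iff hkR.ne', mul_comm, ha]
      norm_cast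
  choose d hd1 hd2 using hd
  exact ⟨_, by omega, rfl, d, hd1, hd2⟩

/-- The equivariant lift of a monomial orbi-disc at the origin. -/
theorem IsLabeledPolytope.exists_monomial_orbiLift (hP : P.IsLabeledPolytope) {s : P.MaxCone}
    {ν : Fin n → ℤ} (hν : ν ∈ P.boxCone s) {k : ℕ} (hk : k ≠ 0)
    (hord : addOrderOf (QuotientAddGroup.mk ν : (Fin n → ℤ) ⧸ P.coneLattice s) = k)
    {d : Fin n → ℕ} (hdk : ∀ j, d j < k) (hd : ∀ j, P.dualCoord s ν j = d j / k) (b : Fin n → ℂ)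
    {w : ClosedDisc → P.X}
    (hw : ∀ (z : ClosedDisc) (ζ : ℂ), ζ ^ k = z → w z = P.chart s (monCurve b d ζ)) :
    ∃ o : P.OrbiLift w 0 k, ν ∈ P.boxCone o.cone ∧
      o.φ 1 = (QuotientAddGroup.mk ν : (Fin n → ℤ) ⧸ P.coneLattice o.cone) := by
  set x : (Fin n → ℤ) ⧸ P.coneLattice s := QuotientAddGroup.mk ν with hx
  have hkx : (zmultiplesHom ((Fin n → ℤ) ⧸ P.coneLattice s) x) k = 0 := by
    rw [zmultiplesHom_apply, natCast_zsmul, ← hord]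
    exact addOrderOf_nsmul_eq_zero x
  set φ : ZMod k →+ (Fin n → ℤ) ⧸ P.coneLattice s := ZMod.lift k ⟨zmultiplesHom _ x, hkx⟩ with hφ
  have hφ1 : φ 1 = x := by
    have h := ZMod.lift_coe k ⟨zmultiplesHom _ x, hkx⟩ 1
    rw [Int.cast_one] at h
    rw [hφ, h]
    simp
  have hact : ∀ ν' : Fin n → ℤ, (QuotientAddGroup.mk ν' : (Fin n → ℤ) ⧸ P.coneLattice s) = φ 1 →
      ∀ j, Complex.exp (2 * Real.pi * Complex.I * (P.dualCoord s ν' j : ℂ)) =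
        Complex.exp (2 * Real.pi * Complex.I * (d j : ℂ) / k) := by
    intro ν' hν' j
    rw [hφ1, hx] at hν'
    obtain ⟨a, ha⟩ := (hP.mk_eq_mk_iff s ν ν').1 hν'.symm j
    rw [Complex.exp_eq_exp_iff_exists_int]
    refine ⟨a, ?_⟩
    rw [ha, hd]
    push_cast
    ring
  refine ⟨⟨1, one_pos, fun ζ hζ => ?_, s, monCurve b d, (differentiable_monCurve b d).differentiableOn,
    fun ζ _ z hz => hw z ζ (by rw [hz, zero_add]), φ, ?_, fun ν' hν' ζ _ => ?_, d, hdk,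
    fun ν' hν' y j => ?_⟩, hν, hφ1⟩
  · rw [zero_add, mem_ball_zero_iff, norm_pow]
    exact pow_lt_one₀ (norm_nonneg _) (mem_ball_zero_iff.1 hζ) hk
  · rw [hφ, ZMod.lift_injective]
    intro a ha
    rw [ZMod.intCast_zmod_eq_zero_iff_dvd, ← hord, addOrderOf_dvd_iff_zsmul_eq_zero]
    simpa using ha
  · ext j
    simp only [latAct, monCurve, hact ν' hν']
    rw [mul_pow, ← Complex.exp_nat_mul]
    have : (d j : ℂ) * (2 * Real.pi * Complex.I / k) = 2 * Real.pi * Complex.I * (d j : ℂ) / k := by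
      ring
    rw [this]
    ring
  · simp only [latAct, hact ν' hν']

/-- Away from the origin, a monomial orbi-disc lifts by a branch of the `k`-th root. -/
theorem exists_monomial_localLift {s : P.MaxCone} {k : ℕ} (hk : k ≠ 0) (b : Fin n → ℂ)
    (d : Fin n → ℕ) {w : ClosedDisc → P.X}
    (hw : ∀ (z : ClosedDisc) (ζ : ℂ), ζ ^ k = z → w z = P.chart s (monCurve b d ζ)) {z₀ : ℂ}
    (hz₀ : z₀ ≠ 0) : ∃ l : P.LocalLift w 0, z₀ ∈ l.V := by
  set V : Set ℂ := (fun z => z / z₀) ⁻¹' Complex.slitPlane with hV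
  set r : ℂ → ℂ := fun z => root k z₀ * Complex.exp (Complex.log (z / z₀) / k) with hr
  have hVo : IsOpen V := Complex.isOpen_slitPlane.preimage (by fun_prop)
  have hk' : (k : ℂ) ≠ 0 := by exact_mod_cast hk
  have hrk : ∀ z ∈ V, r z ^ k = z := by
    intro z hz
    rw [hr, mul_pow, root_pow hk, ← Complex.exp_nat_mul, mul_div_cancel₀ _ hk',
      Complex.exp_log (Complex.slitPlane_ne_zero hz), mul_div_cancel₀ _ hz₀]
  have hrd : DifferentiableOn ℂ r V := by
    intro z hz
    refine DifferentiableAt.differentiableWithinAt ?_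
    exact ((((differentiableAt_id.div_const z₀).clog hz).div_const _).cexp).const_mul _
  have hFd : DifferentiableOn ℂ (fun z => monCurve b d (r z)) V :=
    (differentiable_monCurve b d).comp_differentiableOn hrd
  refine ⟨⟨V, hVo, fun h => ?_, s, fun z => monCurve b d (r z),
    hFd.continuousOn.mono Set.inter_subset_left, hFd.mono Set.inter_subset_left,
    fun z hz => hw z _ (hrk z hz)⟩, ?_⟩
  · refine Complex.slitPlane_ne_zero h ?_
    simp
  · change z₀ / z₀ ∈ Complex.slitPlane
    rw [div_self hz₀]
    exact Complex.one_mem_slitPlane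

/-- Every nonzero element of the box is the sector of a monomial orbi-disc, which is minimal. -/
theorem IsLabeledPolytope.exists_isMinimal (hP : P.IsLabeledPolytope)
    (hu : u ∈ interior P.polytope) {ν : Fin n → ℤ} (hν : ν ∈ P.box') :
    ∃ D : P.OrbiDisc u, D.IsMinimal ∧ D.HasSector ν := by
  obtain ⟨hνb, hν0⟩ := hν
  obtain ⟨s, hs⟩ := Set.mem_iUnion.1 hνb
  obtain ⟨k, hk2, hord, d, hdk, hd⟩ := hP.exists_order hs hν0
  have hk : k ≠ 0 := by omega
  have hr : ∀ j, 0 < √(2 * P.ell j u) := fun j =>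
    Real.sqrt_pos.2 (mul_pos two_pos (hP.ell_pos hu j))
  have hr0 : ∀ j, (√(2 * P.ell j u) : ℂ) ≠ 0 := fun j => by exact_mod_cast (hr j).ne'
  -- The chart coordinates `b` of a point of `L(u)`: the one with real positive homogeneous
  -- coordinates.
  obtain ⟨b, hb0, hb, -⟩ := hP.exists_coneMon_eq s
    (y := fun i => ∏ j, (√(2 * P.ell j u) : ℂ) ^ P.stacky j i) fun i =>
      Finset.prod_ne_zero_iff.2 fun j _ => zpow_ne_zero _ (hr0 j)
  set w : ClosedDisc → P.X := fun z => P.chart s (monCurve b d (root k z)) with hwdef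
  have hw : ∀ (z : ClosedDisc) (ζ : ℂ), ζ ^ k = z → w z = P.chart s (monCurve b d ζ) :=
    fun z ζ hζ => chart_monCurve_eq hP hk hd hb0 (by rw [root_pow hk, hζ])
  have hwc : Continuous w := by
    have h1 : Continuous fun z : ℂ => P.chart s (monCurve b d (root k (z - 0))) := by
      refine continuous_iff_continuousAt.2 fun z => ?_
      exact continuousAt_comp_root hk isOpen_univ
        (((continuous_chart s).comp (continuous_monCurve b d)).continuousOn)
        (fun ζ _ ζ' _ h => chart_monCurve_eq hP hk hd hb0 h) (fun _ _ _ _ => trivial) trivial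
    simp only [sub_zero] at h1
    exact h1.comp continuous_subtype_val
  have hbd : ∀ z : ClosedDisc, ‖(z : ℂ)‖ = 1 → w z ∈ P.fiber u := by
    intro z hz
    set ζ := root k z with hζ
    have hζn : ‖ζ‖ = 1 := by
      have h1 : ‖ζ‖ ^ k = 1 := by rw [← norm_pow, hζ, root_pow hk, hz]
      exact (pow_eq_one_iff_of_nonneg (norm_nonneg _) hk).1 h1
    have hζ0 : ζ ≠ 0 := norm_ne_zero_iff.1 (by rw [hζn]; exact one_ne_zero)
    have hU : (fun j => (√(2 * P.ell j u) : ℂ) * ζ ^ P.coneExtend s d j) ∈ P.U :=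
      (isCone_coneExtend s d).mono fun j hj _ => mul_ne_zero (hr0 j) (pow_ne_zero _ hζ0) hj
    refine ⟨_, hU, P.torusCoord_injOn ((P.isGeneric_chart _ _).2 (monCurve_ne_zero hb0 d hζ0))
      (fun j => mul_ne_zero (hr0 j) (pow_ne_zero _ hζ0)) ?_, fun j => ?_⟩
    · ext i
      rw [torusCoord_monCurve, torusCoord_point]
      simp only [mul_zpow, Finset.prod_mul_distrib]
      rw [prod_pow_coneExtend, hb]
    · rw [norm_mul, norm_pow, hζn, one_pow, mul_one, Complex.norm_real,
        Real.norm_of_nonneg (hr j).le, Real.sq_sqrt (mul_pos two_pos (hP.ell_pos hu j)).le]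
      ring
  obtain ⟨o, ho, hoφ⟩ := hP.exists_monomial_orbiLift hs hk hord hdk hd b hw
  set D : P.OrbiDisc u :=
    { pt := 0
      pt_mem := by simp
      order := k
      two_le_order := hk2
      map := w
      continuous := hwc
      exists_lift := fun z hz => exists_monomial_localLift hk b d hw hz
      exists_orbiLift := ⟨o⟩
      boundary := hbd } with hDdef
  have hext : ∀ (z ζ : ℂ), z ∈ Metric.closedBall (0 : ℂ) 1 → ζ ^ k = z →
      D.ext z = P.chart s (monCurve b d ζ) := by
    intro z ζ hz hζ
    rw [D.ext_of_mem hz]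
    exact hw ⟨z, hz⟩ ζ hζ
  refine ⟨D, ⟨fun z hz hz0 => ?_, fun o' => ?_⟩, o, ho, hoφ⟩
  · have hζ : root k z ^ k = z := root_pow hk z
    rw [hext z _ hz hζ]
    refine (P.isGeneric_chart _ _).2 (monCurve_ne_zero hb0 d fun h => ?_)
    rw [h, zero_pow hk] at hζ
    exact hz0 hζ.symm
  · -- Comparison of the characters determines the orders of vanishing in any other lift.
    obtain ⟨q, g, hgc, hg0, hF⟩ := D.exists_orbiLift_eq hP hu o'
    have hball := Metric.ball_mem_nhds (0 : ℂ) o'.ε_pos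
    set N : Fin n → ℕ := fun j => o'.wt j + k * q j with hN
    have hgc' : ContinuousAt (fun ζ => fun j => g j ζ) 0 :=
      continuousAt_pi.2 fun j => (hgc j).continuousAt hball
    have hexp : ∀ i, ∑ j, (N j : ℤ) * P.stacky (o'.cone.idx j) i =
        ∑ j, (d j : ℤ) * P.stacky (s.idx j) i := by
      intro i
      have hg0' := P.coneMon_ne_zero o'.cone (x := fun j => g j 0) hg0 i
      have hlim : Filter.Tendsto (fun ζ => P.coneMon s b i / P.coneMon o'.cone (fun j => g j ζ) i)
          (𝓝[≠] 0) (𝓝 (P.coneMon s b i / P.coneMon o'.cone (fun j => g j 0) i)) := by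
        have h2 : ContinuousAt (fun ζ => P.coneMon o'.cone (fun j => g j ζ) i) 0 :=
          ContinuousAt.comp (f := fun ζ => fun j => g j ζ)
            (P.coneMon_continuousAt o'.cone hg0 i) hgc'
        exact (tendsto_const_nhds.div h2.tendsto hg0').mono_left nhdsWithin_le_nhds
      rw [← sub_eq_zero]
      refine eq_zero_of_tendsto_zpow (div_ne_zero (P.coneMon_ne_zero s hb0 i) hg0')
        (hlim.congr' ?_)
      have hgne : ∀ᶠ ζ in 𝓝 (0 : ℂ), ∀ j, g j ζ ≠ 0 := Filter.eventually_all.2 fun j =>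
        ((hgc j).continuousAt hball).eventually_ne (hg0 j)
      filter_upwards [nhdsWithin_le_nhds hball, self_mem_nhdsWithin,
        nhdsWithin_le_nhds hgne] with ζ hζ hζ0 hgζ
      have h1 := D.ext_orbiLift o' hζ
      rw [hext _ ζ (Metric.ball_subset_closedBall (o'.small ζ hζ)) (zero_add _).symm] at h1
      have h2 := congrFun (congrArg P.torusCoord h1) i
      have h3 : o'.F ζ = fun j => ζ ^ N j * g j ζ := by
        ext j; exact hF j ζ hζ
      rw [torusCoord_monCurve, torusCoord_chart, h3, coneMon_mul, P.coneMon_pow s hζ0,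
        P.coneMon_pow o'.cone hζ0] at h2
      have h4 := P.coneMon_ne_zero o'.cone hgζ i
      rw [zpow_sub₀ hζ0, div_eq_div_iff h4 (zpow_ne_zero _ hζ0)]
      exact h2
    have hcone := hP.cone_coeff_unique (c := P.coneExtend o'.cone fun j => (N j : ℝ))
      (c' := P.coneExtend s fun j => (d j : ℝ)) (fun j => ?_) (fun j => ?_)
      (isCone_coneExtend _ _) (isCone_coneExtend _ _) fun i => by
        rw [sum_coneExtend, sum_coneExtend]
        exact_mod_cast hexp i
    · have hq : ∀ j, q j = 0 := by
        intro j
        have h1 := congrFun hcone (o'.cone.idx j)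
        rw [coneExtend_idx] at h1
        have h2 : N j < k := by
          by_cases hj : o'.cone.idx j ∈ Set.range s.idx
          · obtain ⟨j', hj'⟩ := hj
            rw [← hj', coneExtend_idx] at h1
            have h3 : N j = d j' := by exact_mod_cast h1
            rw [h3]
            exact hdk j'
          · rw [coneExtend_of_notMem _ _ hj] at h1
            have h3 : N j = 0 := by exact_mod_cast h1
            omega
        by_contra h0
        have h3 : k ≤ k * q j := Nat.le_mul_of_pos_right k (Nat.pos_of_ne_zero h0)
        simp only [hN] at h2
        omega
      refine ⟨g, hgc, hg0, fun j ζ hζ => ?_⟩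
      rw [hF j ζ hζ, hq j, mul_zero, add_zero]
    · by_cases hj : j ∈ Set.range o'.cone.idx
      · obtain ⟨j, rfl⟩ := hj
        rw [coneExtend_idx]
        positivity
      · rw [coneExtend_of_notMem _ _ hj]
    · by_cases hj : j ∈ Set.range s.idx
      · obtain ⟨j, rfl⟩ := hj
        rw [coneExtend_idx]
        positivity
      · rw [coneExtend_of_notMem _ _ hj]

end PolytopeData

end

/-! ### Classification of the orbi-discs of index zero -/

theorem mainTheorem2 {n m : ℕ} (P : PolytopeData n m) (hP : P.IsLabeledPolytope)
    (u : Fin n → ℝ) (hu : u ∈ interior P.polytope) :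
    ∃ Ψ : Quotient (P.basicSetoid u) ≃ P.box',
      ∀ D : P.BasicOrbiDisc u,
        (∀ ν : Fin n → ℤ, D.1.HasSector ν ↔ ν = (Ψ (Quotient.mk (P.basicSetoid u) D) : Fin n → ℤ)) ∧
        D.1.HasMonomialForm (Ψ (Quotient.mk (P.basicSetoid u) D) : Fin n → ℤ) := by
  have hmin (D : P.BasicOrbiDisc u) : D.1.IsMinimal := D.1.isMinimal_of_index_zero hP hu D.2
  choose sec hsec using fun D : P.BasicOrbiDisc u => hP.exists_sector D.1
  let Φ : Quotient (P.basicSetoid u) → P.box' :=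
    Quotient.lift (fun D => ⟨sec D, (hsec D).mem_box'⟩) fun D D' h =>
      Subtype.ext ((hmin D).sector_eq hP hu (hmin D') h (hsec D) (hsec D'))
  have hΦ : Function.Bijective Φ := by
    constructor
    · intro x y
      induction x using Quotient.inductionOn with | h D => ?_
      induction y using Quotient.inductionOn with | h D' => ?_
      intro h
      have hs : sec D = sec D' := congrArg Subtype.val h
      exact Quotient.sound ((hmin D).equivalent hP hu (hmin D') (hsec D) (hs ▸ hsec D'))
    · rintro ⟨ν, hν⟩
      obtain ⟨D, hD, hDν⟩ := hP.exists_isMinimal hu hν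
      refine ⟨Quotient.mk _ ⟨D, hD.hasDesingMaslovIndex hP⟩, Subtype.ext ?_⟩
      exact hD.sector_eq hP hu hD (PolytopeData.OrbiDisc.Equivalent.refl D) (hsec ⟨D, _⟩) hDν
  refine ⟨Equiv.ofBijective Φ hΦ, fun D => ⟨fun ν => ⟨fun h => ?_, ?_⟩, ?_⟩⟩
  · exact (hmin D).sector_eq hP hu (hmin D) (PolytopeData.OrbiDisc.Equivalent.refl D.1) h (hsec D)
  · rintro rfl
    exact hsec D
  · exact (hmin D).hasMonomialForm hP hu (hsec D)
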